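/- Theorem 6.4. Let $\Sigma$ be the Klein bottle, $\mathbb{R}^2$ modulo the group $G$ generated by $(x,y)\mapsto(x+1,-y)$ and $(x,y)\mapsto(x,y+1)$. A ruled 3-fold over $\Sigma$ is an immersed (possibly singular) 3-fold $N$ with a smooth projection $\pi:N\to\Sigma$ whose fibres are mapped bijectively onto affine real lines in $\mathbb{C}^3$, depending smoothly on $\sigma\in\Sigma$. It is r-orientable if its lines can be oriented continuously in $\sigma\in\Sigma$. It is special Lagrangian (SL) if its nonsingular points are dense and its tangent planes there, suitably oriented, are calibrated by $\operatorname{Re}(dz_1\wedge dz_2\wedge dz_3)$. Its asymptotic cone is the set of vectors parallel to its lines. Let $N_0$ be a two-sided (immersed) SL cone in $\mathbb{C}^3$ over $\Sigma$: a ruled SL 3-fold over $\Sigma$ all of whose lines pass through $0$, nonsingular except at $0$. Let $\tilde\Sigma\to\Sigma$ be the double cover whose points are the unit vectors in the lines of $N_0$, with its tautological map $\phi:\tilde\Sigma\to\mathcal{S}^5$ and with the complex structure $J$ determined by the metric $\phi^*g$ and the orientation for which $\operatorname{Re}\Omega(\phi,d\phi(\cdot),d\phi(\cdot))>0$, where $\Omega=dz_1\wedge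 dz_2\wedge dz_3$. Let $-1:\tilde\Sigma\to\tilde\Sigma$ be the involution that changes the sign of the unit vector, so that $\phi\circ(-1)=-\phi$. Let $W$ be the real vector space of holomorphic vector fields $w$ on $\tilde\Sigma$ (smooth real vector fields with $\mathcal{L}_wJ=0$) that change sign under $-1$. Then $N_0$ is not r-orientable, and $\dim_{\mathbb{R}}W=1$. For each $w\in W$, the lines $\{r\,\phi(\tilde\sigma)+(\mathcal{L}_w\phi)(\tilde\sigma):r\in\mathbb{R}\}$, $\tilde\sigma\in\tilde\Sigma$, depend only on the image of $\tilde\sigma$ in $\Sigma$ and form a ruled SL 3-fold $N_w$ over $\Sigma$. It is not r-orientable, it has asymptotic cone $N_0$, and it is asymptotic to $N_0$ with order $O(r^{-1})$ in the following sense. There are a compact $K\subset N_w$, a constant $R>0$ and a diffeomorphism $\Phi$ from the part of $N_0$ outside the closed ball $\overline{B}_R(0)$ to $N_w\setminus K$ such that $|\nabla^k(\iota\circ\Phi-\iota_0)|=O(r^{-1-k})$ as $r\to\infty$ for all $k\ge 0$, where $\iota,\iota_0$ are the immersions of $N_w,N_0$ in $\mathbb{C}^3$, and $\nabla$ and $|\cdot|$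 are those of the cone metric on $N_0$. The $N_w$ are distinct as ruled immersed submanifolds: if $w\ne w'$ there is no homeomorphism $f:\Sigma\to\Sigma$ such that, for every $\sigma\in\Sigma$, the line of $N_{w'}$ over $f(\sigma)$ is the line of $N_w$ over $\sigma$. -/

import Mathlib

open scoped ContDiff

/-! ### Linear algebra of special Lagrangian planes in `ℂ³` -/

/-- `ℂ³` with its Euclidean metric (as a real inner product space: `g = Σ |dz_j|²`). -/
abbrev C3 : Type := EuclideanSpace ℂ (Fin 3)

/-- The holomorphic volume form `Ω = dz₁ ∧ dz₂ ∧ dz₃`. -/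
noncomputable def holVol (v : Fin 3 → C3) : ℂ :=
  Matrix.det (Matrix.of fun i j => v i j)

/-- `Re Ω (v₁, v₂, v₃) = ± vol (v₁, v₂, v₃)`. If `v` is a basis of a real 3-plane, this says that
one of the two orientations makes the plane calibrated by `Re Ω` (special Lagrangian, phase 1);
that orientation is then the one on which `Re Ω` is positive. -/
def IsCalibratedTriple (v : Fin 3 → C3) : Prop :=
  |(holVol v).re| = Real.sqrt (Matrix.det (Matrix.of fun i j => inner ℝ (v i) (v j)))

/-! ### The Klein bottle -/

/-- The deck transformations of `ℝ²` over the Klein bottle: the group generated by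
`(x, y) ↦ (x + 1, -y)` and `(x, y) ↦ (x, y + 1)`. -/
noncomputable def deck (m n : ℤ) (x : ℝ × ℝ) : ℝ × ℝ :=
  (x.1 + m, (m.negOnePow : ℤ) * x.2 + n)

/-- The derivative of `deck m n` (at any point). -/
noncomputable def deckLin (m : ℤ) (v : ℝ × ℝ) : ℝ × ℝ :=
  (v.1, (m.negOnePow : ℤ) * v.2)

theorem negOnePow_mul_self_real (m : ℤ) :
    ((m.negOnePow : ℤ) : ℝ) * ((m.negOnePow : ℤ) : ℝ) = 1 := by
  rw [← Int.cast_mul, ← Units.val_mul, ← Int.negOnePow_add, Int.negOnePow_even _ ⟨m, rfl⟩]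
  simp

theorem deck_zero (x : ℝ × ℝ) : deck 0 0 x = x := by
  simp [deck]

theorem deck_deck (m n p q : ℤ) (x : ℝ × ℝ) :
    deck p q (deck m n x) = deck (m + p) ((p.negOnePow : ℤ) * n + q) x := by
  ext
  · simp [deck]; ring
  · simp [deck, Int.negOnePow_add]; ring

theorem deck_inv (m n : ℤ) (x : ℝ × ℝ) :
    deck (-m) (-((m.negOnePow : ℤ) * n)) (deck m n x) = x := by
  ext
  · simp [deck]
  · simp only [deck, Int.negOnePow_neg]
    push_cast
    linear_combination x.2 * negOnePow_mul_self_real m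

/-- Two points of `ℝ²` are equivalent if a deck transformation maps one to the other. -/
def kleinSetoid : Setoid (ℝ × ℝ) where
  r x y := ∃ m n : ℤ, deck m n x = y
  iseqv :=
    { refl := fun x => ⟨0, 0, deck_zero x⟩
      symm := by
        rintro x _ ⟨m, n, rfl⟩
        exact ⟨_, _, deck_inv m n x⟩
      trans := by
        rintro x _ _ ⟨m, n, rfl⟩ ⟨p, q, rfl⟩
        exact ⟨_, _, (deck_deck m n p q x).symm⟩ }

/-- The Klein bottle, with the quotient topology. -/
abbrev KleinBottle : Type := Quotient kleinSetoid

/-- The universal covering map `ℝ² → KleinBottle`. -/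
def kleinMk (x : ℝ × ℝ) : KleinBottle := Quotient.mk kleinSetoid x

/-! ### Ruled 3-folds in `ℂ³` over the Klein bottle -/

/-- A ruled, immersed (possibly singular) 3-fold `(N, Σ, π)` in `ℂ³` whose base `Σ` is the Klein
bottle. It is a smooth family of affine real lines `σ ↦ line σ` in `ℂ³`, `σ ∈ Σ`. As `ℝ²` is
simply connected, the pulled back family of lines on `ℝ²` has a smooth unit direction `dir` and
has the form `{ r dir x + foot x : r ∈ ℝ }`, where `foot x` is the point of the line orthogonal to
`dir x`. That the lines depend only on the class of `x` in the Klein bottle means that `dir` is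
invariant up to sign and `foot` is invariant under deck transformations. -/
structure RuledThreefold where
  dir : ℝ × ℝ → C3
  foot : ℝ × ℝ → C3
  contDiff_dir : ContDiff ℝ ∞ dir
  contDiff_foot : ContDiff ℝ ∞ foot
  norm_dir : ∀ x, ‖dir x‖ = 1
  inner_dir_foot : ∀ x, inner ℝ (dir x) (foot x) = 0
  dir_deck : ∀ (m n : ℤ) (x : ℝ × ℝ), dir (deck m n x) = dir x ∨ dir (deck m n x) = -dir x
  foot_deck : ∀ (m n : ℤ) (x : ℝ × ℝ), foot (deck m n x) = foot x

namespace RuledThreefold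

/-- The immersion `(r, x) ↦ r dir x + foot x` on the universal cover `ℝ × ℝ²` of `N`. -/
noncomputable def imm (N : RuledThreefold) (y : ℝ × ℝ × ℝ) : C3 :=
  y.1 • N.dir y.2 + N.foot y.2

/-- The universal covering map from `ℝ × ℝ²` to the 3-manifold `N`, which is realized as the
subset `{ (σ, z) : z ∈ line σ }` of `Σ × ℂ³`; then `π` and the immersion `ι` of `N` are the two
projections. This map is a local diffeomorphism onto `N`. -/
noncomputable def point (N : RuledThreefold) (y : ℝ × ℝ × ℝ) : KleinBottle × C3 :=
  (kleinMk y.2, N.imm y)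

/-- The 3-manifold `N` as a subset of `Σ × ℂ³`. -/
def total (N : RuledThreefold) : Set (KleinBottle × C3) := Set.range N.point

/-- The affine line `ι (π⁻¹ σ)` in `ℂ³`. -/
def line (N : RuledThreefold) (s : KleinBottle) : Set C3 := {z | (s, z) ∈ N.total}

/-- `N` and `N'` are the same ruled immersed submanifold: there is a homeomorphism `N → N'`
that commutes with the immersions and covers a homeomorphism of the bases (the map of bases
determines the map `N → N'`, because immersions are injective on the fibres). -/
def SameRuled (N N' : RuledThreefold) : Prop :=
  ∃ f : KleinBottle ≃ₜ KleinBottle, ∀ s, N'.line (f s) = N.line s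

/-- An r-orientation is a continuous choice of orientations (equivalently, of unit directions)
of the lines `π⁻¹ σ`, `σ ∈ Σ`. -/
def ROrientable (N : RuledThreefold) : Prop :=
  ∃ u : KleinBottle → C3, Continuous u ∧
    ∀ x, u (kleinMk x) = N.dir x ∨ u (kleinMk x) = -N.dir x

/-- The points (of the universal cover) where `N` is nonsingular. -/
def IsNonsingularAt (N : RuledThreefold) (y : ℝ × ℝ × ℝ) : Prop :=
  Function.Injective (fderiv ℝ N.imm y)

/-- `N` is special Lagrangian (with phase 1): the nonsingular points are dense, and at each of
them the tangent space of `N`, suitably oriented, is calibrated by `Re Ω`. As `Re Ω` does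
not vanish on these tangent spaces, the orientations fit together. -/
def IsSpecialLagrangian (N : RuledThreefold) : Prop :=
  Dense {y | N.IsNonsingularAt y} ∧
    ∀ y, N.IsNonsingularAt y →
      ∀ v : Fin 3 → ℝ × ℝ × ℝ, IsCalibratedTriple fun i => fderiv ℝ N.imm y (v i)

/-- `N` is a two-sided cone, regarded as a ruled 3-fold: all lines pass through `0`, and `N`
is nonsingular except at `0`. -/
def IsTwoSidedCone (N : RuledThreefold) : Prop :=
  (∀ x, N.foot x = 0) ∧ ∀ y : ℝ × ℝ × ℝ, y.1 ≠ 0 → N.IsNonsingularAt y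

/-- The asymptotic cone of `N`, as a subset of `ℂ³`: all vectors parallel to some line of `N`. -/
def asymptoticCone (N : RuledThreefold) : Set C3 := {v | ∃ (x : ℝ × ℝ) (c : ℝ), v = c • N.dir x}

end RuledThreefold

/-! ### Covariant derivatives and asymptotics -/

/-- The Christoffel symbols (Levi-Civita connection in coordinates) of the metric induced by an
immersion `ι`: `Γ_y(u, v)` is the vector with `dι (Γ_y(u, v))` the orthogonal projection of the
second derivative `D²ι(u, v)` to the image of `dι`. -/
noncomputable def christoffel (ι : ℝ × ℝ × ℝ → C3) (y u v : ℝ × ℝ × ℝ) : ℝ × ℝ × ℝ :=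
  Classical.epsilon fun z : ℝ × ℝ × ℝ => ∀ w : ℝ × ℝ × ℝ,
    inner ℝ (fderiv ℝ ι y z) (fderiv ℝ ι y w) =
      inner ℝ (fderiv ℝ (fun p => fderiv ℝ ι p v) y u) (fderiv ℝ ι y w)

/-- The iterated covariant derivative `∇ᵏ f` of a `ℂ³`-valued function `f`, with respect to the
Levi-Civita connection of the metric induced by `ι`. -/
noncomputable def nabla (ι f : ℝ × ℝ × ℝ → C3) :
    (k : ℕ) → (ℝ × ℝ × ℝ) → (Fin k → ℝ × ℝ × ℝ) → C3
  | 0, y, _ => f y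
  | k + 1, y, v =>
      fderiv ℝ (fun p => nabla ι f k p (Fin.tail v)) y (v 0) -
        ∑ i : Fin k, nabla ι f k y
          (Function.update (Fin.tail v) i (christoffel ι y (v 0) (Fin.tail v i)))

namespace RuledThreefold

/-- `N` is asymptotic to the cone `N₀` with order `O(r^α)`: there are a compact subset `K` of `N`,
a constant `R > 0` and a diffeomorphism `Φ` from the part of `N₀` outside the closed ball of radius
`R` to `N \ K`, such that `|∇ᵏ(ι ∘ Φ - ι₀)| = O(r^(α - k))` as `r → ∞` for all `k`. Here `ι`, `ι₀`
are the immersions of `N`, `N₀`, and `∇` and `|.|` come from the cone metric on `N₀`.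

`Φ` is given by its lift to the universal covers, a smooth local diffeomorphism which
induces a bijection from `N₀` outside the ball to `N \ K` (every smooth map from this part of `N₀`
to `N` lifts, since the components of `{ |r| > R } × ℝ²` are simply connected). -/
def AsymptoticTo (N N₀ : RuledThreefold) (α : ℝ) : Prop :=
  ∃ (K : Set (KleinBottle × C3)) (R : ℝ) (Φ : ℝ × ℝ × ℝ → ℝ × ℝ × ℝ),
    IsCompact K ∧ K ⊆ N.total ∧ 0 < R ∧
    ContDiffOn ℝ ∞ Φ {y | R < ‖N₀.imm y‖} ∧
    (∀ y, R < ‖N₀.imm y‖ → Function.Bijective (fderiv ℝ Φ y)) ∧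
    (∀ y y', R < ‖N₀.imm y‖ → R < ‖N₀.imm y'‖ →
      (N.point (Φ y) = N.point (Φ y') ↔ N₀.point y = N₀.point y')) ∧
    (fun y => N.point (Φ y)) '' {y | R < ‖N₀.imm y‖} = N.total \ K ∧
    ∀ k : ℕ, ∃ M R' : ℝ, R ≤ R' ∧ ∀ y, R' < ‖N₀.imm y‖ → ∀ v : Fin k → ℝ × ℝ × ℝ,
      ‖nabla N₀.imm (fun p => N.imm (Φ p) - N₀.imm p) k y v‖ ≤
        M * ‖N₀.imm y‖ ^ (α - k) * ∏ i, ‖fderiv ℝ N₀.imm y (v i)‖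

/-! ### Holomorphic vector fields on the double cover of the base of a cone

For a cone `N₀`, the double cover `Σ̃` of `Σ` is the set of unit vectors in the lines of `N₀`
(if `N₀` is embedded this is `N₀ ∩ S⁵`). Points of `ℝ²` represent the same point of
`Σ̃` if they differ by a deck transformation and `dir` takes the same value, and `-1` acts
on `Σ̃` by the deck transformations that change the sign of `dir`. -/

/-- `J` is the complex structure of the Riemann surface `Σ̃` (lifted to `ℝ²`): the rotation
by `90` degrees for the metric induced by `dir` and the orientation which is positive for
`(u, v) ↦ Re Ω (dir, d dir u, d dir v)`. These properties determine `J` uniquely. -/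
def IsComplexStructure (N₀ : RuledThreefold) (J : ℝ × ℝ → (ℝ × ℝ →L[ℝ] ℝ × ℝ)) : Prop :=
  ∀ x v, v ≠ 0 →
    ‖fderiv ℝ N₀.dir x (J x v)‖ = ‖fderiv ℝ N₀.dir x v‖ ∧
    inner ℝ (fderiv ℝ N₀.dir x (J x v)) (fderiv ℝ N₀.dir x v) = 0 ∧
    0 < (holVol ![N₀.dir x, fderiv ℝ N₀.dir x v, fderiv ℝ N₀.dir x (J x v)]).re

/-- The real vector space of holomorphic vector fields `w` on `Σ̃` (smooth real vector fields with
`L_w J = 0`) that change sign under `-1 : Σ̃ → Σ̃`, lifted to `ℝ²`. -/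
def antiInvariantFields (N₀ : RuledThreefold) (J : ℝ × ℝ → (ℝ × ℝ →L[ℝ] ℝ × ℝ)) :
    Submodule ℝ (ℝ × ℝ → ℝ × ℝ) where
  carrier := {w | ContDiff ℝ ∞ w ∧
    (∀ x v, fderiv ℝ (fun y => J y v) x (w x) - fderiv ℝ w x (J x v) + J x (fderiv ℝ w x v) = 0) ∧
    (∀ (m n : ℤ) (x : ℝ × ℝ), N₀.dir (deck m n x) = N₀.dir x →
      w (deck m n x) = deckLin m (w x)) ∧
    (∀ (m n : ℤ) (x : ℝ × ℝ), N₀.dir (deck m n x) = -N₀.dir x →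
      w (deck m n x) = -deckLin m (w x))}
  zero_mem' := by
    refine ⟨contDiff_const, fun x v => ?_, fun m n x _ => ?_, fun m n x _ => ?_⟩
    · simp
    · ext <;> simp [deckLin]
    · ext <;> simp [deckLin]
  add_mem' := by
    rintro w w' ⟨h1, h2, h3, h4⟩ ⟨h1', h2', h3', h4'⟩
    refine ⟨h1.add h1', fun x v => ?_, fun m n x h => ?_, fun m n x h => ?_⟩
    · have e : fderiv ℝ (w + w') x = fderiv ℝ w x + fderiv ℝ w' x :=
        fderiv_add (h1.differentiable (by simp) x) (h1'.differentiable (by simp) x)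
      have a := h2 x v
      have b := h2' x v
      rw [e]
      simp only [Pi.add_apply, map_add, add_apply]
      rw [← add_zero (0 : ℝ × ℝ)]
      nth_rewrite 1 [← a]
      rw [← b]
      abel
    · simp only [Pi.add_apply, h3 m n x h, h3' m n x h, deckLin]
      ext <;> simp <;> ring
    · simp only [Pi.add_apply, h4 m n x h, h4' m n x h, deckLin]
      ext <;> simp <;> ring
  smul_mem' := by
    rintro c w ⟨h1, h2, h3, h4⟩
    refine ⟨h1.const_smul c, fun x v => ?_, fun m n x h => ?_, fun m n x h => ?_⟩
    · have e : fderiv ℝ (c • w) x = c • fderiv ℝ w x :=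
        fderiv_const_smul (h1.differentiable (by simp) x) c
      have a := h2 x v
      rw [e]
      simp only [Pi.smul_apply, map_smul, smul_apply]
      rw [← smul_sub, ← smul_add, a, smul_zero]
    · simp only [Pi.smul_apply, h3 m n x h, deckLin]
      ext <;> simp <;> ring
    · simp only [Pi.smul_apply, h4 m n x h, deckLin]
      ext <;> simp <;> ring

end RuledThreefold

/-! ### Beltrami operators on `L²` of the torus -/

noncomputable section TorusFourier

open MeasureTheory UnitAddTorus
open scoped ComplexConjugate ENNReal

-- Write φ for the unit direction `dir` of the cone, ψ = L_w φ, and × for the antilinear cross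
-- product dual to Ω. The equality case of the calibration inequality shows that φ is Legendrian and
-- that φ × dφ(v) = dφ(Jv) (`ccross_and_inner`). The density Re Ω(φ, ∂₁φ, ∂₂φ) never vanishes and is
-- cubic in φ, so a deck transformation reverses φ exactly when it reverses the orientation of ℝ²
-- (`dir_deck_eq`). Hence no continuous choice of directions exists on the Klein bottle, and Σ̃ is
-- the torus ℝ² / (2ℤ × ℤ).
--
-- Holomorphic fields: the torus is uniformized by a bijective J-holomorphic coordinate Z : ℝ² → ℂ
-- with periodic dZ (`exists_globalCoordinate`). For a holomorphic field w the function dZ(w) is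
-- holomorphic on the torus, hence constant. The glide reflection is antiholomorphic, so changing
-- sign under it becomes conj h = -κ h with |κ| = 1, which cuts out one real line in ℂ
-- (`exists_field_generator`). The coordinate comes from the Beltrami equation ∂bar f = μ ∂f. A
-- Neumann series solves it in `L²`, because the operator ∂ ∂bar⁻¹ on the torus is an isometry. The
-- solution is smooth because its translates solve the translated equation. Finally ∂f has no zeros,
-- because ∂f times a suitable exponential is again a solution, with unitary periods, and is
-- therefore constant: its Jacobian is nonnegative and exact.
--
-- Special Lagrangian: the Lie derivative along w of dφ(Jv) = φ × dφ(v) is dψ(Jv) = ψ × dφ(v) + φ ×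
-- dψ(v), and ψ × dφ(v) is a real multiple of φ by the Legendrian condition. So the vector a = r
-- dφ(v) + dψ(v) has as its partner in the direction Jv the vector φ × a + cφ, while ⟪φ, a⟫ is real.
-- Then φ, a, φ × a + cφ form a calibrated triple (`isCalibratedTriple_ccross`).
--
-- Asymptotics: with Φ(r, x) = (r, x - w(x)/r) and s = 1/r, the difference of the immersions is r
-- (φ(x - s w) - φ(x) + s ψ(x - s w)). The bracket vanishes to second order at s = 0, so the
-- difference is r⁻¹ times a smooth function of (s, x). Homotheties and periods carry every point to
-- r = 1 over a compact rectangle, which bounds all covariant derivatives at once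
-- (`nabla_imm_bound`).
--
-- Distinctness: an isomorphism lifts to a map F of ℝ² with φ ∘ F = φ, after correction by a deck
-- transformation. Comparing maxima of |ψ| leaves only w' = -w ≠ 0. Then F acts as Z ↦ C - Z and has
-- a fixed point, where φ ∘ F = φ forces the derivative of F to be the identity, although F reverses
-- w (`not_exists_reversing_lift`).

local instance : MeasureSpace UnitAddCircle := ⟨AddCircle.haarAddCircle⟩

local instance : Measure.IsAddHaarMeasure (volume : Measure UnitAddCircle) :=
  inferInstanceAs (Measure.IsAddHaarMeasure AddCircle.haarAddCircle)

local instance : IsProbabilityMeasure (volume : Measure UnitAddCircle) :=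
  inferInstanceAs (IsProbabilityMeasure AddCircle.haarAddCircle)

/-- The two-dimensional torus `(ℝ / ℤ)²`. -/
abbrev Torus : Type := UnitAddTorus (Fin 2)

/-- The Hilbert space `L²((ℝ / ℤ)²)`. -/
abbrev TorusL2 : Type := Lp ℂ 2 (volume : Measure Torus)

/-- The inclusion of continuous functions in `L²`. -/
def torusIncl : C(Torus, ℂ) →L[ℂ] TorusL2 := ContinuousMap.toLp 2 volume ℂ

theorem torusIncl_injective : Function.Injective torusIncl :=
  ContinuousMap.toLp_injective (p := 2) (𝕜 := ℂ) (volume : Measure Torus)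

theorem torusIncl_denseRange : DenseRange torusIncl :=
  ContinuousMap.toLp_denseRange ℂ (volume : Measure Torus) ℂ (by simp)

theorem torusBasis_repr_incl (f : C(Torus, ℂ)) (m : Fin 2 → ℤ) :
    mFourierBasis.repr (torusIncl f) m = mFourierCoeff f m := by
  rw [mFourierBasis_repr]; exact mFourierCoeff_toLp f m

/-- Multiplication by a continuous function as an operator on `L²`. -/
def torusMul : C(Torus, ℂ) →L[ℂ] TorusL2 →L[ℂ] TorusL2 :=
  ((ContinuousLinearMap.mul ℂ ℂ).holderL volume ∞ 2 2).comp (ContinuousMap.toLp ∞ volume ℂ)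

theorem torusMul_coeFn (f : C(Torus, ℂ)) (g : TorusL2) :
    torusMul f g =ᵐ[volume] fun x => f x * g x := by
  have h := ContinuousLinearMap.coeFn_holder (r := 2) (ContinuousLinearMap.mul ℂ ℂ)
    (ContinuousMap.toLp ∞ volume ℂ f) g
  have h2 := ContinuousMap.coeFn_toLp (p := ∞) (𝕜 := ℂ) (volume : Measure Torus) f
  have h3 : torusMul f g = (ContinuousLinearMap.mul ℂ ℂ).holder 2
    (ContinuousMap.toLp ∞ volume ℂ f) g := rfl
  rw [h3]
  filter_upwards [h, h2] with x hx hx2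
  rw [hx, hx2]; rfl

theorem torusMul_incl (f g : C(Torus, ℂ)) : torusMul f (torusIncl g) = torusIncl (f * g) := by
  apply Lp.ext
  have h1 := torusMul_coeFn f (torusIncl g)
  have h2 := ContinuousMap.coeFn_toLp (p := 2) (𝕜 := ℂ) (volume : Measure Torus) g
  have h3 := ContinuousMap.coeFn_toLp (p := 2) (𝕜 := ℂ) (volume : Measure Torus) (f * g)
  change torusIncl g =ᵐ[volume] g at h2
  change torusIncl (f * g) =ᵐ[volume] (f * g : C(Torus, ℂ)) at h3
  filter_upwards [h1, h2, h3] with x a b c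
  rw [a, b, c]; rfl

theorem norm_torusMul_apply_le {f : C(Torus, ℂ)} {k : ℝ} (hk : ∀ x, ‖f x‖ ≤ k) (g : TorusL2) :
    ‖torusMul f g‖ ≤ k * ‖g‖ := by
  apply Lp.norm_le_mul_norm_of_ae_le_mul
  filter_upwards [torusMul_coeFn f g] with x hx
  rw [hx, norm_mul]
  exact mul_le_mul_of_nonneg_right (hk x) (norm_nonneg _)

/-- The Fourier multiplier with unimodular symbol `t`, as a linear isometry of `L²`. -/
def torusMultiplier (t : (Fin 2 → ℤ) → ℂ) (ht : ∀ m, ‖t m‖ = 1) : TorusL2 →ₗᵢ[ℂ] TorusL2 :=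
  (mFourierBasis (d := Fin 2)).repr.symm.toLinearIsometry.comp
    ((LinearIsometry.mk (σ₁₂ := RingHom.id ℂ) (E := lp (fun _ : Fin 2 → ℤ => ℂ) 2)
      (E₂ := lp (fun _ : Fin 2 → ℤ => ℂ) 2)
      { toFun := fun a => ⟨fun m => t m * a m, (lp.memℓp a).mono' (fun m => by simp [ht])⟩
        map_add' := fun a b => by
          apply lp.ext; funext m; exact mul_add (t m) (a m) (b m)
        map_smul' := fun c a => by
          apply lp.ext; funext m; exact mul_left_comm (t m) c (a m) } (by
          intro a
          rw [lp.norm_eq_tsum_rpow (by simp), lp.norm_eq_tsum_rpow (by simp)]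
          simp [ht])).comp mFourierBasis.repr.toLinearIsometry)

theorem torusBasis_repr_multiplier (t : (Fin 2 → ℤ) → ℂ) (ht : ∀ m, ‖t m‖ = 1) (f : TorusL2)
    (m : Fin 2 → ℤ) :
    mFourierBasis.repr (torusMultiplier t ht f) m = t m * mFourierBasis.repr f m := by
  simp [torusMultiplier]

/-- Multipliers are diagonal in the Fourier basis. Translations are multipliers too, so the operator
with symbol `beurlingSymbol` commutes with them; the regularity of solutions rests on this. -/
theorem torusMultiplier_comm (t t' : (Fin 2 → ℤ) → ℂ) (ht : ∀ m, ‖t m‖ = 1)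
    (ht' : ∀ m, ‖t' m‖ = 1) (f : TorusL2) :
    torusMultiplier t ht (torusMultiplier t' ht' f) =
      torusMultiplier t' ht' (torusMultiplier t ht f) := by
  apply (mFourierBasis (d := Fin 2)).repr.injective
  apply lp.ext; funext m
  simp only [torusBasis_repr_multiplier]
  ring

theorem mFourier_add_point (m : Fin 2 → ℤ) (x y : Torus) :
    mFourier m (x + y) = mFourier m x * mFourier m y := by
  simp [mFourier, fourier_apply, AddCircle.toCircle_add, mul_mul_mul_comm]

theorem norm_mFourier_apply (m : Fin 2 → ℤ) (x : Torus) : ‖mFourier m x‖ = 1 := by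
  simp [mFourier, -Fin.prod_univ_two, norm_prod, Circle.norm_coe, fourier_apply]

/-- Translation of continuous functions on the torus. -/
def torusTrans (f : C(Torus, ℂ)) (s : Torus) : C(Torus, ℂ) :=
  f.comp ⟨fun x => x + s, by fun_prop⟩

@[simp] theorem torusTrans_apply (f : C(Torus, ℂ)) (s x : Torus) :
    torusTrans f s x = f (x + s) := rfl

theorem continuous_torusTrans (f : C(Torus, ℂ)) : Continuous (torusTrans f) := by
  have h : Continuous fun p : Torus × Torus => f (p.2 + p.1) := by fun_prop
  exact (ContinuousMap.curry ⟨_, h⟩).continuous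

theorem mFourierCoeff_torusTrans (f : C(Torus, ℂ)) (s : Torus) (m : Fin 2 → ℤ) :
    mFourierCoeff (torusTrans f s) m = mFourier m s * mFourierCoeff f m := by
  unfold mFourierCoeff
  rw [← integral_add_right_eq_self (μ := (volume : Measure Torus))
    (fun t => mFourier (-m) t • f t) s, ← integral_const_mul]
  congr 1; funext x
  rw [mFourier_add_point, torusTrans_apply]
  have h : mFourier m s * mFourier (-m) s = 1 := by
    rw [← mFourier_add, add_neg_cancel, mFourier_zero]; rfl
  simp only [smul_eq_mul]
  linear_combination (-(mFourier (-m) x * f (x + s))) * h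

/-- Translation on `L²`. -/
abbrev torusTransL2 (s : Torus) : TorusL2 →ₗᵢ[ℂ] TorusL2 :=
  torusMultiplier (fun m => mFourier m s) (fun m => norm_mFourier_apply m s)

theorem torusTransL2_incl (s : Torus) (f : C(Torus, ℂ)) :
    torusTransL2 s (torusIncl f) = torusIncl (torusTrans f s) := by
  apply (mFourierBasis (d := Fin 2)).repr.injective
  apply lp.ext; funext m
  rw [torusBasis_repr_multiplier, torusBasis_repr_incl, torusBasis_repr_incl,
    mFourierCoeff_torusTrans]

/-- Obvious for continuous `g`, and both sides are continuous in `g`, so density of continuous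
functions suffices. -/
theorem torusTransL2_mul (s : Torus) (f : C(Torus, ℂ)) (g : TorusL2) :
    torusTransL2 s (torusMul f g) = torusMul (torusTrans f s) (torusTransL2 s g) := by
  refine torusIncl_denseRange.induction_on g ?_ ?_
  · exact isClosed_eq ((torusTransL2 s).continuous.comp (torusMul f).continuous)
      ((torusMul _).continuous.comp (torusTransL2 s).continuous)
  · intro g
    rw [torusMul_incl, torusTransL2_incl, torusTransL2_incl, torusMul_incl]
    rfl

/-- The operator `g ↦ μ · T g` on `L²`. -/
def beltramiOp (t : (Fin 2 → ℤ) → ℂ) (ht : ∀ m, ‖t m‖ = 1) :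
    C(Torus, ℂ) →L[ℂ] TorusL2 →L[ℂ] TorusL2 :=
  (ContinuousLinearMap.compL ℂ TorusL2 TorusL2 TorusL2).flip
    (torusMultiplier t ht).toContinuousLinearMap ∘L torusMul

theorem beltramiOp_apply (t : (Fin 2 → ℤ) → ℂ) (ht : ∀ m, ‖t m‖ = 1) (μ : C(Torus, ℂ))
    (g : TorusL2) : beltramiOp t ht μ g = torusMul μ (torusMultiplier t ht g) := rfl

theorem norm_beltramiOp_le (t : (Fin 2 → ℤ) → ℂ) (ht : ∀ m, ‖t m‖ = 1) {μ : C(Torus, ℂ)}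
    {k : ℝ} (hk : ∀ x, ‖μ x‖ ≤ k) : ‖beltramiOp t ht μ‖ ≤ k := by
  refine ContinuousLinearMap.opNorm_le_bound _ ((norm_nonneg _).trans (hk 0)) fun g => ?_
  rw [beltramiOp_apply]
  simpa using norm_torusMul_apply_le hk (torusMultiplier t ht g)

/-- The multiplier `T` is an isometry, so `μT` has norm at most `k < 1` and `1 - μT` is invertible.
A translate of the solution solves the equation with translated data and so, by uniqueness, is the
inverse operator of the translated data. Inversion is smooth on units, hence the translates depend
smoothly on `s`. This replaces elliptic regularity. -/
theorem exists_beltrami_L2 (t : (Fin 2 → ℤ) → ℂ) (ht : ∀ m, ‖t m‖ = 1) {μ ν : C(Torus, ℂ)}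
    {k : ℝ} (hk : ∀ x, ‖μ x‖ ≤ k) (hk1 : k < 1)
    (hμ : ∀ i, ContDiff ℝ ∞ fun s : ℝ => torusTrans μ (Pi.single i (s : UnitAddCircle)))
    (hν : ∀ i, ContDiff ℝ ∞ fun s : ℝ => torusTrans ν (Pi.single i (s : UnitAddCircle))) :
    ∃ q : TorusL2, q = torusMul μ (torusMultiplier t ht q) + torusIncl ν ∧
      ∀ i, ∃ Q : ℝ → TorusL2, ContDiff ℝ ∞ Q ∧
        ∀ s, Q s = torusTransL2 (Pi.single i (s : UnitAddCircle)) q := by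
  let S : C(Torus, ℂ) → C(Torus, ℂ) → TorusL2 := fun μ ν =>
    Ring.inverse (1 - beltramiOp t ht μ) (torusIncl ν)
  have unit : ∀ μ : C(Torus, ℂ), (∀ x, ‖μ x‖ ≤ k) → IsUnit (1 - beltramiOp t ht μ) :=
    fun μ hμ => isUnit_one_sub_of_norm_lt_one ((norm_beltramiOp_le t ht hμ).trans_lt hk1)
  have uniq : ∀ μ : C(Torus, ℂ), (∀ x, ‖μ x‖ ≤ k) → ∀ ν q,
      q = beltramiOp t ht μ q + torusIncl ν ↔ q = S μ ν := by
    intro μ hμ ν q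
    constructor
    · intro h
      have h1 : (1 - beltramiOp t ht μ) q = torusIncl ν := by
        simp only [sub_apply, one_apply_eq_self]
        nth_rewrite 1 [h]; abel
      simp only [S]
      rw [← h1, ← mul_apply_eq_comp, Ring.inverse_mul_cancel _ (unit μ hμ)]
      rfl
    · intro h
      have h1 : (1 - beltramiOp t ht μ) q = torusIncl ν := by
        rw [h]
        simp only [S]
        rw [← mul_apply_eq_comp, Ring.mul_inverse_cancel _ (unit μ hμ)]
        rfl
      rw [← h1]; simp
  refine ⟨S μ ν, (uniq μ hk ν _).2 rfl, fun i => ⟨fun s =>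
    S (torusTrans μ (Pi.single i (s : UnitAddCircle)))
      (torusTrans ν (Pi.single i (s : UnitAddCircle))), ?_, fun s => ?_⟩⟩
  · have h1 : ContDiff ℝ ∞ fun s : ℝ =>
        (1 - beltramiOp t ht (torusTrans μ (Pi.single i (s : UnitAddCircle)))) :=
      contDiff_const.sub (((beltramiOp t ht).restrictScalars ℝ).contDiff.comp (hμ i))
    have h2 : ContDiff ℝ ∞ fun s : ℝ =>
        Ring.inverse (1 - beltramiOp t ht (torusTrans μ (Pi.single i (s : UnitAddCircle)))) := by
      rw [contDiff_iff_contDiffAt]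
      intro s
      obtain ⟨u, hu⟩ := unit (torusTrans μ (Pi.single i (s : UnitAddCircle))) (fun x => hk _)
      have h3 := (contDiffAt_ringInverse ℂ u (n := ∞)).restrict_scalars ℝ
      rw [hu] at h3
      exact h3.comp s h1.contDiffAt
    have h3 : ContDiff ℝ ∞ fun s : ℝ =>
        torusIncl (torusTrans ν (Pi.single i (s : UnitAddCircle))) :=
      (torusIncl.restrictScalars ℝ).contDiff.comp (hν i)
    have h4 := ((ContinuousLinearMap.apply ℂ TorusL2 :
      TorusL2 →L[ℂ] (TorusL2 →L[ℂ] TorusL2) →L[ℂ] TorusL2).isBoundedBilinearMap.contDiff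
        (n := ∞)).restrict_scalars ℝ
    exact h4.comp (h3.prodMk h2)
  · symm
    apply (uniq (torusTrans μ (Pi.single i (s : UnitAddCircle))) (fun x => hk _) _ _).1
    have h := (uniq μ hk ν _).2 rfl
    nth_rewrite 1 [h]
    rw [map_add, beltramiOp_apply, beltramiOp_apply, torusTransL2_mul, torusTransL2_incl,
      torusMultiplier_comm]

theorem mFourier_single_coe (m : Fin 2 → ℤ) (i : Fin 2) (s : ℝ) :
    mFourier m (Pi.single i (s : UnitAddCircle)) = Complex.exp (2 * Real.pi * Complex.I * m i * s) := by
  fin_cases i <;> simp [mFourier, -fourier_apply, fourier_coe_apply, fourier_eval_zero]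

/-- Fourier coefficients are bounded by the `L²` norm, and each derivative of the orbit in `s`
multiplies the coefficient at `m` by `2πi m i`. Induction on `k` is applied to `deriv Q`. -/
theorem exists_fourier_decay (i : Fin 2) (k : ℕ) : ∀ (a : (Fin 2 → ℤ) → ℂ) (Q : ℝ → TorusL2),
    ContDiff ℝ ∞ Q →
    (∀ m s, mFourierBasis.repr (Q s) m = Complex.exp (2 * Real.pi * Complex.I * m i * s) * a m) →
    ∃ C : ℝ, ∀ m, |(m i : ℝ)| ^ k * ‖a m‖ ≤ C := by
  induction k with
  | zero =>
    intro a Q _ hQ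
    refine ⟨‖Q 0‖, fun m => ?_⟩
    have h := hQ m 0
    simp only [Complex.ofReal_zero, mul_zero, Complex.exp_zero, one_mul] at h
    rw [pow_zero, one_mul, ← h, ← (mFourierBasis (d := Fin 2)).repr.norm_map (Q 0)]
    exact lp.norm_apply_le_norm (by simp) _ m
  | succ k ih =>
    intro a Q hs hQ
    obtain ⟨C, hC⟩ := ih (fun m => 2 * Real.pi * Complex.I * m i * a m) (deriv Q)
      ((contDiff_infty_iff_deriv.1 hs).2) (by
        intro m s
        have h1 : HasDerivAt Q (deriv Q s) s := (hs.differentiable (by simp) s).hasDerivAt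
        have h2 : HasDerivAt (fun s => mFourierBasis.repr (Q s) m)
            (mFourierBasis.repr (deriv Q s) m) s := by
          have := (((innerSL ℂ (mFourierBasis (d := Fin 2) m)).restrictScalars
            ℝ).hasFDerivAt.comp_hasDerivAt s h1)
          simp only [HilbertBasis.repr_apply_apply]
          exact this
        have h3 : HasDerivAt (fun s : ℝ => Complex.exp (2 * Real.pi * Complex.I * m i * s) * a m)
            (Complex.exp (2 * Real.pi * Complex.I * m i * s) *
              (2 * Real.pi * Complex.I * m i * 1) * a m) s :=
          ((((hasDerivAt_id s).ofReal_comp).const_mul _).cexp).mul_const _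
        rw [funext (hQ m)] at h2
        rw [h2.unique h3]; ring)
    refine ⟨C, fun m => ?_⟩
    refine le_trans ?_ (hC m)
    simp only [norm_mul, Complex.norm_real, Complex.norm_I, Complex.norm_ofNat, Real.norm_eq_abs,
      abs_of_pos Real.pi_pos, Complex.norm_intCast]
    rw [pow_succ, mul_assoc]
    gcongr
    have h2 : (1 : ℝ) ≤ 2 * Real.pi * 1 := by linarith [Real.pi_gt_three]
    exact le_mul_of_one_le_left (abs_nonneg _) h2

/-- Smoothness of a continuous function on the torus, as a property of its translates. -/
theorem contDiff_torusTrans (F : ℕ → C(Torus, ℂ)) (i : Fin 2)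
    (hF : ∀ n x, HasDerivAt (fun s : ℝ => F n (x + Pi.single i (s : UnitAddCircle)))
      (F (n + 1) x) 0) (n : ℕ) :
    ContDiff ℝ ∞ fun s : ℝ => torusTrans (F n) (Pi.single i (s : UnitAddCircle)) := by
  have hc : Continuous fun s : ℝ => (Pi.single i (s : UnitAddCircle) : Torus) :=
    (continuous_single i).comp (AddCircle.continuous_mk' 1)
  have hadd : ∀ s t : ℝ, (Pi.single i ((s + t : ℝ) : UnitAddCircle) : Torus) =
      Pi.single i (s : UnitAddCircle) + Pi.single i (t : UnitAddCircle) := by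
    intro s t; rw [← Pi.single_add]; rfl
  have key : ∀ (n : ℕ) (s : ℝ), HasDerivAt (fun s : ℝ => torusTrans (F n) (Pi.single i (s : UnitAddCircle)))
      (torusTrans (F (n + 1)) (Pi.single i (s : UnitAddCircle))) s := by
    intro n s
    have hcont : Continuous fun s : ℝ => torusTrans (F (n + 1)) (Pi.single i (s : UnitAddCircle)) :=
      (continuous_torusTrans _).comp hc
    -- The hypothesis is a pointwise derivative; differentiability in the sup norm is needed. The
    -- Banach-valued integral of the translates of `F (n + 1)` has it, and evaluation at each point
    -- identifies this integral with the translate of `F n` minus `F n`.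
    have h1 := (intervalIntegral.integral_hasDerivAt_right (hcont.intervalIntegrable (μ := volume) 0 s)
      hcont.stronglyMeasurable.stronglyMeasurableAtFilter hcont.continuousAt).add_const (F n)
    refine h1.congr_of_eventuallyEq (Filter.Eventually.of_forall fun u => ?_)
    ext x
    have h2 : ∀ v : ℝ, HasDerivAt (fun s : ℝ => F n (x + Pi.single i (s : UnitAddCircle)))
        (F (n + 1) (x + Pi.single i (v : UnitAddCircle))) v := by
      intro v
      have h3 := hF n (x + Pi.single i (v : UnitAddCircle))
      have h3' : HasDerivAt (fun s : ℝ => F n (x + Pi.single i (v : UnitAddCircle) +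
          Pi.single i (s : UnitAddCircle))) (F (n + 1) (x + Pi.single i (v : UnitAddCircle)))
          (v - v) := by rwa [sub_self]
      have h4 := h3'.comp_sub_const v v
      refine h4.congr_of_eventuallyEq (Filter.Eventually.of_forall fun w => ?_)
      simp only
      rw [add_assoc, ← hadd, add_sub_cancel]
    have hc2 : Continuous fun v : ℝ => F (n + 1) (x + Pi.single i (v : UnitAddCircle)) :=
      (F (n + 1)).continuous.comp (continuous_const.add hc)
    have h5 := intervalIntegral.integral_eq_sub_of_hasDerivAt (a := 0) (b := u)
      (fun v _ => h2 v) (hc2.intervalIntegrable (μ := volume) 0 u)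
    have h6 := (ContinuousMap.evalCLM ℝ x : C(Torus, ℂ) →L[ℝ] ℂ).intervalIntegral_comp_comm
      (hcont.intervalIntegrable (μ := volume) 0 u)
    simp only [ContinuousMap.add_apply, torusTrans_apply]
    have h7 : (∫ v in (0:ℝ)..u, torusTrans (F (n + 1)) (Pi.single i (v : UnitAddCircle))) x =
        ∫ v in (0:ℝ)..u, F (n + 1) (x + Pi.single i (v : UnitAddCircle)) := h6.symm
    rw [h7, h5]
    simp
  rw [contDiff_infty]
  intro k
  induction k generalizing n with
  | zero => exact contDiff_zero.2 ((continuous_torusTrans _).comp hc)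
  | succ k ih =>
    have : ((k + 1 : ℕ) : WithTop ℕ∞) = k + 1 := by norm_cast
    rw [this, contDiff_succ_iff_deriv]
    refine ⟨fun s => (key n s).differentiableAt, by simp, ?_⟩
    rw [funext fun s => (key n s).deriv]
    exact ih (n + 1)

end TorusFourier

/-! ### Fourier series of periodic functions and the inhomogeneous Beltrami equation -/

noncomputable section TorusSeries

open MeasureTheory UnitAddTorus
open scoped ComplexConjugate ENNReal

/-- Functions on `ℝ²` that are periodic with respect to `ℤ²`. -/
def TorusPeriodic {E : Type*} (f : ℝ × ℝ → E) : Prop :=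
  ∀ (m n : ℤ) (x : ℝ × ℝ), f (x.1 + m, x.2 + n) = f x

/-- The covering map of the torus. -/
def torusMk (x : ℝ × ℝ) : Torus := ![(x.1 : UnitAddCircle), (x.2 : UnitAddCircle)]

theorem isOpenQuotientMap_torusMk : IsOpenQuotientMap torusMk := by
  have h : IsOpenQuotientMap (Pi.map fun (_ : Fin 2) (x : ℝ) => (x : UnitAddCircle)) :=
    IsOpenQuotientMap.piMap fun _ => QuotientAddGroup.isOpenQuotientMap_mk
  have h2 := h.comp (Homeomorph.finTwoArrow (X := ℝ)).symm.isOpenQuotientMap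
  convert h2 using 1
  funext x
  ext i
  fin_cases i <;> rfl

theorem TorusPeriodic.exists_lift {f : ℝ × ℝ → ℂ} (hf : TorusPeriodic f) (hc : Continuous f) :
    ∃ F : C(Torus, ℂ), ∀ x, F (torusMk x) = f x := by
  have h0 : ∀ x y, torusMk x = torusMk y → f x = f y := by
    intro x y h
    have h1 : (x.1 : UnitAddCircle) = y.1 := congrFun h 0
    have h2 : (x.2 : UnitAddCircle) = y.2 := congrFun h 1
    obtain ⟨m, hm⟩ := AddSubgroup.mem_zmultiples_iff.1 (QuotientAddGroup.eq.1 h1)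
    obtain ⟨n, hn⟩ := AddSubgroup.mem_zmultiples_iff.1 (QuotientAddGroup.eq.1 h2)
    rw [← hf m n x]
    congr 1
    ext
    · simp at hm ⊢; linarith
    · simp at hn ⊢; linarith
  let g : Torus → ℂ := fun t => f (Function.surjInv isOpenQuotientMap_torusMk.surjective t)
  have hg : ∀ x, g (torusMk x) = f x := fun x =>
    h0 _ _ (Function.surjInv_eq isOpenQuotientMap_torusMk.surjective _)
  refine ⟨⟨g, isOpenQuotientMap_torusMk.continuous_comp_iff.1 ?_⟩, hg⟩
  rwa [show g ∘ torusMk = f from funext hg]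

theorem torusMk_add_single_zero (x : ℝ × ℝ) (s : ℝ) :
    torusMk x + Pi.single 0 (s : UnitAddCircle) = torusMk (x.1 + s, x.2) := by
  ext i; fin_cases i <;> simp [torusMk]

theorem torusMk_add_single_one (x : ℝ × ℝ) (s : ℝ) :
    torusMk x + Pi.single 1 (s : UnitAddCircle) = torusMk (x.1, x.2 + s) := by
  ext i; fin_cases i <;> simp [torusMk]

/-- The basis vectors of `ℝ²`. -/
def stdVec (i : Fin 2) : ℝ × ℝ := if i = 0 then (1, 0) else (0, 1)

theorem torusMk_add_single (x : ℝ × ℝ) (i : Fin 2) (s : ℝ) :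
    torusMk x + Pi.single i (s : UnitAddCircle) = torusMk (x + s • stdVec i) := by
  fin_cases i
  · rw [show x + s • stdVec _ = (x.1 + s, x.2) by ext <;> simp [stdVec]]
    exact torusMk_add_single_zero x s
  · rw [show x + s • stdVec _ = (x.1, x.2 + s) by ext <;> simp [stdVec]]
    exact torusMk_add_single_one x s

theorem TorusPeriodic.fderiv {E : Type*} [NormedAddCommGroup E] [NormedSpace ℝ E]
    {f : ℝ × ℝ → E} (hf : TorusPeriodic f) : TorusPeriodic (fderiv ℝ f) := by
  intro m n x
  have h : f = fun y => f (y + ((m : ℝ), (n : ℝ))) := funext fun y => (hf m n y).symm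
  conv_rhs => rw [h]
  rw [fderiv_comp_add_right]
  rfl

theorem TorusPeriodic.fderiv_apply {E : Type*} [NormedAddCommGroup E] [NormedSpace ℝ E]
    {f : ℝ × ℝ → E} (hf : TorusPeriodic f) (v : ℝ × ℝ) :
    TorusPeriodic fun x => _root_.fderiv ℝ f x v := fun m n x => by
  have := hf.fderiv m n x
  simp only [this]

/-- All iterated partial derivatives in the direction `i` are smooth and periodic, and their lifts
form the sequence that `contDiff_torusTrans` needs. -/
theorem TorusPeriodic.contDiff_torusTrans_lift {f : ℝ × ℝ → ℂ} (hf : TorusPeriodic f)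
    (hs : ContDiff ℝ ∞ f) {F : C(Torus, ℂ)} (hF : ∀ x, F (torusMk x) = f x) (i : Fin 2) :
    ContDiff ℝ ∞ fun s : ℝ => torusTrans F (Pi.single i (s : UnitAddCircle)) := by
  let d : (ℝ × ℝ → ℂ) → ℝ × ℝ → ℂ := fun f x => _root_.fderiv ℝ f x (stdVec i)
  have hd : ∀ n, ContDiff ℝ ∞ (d^[n] f) ∧ TorusPeriodic (d^[n] f) := by
    intro n
    induction n with
    | zero => exact ⟨hs, hf⟩
    | succ n ih =>
      rw [Function.iterate_succ_apply']
      exact ⟨(ih.1.fderiv_right (m := ∞) (by simp)).clm_apply contDiff_const,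
        ih.2.fderiv_apply _⟩
  choose G hG using fun n => (hd n).2.exists_lift (hd n).1.continuous
  have h0 : G 0 = F := by
    ext t
    obtain ⟨x, rfl⟩ := isOpenQuotientMap_torusMk.surjective t
    rw [hG, hF]; rfl
  have := contDiff_torusTrans G i (fun n t => by
    obtain ⟨x, rfl⟩ := isOpenQuotientMap_torusMk.surjective t
    simp only [torusMk_add_single, hG]
    rw [Function.iterate_succ_apply']
    have h1 : HasFDerivAt (d^[n] f) (_root_.fderiv ℝ (d^[n] f) (x + (0 : ℝ) • stdVec i))
        (x + (0 : ℝ) • stdVec i) := ((hd n).1.differentiable (by simp) _).hasFDerivAt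
    have h2 : HasDerivAt (fun s : ℝ => x + s • stdVec i) (stdVec i) 0 := by
      simpa using ((hasDerivAt_id (0 : ℝ)).smul_const (stdVec i)).const_add x
    have h3 := h1.comp_hasDerivAt (0 : ℝ) h2
    simpa [d, Function.comp_def] using h3) 0
  rwa [h0] at this

/-- The exponential `exp (2 π i (m₀ x + m₁ y))`. -/
def torusExp (m : Fin 2 → ℤ) (x : ℝ × ℝ) : ℂ :=
  Complex.exp (2 * Real.pi * Complex.I * (m 0 * x.1 + m 1 * x.2))

theorem mFourier_torusMk (m : Fin 2 → ℤ) (x : ℝ × ℝ) : mFourier m (torusMk x) = torusExp m x := by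
  simp only [mFourier, torusMk, torusExp, ContinuousMap.coe_mk, Fin.prod_univ_two,
    Matrix.cons_val_zero, Matrix.cons_val_one, fourier_coe_apply]
  rw [← Complex.exp_add]
  congr 1
  push_cast
  ring

theorem norm_torusExp (m : Fin 2 → ℤ) (x : ℝ × ℝ) : ‖torusExp m x‖ = 1 := by
  rw [← mFourier_torusMk, norm_mFourier_apply]

/-- Rapidly decreasing families of Fourier coefficients. -/
def RapidDecay (a : (Fin 2 → ℤ) → ℂ) : Prop := ∀ k : ℕ, ∃ C : ℝ, ∀ m, ‖m‖ ^ k * ‖a m‖ ≤ C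

theorem RapidDecay.summable {a : (Fin 2 → ℤ) → ℂ} (ha : RapidDecay a) : Summable fun m => ‖a m‖ := by
  obtain ⟨C, hC⟩ := ha 3
  -- The exponent 3 exceeds the rank 2 of the lattice. The term `m = 0` is added by hand, because `0
  -- ^ (-3)` is 0.
  have h := (EisensteinSeries.summable_one_div_norm_rpow (k := 3) (by norm_num)).mul_left C
  have h2 : Summable fun m : Fin 2 → ℤ => C * ‖m‖ ^ (-(3 : ℝ)) + if m = 0 then ‖a 0‖ else 0 :=
    h.add (summable_of_ne_finset_zero (s := {0}) (fun m hm => by simp at hm; simp [hm]))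
  refine h2.of_nonneg_of_le (fun m => norm_nonneg _) fun m => ?_
  by_cases hm : m = 0
  · subst hm; simp
  · have hpos : 0 < ‖m‖ := norm_pos_iff.2 hm
    rw [if_neg hm, add_zero, Real.rpow_neg hpos.le, ← div_eq_mul_inv]
    have : ‖m‖ ^ (3 : ℝ) = ‖m‖ ^ 3 := by norm_cast
    rw [this, le_div_iff₀ (by positivity), mul_comm]
    exact hC m

theorem RapidDecay.of_norm_le {a b : (Fin 2 → ℤ) → ℂ} (ha : RapidDecay a) (j : ℕ) (D : ℝ)
    (h : ∀ m, ‖b m‖ ≤ D * ‖m‖ ^ j * ‖a m‖) (hD : 0 ≤ D) : RapidDecay b := by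
  intro k
  obtain ⟨C, hC⟩ := ha (k + j)
  refine ⟨D * C, fun m => ?_⟩
  calc ‖m‖ ^ k * ‖b m‖ ≤ ‖m‖ ^ k * (D * ‖m‖ ^ j * ‖a m‖) := by gcongr; exact h m
    _ = D * (‖m‖ ^ (k + j) * ‖a m‖) := by ring
    _ ≤ D * C := by gcongr; exact hC m

theorem RapidDecay.mul_coord {a : (Fin 2 → ℤ) → ℂ} (ha : RapidDecay a) (i : Fin 2) (c : ℂ) :
    RapidDecay fun m => c * m i * a m := by
  refine ha.of_norm_le 1 ‖c‖ (fun m => ?_) (norm_nonneg _)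
  rw [norm_mul, norm_mul, pow_one]
  gcongr
  have := norm_le_pi_norm m i
  rwa [Complex.norm_intCast, ← Int.norm_eq_abs]

/-- The sum of the Fourier series with coefficients `a`. -/
def torusSeries (a : (Fin 2 → ℤ) → ℂ) (x : ℝ × ℝ) : ℂ := ∑' m, a m * torusExp m x

theorem RapidDecay.summable_torusExp {a : (Fin 2 → ℤ) → ℂ} (ha : RapidDecay a) (x : ℝ × ℝ) :
    Summable fun m => a m * torusExp m x :=
  Summable.of_norm (by simpa [norm_torusExp] using ha.summable)

theorem torusPeriodic_torusSeries (a : (Fin 2 → ℤ) → ℂ) : TorusPeriodic (torusSeries a) := by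
  intro m n x
  unfold torusSeries
  congr 1; funext k
  congr 1
  unfold torusExp
  rw [Complex.exp_eq_exp_iff_exists_int]
  refine ⟨k 0 * m + k 1 * n, ?_⟩
  push_cast
  ring

theorem hasFDerivAt_torusExp (m : Fin 2 → ℤ) (x : ℝ × ℝ) : HasFDerivAt (torusExp m)
    ((ContinuousLinearMap.fst ℝ ℝ ℝ).smulRight (2 * Real.pi * Complex.I * m 0 * torusExp m x) +
    (ContinuousLinearMap.snd ℝ ℝ ℝ).smulRight (2 * Real.pi * Complex.I * m 1 * torusExp m x)) x := by
  have h1 : HasFDerivAt (fun x : ℝ × ℝ => (x.1 : ℂ))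
      (Complex.ofRealCLM.comp (ContinuousLinearMap.fst ℝ ℝ ℝ)) x :=
    (Complex.ofRealCLM.comp (ContinuousLinearMap.fst ℝ ℝ ℝ)).hasFDerivAt
  have h2 : HasFDerivAt (fun x : ℝ × ℝ => (x.2 : ℂ))
      (Complex.ofRealCLM.comp (ContinuousLinearMap.snd ℝ ℝ ℝ)) x :=
    (Complex.ofRealCLM.comp (ContinuousLinearMap.snd ℝ ℝ ℝ)).hasFDerivAt
  have h3 := (((h1.const_mul (m 0 : ℂ)).add (h2.const_mul (m 1 : ℂ))).const_mul
    (2 * Real.pi * Complex.I)).cexp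
  refine h3.congr_fderiv ?_
  ext <;> simp [torusExp] <;> ring

theorem RapidDecay.hasFDerivAt_torusSeries {a : (Fin 2 → ℤ) → ℂ} (ha : RapidDecay a) (x : ℝ × ℝ) :
    HasFDerivAt (torusSeries a)
      ((ContinuousLinearMap.fst ℝ ℝ ℝ).smulRight
        (torusSeries (fun m => 2 * Real.pi * Complex.I * m 0 * a m) x) +
      (ContinuousLinearMap.snd ℝ ℝ ℝ).smulRight
        (torusSeries (fun m => 2 * Real.pi * Complex.I * m 1 * a m) x)) x := by
  have d0 := ha.mul_coord 0 (2 * Real.pi * Complex.I)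
  have d1 := ha.mul_coord 1 (2 * Real.pi * Complex.I)
  have bound : ∀ m y, ‖a m •
        ((ContinuousLinearMap.fst ℝ ℝ ℝ).smulRight (2 * Real.pi * Complex.I * m 0 * torusExp m y) +
        (ContinuousLinearMap.snd ℝ ℝ ℝ).smulRight
          (2 * Real.pi * Complex.I * m 1 * torusExp m y))‖ ≤
      ‖2 * Real.pi * Complex.I * m 0 * a m‖ + ‖2 * Real.pi * Complex.I * m 1 * a m‖ := by
    intro m y
    refine ContinuousLinearMap.opNorm_le_bound _ (by positivity) fun v => ?_
    have h1 : |v.1| ≤ ‖v‖ := norm_fst_le v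
    have h2 : |v.2| ≤ ‖v‖ := norm_snd_le v
    simp only [smul_apply, add_apply, ContinuousLinearMap.smulRight_apply,
      ContinuousLinearMap.coe_fst', ContinuousLinearMap.coe_snd']
    rw [smul_add, add_mul]
    refine (norm_add_le _ _).trans (add_le_add ?_ ?_)
    · simp only [norm_smul, norm_mul, norm_torusExp, mul_one, Real.norm_eq_abs]
      calc _ = (‖(2 : ℂ)‖ * ‖(Real.pi : ℂ)‖ * ‖Complex.I‖ * ‖(m 0 : ℂ)‖ * ‖a m‖) * |v.1| := by ring
        _ ≤ _ := by gcongr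
    · simp only [norm_smul, norm_mul, norm_torusExp, mul_one, Real.norm_eq_abs]
      calc _ = (‖(2 : ℂ)‖ * ‖(Real.pi : ℂ)‖ * ‖Complex.I‖ * ‖(m 1 : ℂ)‖ * ‖a m‖) * |v.2| := by ring
        _ ≤ _ := by gcongr
  have h := hasFDerivAt_tsum (d0.summable.add d1.summable)
    (fun m y => (hasFDerivAt_torusExp m y).const_mul (a m)) bound (ha.summable_torusExp x) x
  · refine h.congr_fderiv ?_
    have hs : Summable fun m => a m •
        ((ContinuousLinearMap.fst ℝ ℝ ℝ).smulRight (2 * Real.pi * Complex.I * m 0 * torusExp m x) +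
        (ContinuousLinearMap.snd ℝ ℝ ℝ).smulRight
          (2 * Real.pi * Complex.I * m 1 * torusExp m x)) :=
      Summable.of_norm_bounded (d0.summable.add d1.summable) (bound · x)
    have happ : ∀ v : ℝ × ℝ, (∑' m, a m •
        ((ContinuousLinearMap.fst ℝ ℝ ℝ).smulRight (2 * Real.pi * Complex.I * m 0 * torusExp m x) +
        (ContinuousLinearMap.snd ℝ ℝ ℝ).smulRight
          (2 * Real.pi * Complex.I * m 1 * torusExp m x))) v = ∑' m, (a m •
        ((ContinuousLinearMap.fst ℝ ℝ ℝ).smulRight (2 * Real.pi * Complex.I * m 0 * torusExp m x) +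
        (ContinuousLinearMap.snd ℝ ℝ ℝ).smulRight
          (2 * Real.pi * Complex.I * m 1 * torusExp m x))) v := fun v =>
      (ContinuousLinearMap.apply ℝ ℂ v).map_tsum hs
    ext
    · simp only [ContinuousLinearMap.comp_apply, happ]
      simp [torusSeries]
      congr 1; funext m; ring
    · simp only [ContinuousLinearMap.comp_apply, happ]
      simp [torusSeries]
      congr 1; funext m; ring

theorem RapidDecay.contDiff_torusSeries {a : (Fin 2 → ℤ) → ℂ} (ha : RapidDecay a) :
    ContDiff ℝ ∞ (torusSeries a) := by
  rw [contDiff_infty]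
  intro k
  induction k generalizing a with
  | zero =>
    exact contDiff_zero.2 (continuous_iff_continuousAt.2 fun x =>
      (ha.hasFDerivAt_torusSeries x).continuousAt)
  | succ k ih =>
    have : ((k + 1 : ℕ) : WithTop ℕ∞) = k + 1 := by norm_cast
    rw [this, contDiff_succ_iff_fderiv]
    refine ⟨fun x => (ha.hasFDerivAt_torusSeries x).differentiableAt, by simp, ?_⟩
    rw [funext fun x => (ha.hasFDerivAt_torusSeries x).fderiv]
    exact (contDiff_const.smulRight (ih (ha.mul_coord 0 _))).add
      (contDiff_const.smulRight (ih (ha.mul_coord 1 _)))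

theorem torusSeries_single (c : ℂ) (x : ℝ × ℝ) : torusSeries (Pi.single 0 c) x = c := by
  unfold torusSeries
  rw [tsum_eq_single 0 (fun m hm => by simp [Pi.single_eq_of_ne hm])]
  simp [torusExp]

/-- The continuous function on the torus with Fourier coefficients `a`. -/
def torusSum (a : (Fin 2 → ℤ) → ℂ) : C(Torus, ℂ) := ∑' m, a m • mFourier m

theorem RapidDecay.summable_mFourier {a : (Fin 2 → ℤ) → ℂ} (ha : RapidDecay a) :
    Summable fun m => a m • (mFourier m : C(Torus, ℂ)) :=
  Summable.of_norm (by simpa [norm_smul, mFourier_norm] using ha.summable)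

theorem RapidDecay.torusSum_torusMk {a : (Fin 2 → ℤ) → ℂ} (ha : RapidDecay a) (x : ℝ × ℝ) :
    torusSum a (torusMk x) = torusSeries a x := by
  have h := (ContinuousMap.evalCLM ℂ (torusMk x) : C(Torus, ℂ) →L[ℂ] ℂ).map_tsum
    ha.summable_mFourier
  simp only [ContinuousMap.evalCLM_apply] at h
  rw [torusSum, h, torusSeries]
  congr 1; funext m
  rw [← mFourier_torusMk]; rfl

theorem RapidDecay.torusIncl_torusSum {q : TorusL2}
    (ha : RapidDecay fun m => mFourierBasis.repr q m) :
    torusIncl (torusSum fun m => mFourierBasis.repr q m) = q := by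
  rw [torusSum, torusIncl.map_tsum ha.summable_mFourier]
  simp only [map_smul]
  have h := (mFourierBasis (d := Fin 2)).hasSum_repr q
  rw [coe_mFourierBasis] at h
  exact h.tsum_eq

/-- The Fourier symbol of `∂ ∘ ∂bar⁻¹`. -/
def beurlingSymbol (m : Fin 2 → ℤ) : ℂ :=
  if m = 0 then 1 else (m 0 - Complex.I * m 1) / (m 0 + Complex.I * m 1)

theorem int_add_I_mul_ne_zero {m : Fin 2 → ℤ} (hm : m ≠ 0) : (m 0 + Complex.I * m 1 : ℂ) ≠ 0 := by
  intro h
  apply hm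
  have h1 := congrArg Complex.re h
  have h2 := congrArg Complex.im h
  simp at h1 h2
  ext i; fin_cases i <;> simp [h1, h2]

theorem norm_beurlingSymbol (m : Fin 2 → ℤ) : ‖beurlingSymbol m‖ = 1 := by
  unfold beurlingSymbol
  split_ifs with h
  · simp
  · have h1 : (m 0 - Complex.I * m 1 : ℂ) = conj (m 0 + Complex.I * m 1 : ℂ) := by
      simp; ring
    rw [norm_div, h1, Complex.norm_conj, div_self]
    exact norm_ne_zero_iff.2 (int_add_I_mul_ne_zero h)

/-- The operator `∂ = (∂ₓ - i ∂_y) / 2`. -/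
def dz (f : ℝ × ℝ → ℂ) (x : ℝ × ℝ) : ℂ :=
  (fderiv ℝ f x (1, 0) - Complex.I * fderiv ℝ f x (0, 1)) / 2

/-- The operator `∂bar = (∂ₓ + i ∂_y) / 2`. -/
def dzbar (f : ℝ × ℝ → ℂ) (x : ℝ × ℝ) : ℂ :=
  (fderiv ℝ f x (1, 0) + Complex.I * fderiv ℝ f x (0, 1)) / 2

/-- The unknown is q = ∂bar g. Then ∂g = Tq for the unimodular symbol `beurlingSymbol`, and the
equation becomes q = μTq + ν, which is solvable in `L²` with rapidly decreasing coefficients.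
Inverting ∂bar on the Fourier side gives g up to the mean of q, which costs a linear term. -/
theorem exists_periodic_beltrami {μ ν : ℝ × ℝ → ℂ} (hμ : ContDiff ℝ ∞ μ) (hν : ContDiff ℝ ∞ ν)
    (pμ : TorusPeriodic μ) (pν : TorusPeriodic ν) {k : ℝ} (hk1 : k < 1) (hk : ∀ x, ‖μ x‖ ≤ k) :
    ∃ (g : ℝ × ℝ → ℂ) (c : ℂ), ContDiff ℝ ∞ g ∧ TorusPeriodic (fun x => g x - 2 * c * x.1) ∧
      ∀ x, dzbar g x = μ x * dz g x + ν x := by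
  obtain ⟨M, hM⟩ := pμ.exists_lift hμ.continuous
  obtain ⟨N, hN⟩ := pν.exists_lift hν.continuous
  obtain ⟨q, hq, hQ⟩ := exists_beltrami_L2 beurlingSymbol norm_beurlingSymbol (μ := M) (ν := N)
    (k := k) (fun t => by
      obtain ⟨x, rfl⟩ := isOpenQuotientMap_torusMk.surjective t
      rw [hM]; exact hk x) hk1 (pμ.contDiff_torusTrans_lift hμ hM)
    (pν.contDiff_torusTrans_lift hν hN)
  have ha : RapidDecay fun m => mFourierBasis.repr q m := by
    intro k
    have h : ∀ i, ∃ C : ℝ, ∀ m : Fin 2 → ℤ, |(m i : ℝ)| ^ k * ‖mFourierBasis.repr q m‖ ≤ C := by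
      intro i
      obtain ⟨Q, hs, hQ⟩ := hQ i
      exact exists_fourier_decay i k _ Q hs fun m s => by
        rw [hQ, torusBasis_repr_multiplier, mFourier_single_coe]
    choose C hC using h
    refine ⟨max (C 0) (C 1), fun m => ?_⟩
    obtain ⟨i, hi⟩ : ∃ i, ‖m‖ = |(m i : ℝ)| := by
      obtain ⟨i, hi⟩ := Finite.exists_max fun i => ‖m i‖
      refine ⟨i, ?_⟩
      rw [← Int.norm_eq_abs]
      exact le_antisymm ((pi_norm_le_iff_of_nonneg (norm_nonneg _)).2 hi) (norm_le_pi_norm m i)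
    rw [hi]
    refine (hC i m).trans ?_
    fin_cases i
    · exact le_max_left _ _
    · exact le_max_right _ _
  have ha' : RapidDecay fun m => mFourierBasis.repr
      (torusMultiplier beurlingSymbol norm_beurlingSymbol q) m :=
    ha.of_norm_le 0 1 (fun m => by simp [torusBasis_repr_multiplier, norm_beurlingSymbol])
      zero_le_one
  set a : (Fin 2 → ℤ) → ℂ := fun m => mFourierBasis.repr q m with hadef
  have eq1 : ∀ x, torusSeries a x =
      μ x * torusSeries (fun m => beurlingSymbol m * a m) x + ν x := by
    intro x
    have h1 : torusSum a = M * torusSum (fun m => mFourierBasis.repr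
        (torusMultiplier beurlingSymbol norm_beurlingSymbol q) m) + N := by
      apply torusIncl_injective
      rw [ha.torusIncl_torusSum, map_add, ← torusMul_incl, ha'.torusIncl_torusSum]
      exact hq
    have h2 := congrArg (fun F : C(Torus, ℂ) => F (torusMk x)) h1
    simp only [ContinuousMap.add_apply, ContinuousMap.mul_apply] at h2
    rw [ha.torusSum_torusMk, ha'.torusSum_torusMk, hM, hN] at h2
    simpa only [torusBasis_repr_multiplier] using h2
  have hbeq : ∀ m : Fin 2 → ℤ, m ≠ 0 → 1 ≤ ‖(m 0 + Complex.I * m 1 : ℂ)‖ := by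
    intro m hm
    rw [← one_le_sq_iff₀ (norm_nonneg _), ← Complex.normSq_eq_norm_sq, Complex.normSq_apply]
    have h1 : 1 ≤ m 0 * m 0 + m 1 * m 1 := by
      by_contra h
      have h2 : m 0 * m 0 + m 1 * m 1 = 0 := by
        nlinarith [mul_self_nonneg (m 0), mul_self_nonneg (m 1)]
      have h3 : m 0 = 0 := by nlinarith [mul_self_nonneg (m 0), mul_self_nonneg (m 1)]
      have h4 : m 1 = 0 := by nlinarith [mul_self_nonneg (m 0), mul_self_nonneg (m 1)]
      apply hm
      ext i; fin_cases i <;> simp [h3, h4]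
    simp
    exact_mod_cast h1
  -- Division by the symbol of ∂bar. At `m = 0` the denominator vanishes and the quotient is 0 by
  -- convention.
  let b : (Fin 2 → ℤ) → ℂ := fun m => a m / (Real.pi * Complex.I * (m 0 + Complex.I * m 1))
  have hb : RapidDecay b := by
    refine ha.of_norm_le 0 1 (fun m => ?_) zero_le_one
    rw [pow_zero, one_mul, one_mul, norm_div]
    by_cases hm : m = 0
    · simp [hm]
    · refine div_le_self (norm_nonneg _) ?_
      rw [norm_mul, norm_mul, Complex.norm_I, Complex.norm_real, Real.norm_eq_abs,
        abs_of_pos Real.pi_pos]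
      nlinarith [Real.pi_gt_three, hbeq m hm]
  -- The ∂bar of a periodic function has mean zero, so the zero mode `a 0` of q is supplied by `2 *
  -- a 0 * x.1`, on which ∂ and ∂bar both equal `a 0`. That is why `beurlingSymbol` is 1 at 0.
  refine ⟨fun x => torusSeries b x + 2 * a 0 * x.1, a 0, ?_, ?_, ?_⟩
  · refine hb.contDiff_torusSeries.add (contDiff_const.mul ?_)
    exact Complex.ofRealCLM.contDiff.comp contDiff_fst
  · intro m n x
    simpa using torusPeriodic_torusSeries b m n x
  · intro x
    have hd : HasFDerivAt (fun x : ℝ × ℝ => torusSeries b x + 2 * a 0 * x.1) _ x :=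
      (hb.hasFDerivAt_torusSeries x).add
        ((Complex.ofRealCLM.comp (ContinuousLinearMap.fst ℝ ℝ ℝ)).hasFDerivAt.const_mul (2 * a 0))
    have c0 := hb.mul_coord 0 (2 * Real.pi * Complex.I)
    have c1 := hb.mul_coord 1 (2 * Real.pi * Complex.I)
    -- The value `e = i` gives ∂bar and `e = -i` gives ∂.
    have lin : ∀ e : ℂ, (torusSeries (fun m => 2 * Real.pi * Complex.I * m 0 * b m) x + 2 * a 0 +
        e * torusSeries (fun m => 2 * Real.pi * Complex.I * m 1 * b m) x) / 2 =
        torusSeries (fun m => Real.pi * Complex.I * (m 0 + e * m 1) * b m +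
          (Pi.single 0 (a 0) : (Fin 2 → ℤ) → ℂ) m) x := by
      intro e
      have e0 := torusSeries_single (a 0) x
      have s0 := c0.summable_torusExp x
      have s1 := c1.summable_torusExp x
      have s2 : Summable fun m : Fin 2 → ℤ => (Pi.single 0 (a 0) : (Fin 2 → ℤ) → ℂ) m * torusExp m x :=
        summable_of_ne_finset_zero (s := {0}) fun m hm => by
          simp only [Finset.mem_singleton] at hm
          simp [Pi.single_eq_of_ne hm]
      unfold torusSeries at e0 ⊢
      nth_rewrite 1 [← e0]
      rw [← tsum_mul_left, ← s0.tsum_add (s2.mul_left 2), ← tsum_mul_left,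
        ← (s0.add (s2.mul_left 2)).tsum_add (s1.mul_left e), ← tsum_div_const]
      congr 1; funext m; ring
    have h1 : dzbar (fun x : ℝ × ℝ => torusSeries b x + 2 * a 0 * x.1) x = torusSeries a x := by
      rw [dzbar, hd.fderiv]
      have := lin Complex.I
      simp at this ⊢
      rw [this]
      congr 1; funext m
      by_cases hm : m = 0
      · simp [hm]
      · have := int_add_I_mul_ne_zero hm
        simp only [b, Pi.single_eq_of_ne hm]
        field_simp
        simp
    have h2 : dz (fun x : ℝ × ℝ => torusSeries b x + 2 * a 0 * x.1) x =
        torusSeries (fun m => beurlingSymbol m * a m) x := by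
      rw [dz, hd.fderiv]
      have := lin (-Complex.I)
      simp [← sub_eq_add_neg] at this ⊢
      rw [this]
      congr 1; funext m
      by_cases hm : m = 0
      · simp [hm, beurlingSymbol]
      · have := int_add_I_mul_ne_zero hm
        simp only [b, Pi.single_eq_of_ne hm, beurlingSymbol, if_neg hm]
        field_simp
        ring
    rw [h1, h2, eq1]

end TorusSeries

/-! ### Homogeneous Beltrami equation: rigidity and a coordinate without critical points -/

noncomputable section Beltrami

open MeasureTheory
open scoped ComplexConjugate

theorem TorusPeriodic.exists_mem_Icc {E : Type*} {f : ℝ × ℝ → E} (hf : TorusPeriodic f)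
    (x : ℝ × ℝ) : ∃ y ∈ Set.Icc (0 : ℝ) 1 ×ˢ Set.Icc (0 : ℝ) 1, f y = f x := by
  refine ⟨(Int.fract x.1, Int.fract x.2), ⟨⟨Int.fract_nonneg _, (Int.fract_lt_one _).le⟩,
    Int.fract_nonneg _, (Int.fract_lt_one _).le⟩, ?_⟩
  rw [← hf (-⌊x.1⌋) (-⌊x.2⌋) x]
  congr 1
  ext <;> simp [Int.fract, sub_eq_add_neg]

/-- A nonnegative periodic function that is a divergence vanishes. -/
theorem divergence_eq_zero_of_torusPeriodic {P Q : ℝ × ℝ → ℝ} (hP : ContDiff ℝ 1 P)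
    (hQ : ContDiff ℝ 1 Q) (pP : TorusPeriodic P) (pQ : TorusPeriodic Q)
    (h0 : ∀ x, 0 ≤ fderiv ℝ P x (1, 0) + fderiv ℝ Q x (0, 1)) (x : ℝ × ℝ) :
    fderiv ℝ P x (1, 0) + fderiv ℝ Q x (0, 1) = 0 := by
  by_contra hne
  have hc : Continuous fun x => fderiv ℝ P x (1, 0) + fderiv ℝ Q x (0, 1) :=
    ((hP.continuous_fderiv (by simp)).clm_apply continuous_const).add
      ((hQ.continuous_fderiv (by simp)).clm_apply continuous_const)
  have hp : TorusPeriodic fun x => fderiv ℝ P x (1, 0) + fderiv ℝ Q x (0, 1) := by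
    intro m n y
    have h1 := pP.fderiv_apply (1, 0) m n y
    have h2 := pQ.fderiv_apply (0, 1) m n y
    simp only at h1 h2 ⊢
    rw [h1, h2]
  obtain ⟨y, hy, hyx⟩ := hp.exists_mem_Icc x
  have hpos : 0 < fderiv ℝ P y (1, 0) + fderiv ℝ Q y (0, 1) :=
    lt_of_le_of_ne (h0 y) fun h => hne (hyx ▸ h.symm)
  have hint := integral2_divergence_prod_of_hasFDerivAt_off_countable P Q (fun x => fderiv ℝ P x)
    (fun x => fderiv ℝ Q x) 0 0 1 1 ∅ Set.countable_empty hP.continuous.continuousOn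
    hQ.continuous.continuousOn (fun x _ => (hP.differentiable (by simp) x).hasFDerivAt)
    (fun x _ => (hQ.differentiable (by simp) x).hasFDerivAt)
    (hc.continuousOn.integrableOn_compact (by
      exact isCompact_uIcc.prod isCompact_uIcc))
  have e1 : ∀ y, P (1, y) = P (0, y) := fun y => by simpa using pP 1 0 (0, y)
  have e2 : ∀ y, Q (y, 1) = Q (y, 0) := fun y => by simpa using pQ 0 1 (y, 0)
  simp only [e1, e2, sub_self, zero_add] at hint
  have hpos2 : 0 < ∫ x in (0:ℝ)..1, ∫ y in (0:ℝ)..1,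
      (fderiv ℝ P (x, y) (1, 0) + fderiv ℝ Q (x, y) (0, 1)) := by
    refine intervalIntegral.integral_pos zero_lt_one ?_ ?_ ⟨y.1, hy.1, ?_⟩
    · exact (intervalIntegral.continuous_parametric_intervalIntegral_of_continuous' hc 0 1).continuousOn
    · exact fun x _ => intervalIntegral.integral_nonneg zero_le_one fun y _ => h0 _
    · refine intervalIntegral.integral_pos zero_lt_one ?_ (fun z _ => h0 _) ⟨y.2, hy.2, hpos⟩
      exact (hc.comp (by fun_prop : Continuous fun z : ℝ => (y.1, z))).continuousOn
  exact hpos2.ne' hint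

/-- The right side is the Jacobian determinant of `f`. Thus a solution of the Beltrami equation with
|μ| < 1 has nonnegative Jacobian, and its differential vanishes wherever the Jacobian does. -/
theorem jacobian_eq (f : ℝ × ℝ → ℂ) (x : ℝ × ℝ) :
    ‖dz f x‖ ^ 2 - ‖dzbar f x‖ ^ 2 =
      (conj (fderiv ℝ f x (1, 0)) * fderiv ℝ f x (0, 1)).im := by
  rw [← Complex.normSq_eq_norm_sq, ← Complex.normSq_eq_norm_sq, Complex.normSq_apply,
    Complex.normSq_apply, dz, dzbar]
  simp
  ring

theorem fderiv_eq_zero_of_dz {f : ℝ × ℝ → ℂ} {x : ℝ × ℝ} (h1 : dz f x = 0) (h2 : dzbar f x = 0) :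
    fderiv ℝ f x = 0 := by
  have e1 : fderiv ℝ f x (1, 0) = dz f x + dzbar f x := by rw [dz, dzbar]; ring
  have e2 : fderiv ℝ f x (0, 1) = Complex.I * (dz f x - dzbar f x) := by
    rw [dz, dzbar]; linear_combination (-1) * fderiv ℝ f x (0, 1) * (-1) * Complex.I_sq
  rw [h1, h2] at e1 e2
  ext <;> simp_all

theorem fderiv_eq_zero_of_jacobian {f μ : ℝ × ℝ → ℂ} {x : ℝ × ℝ} (hμ : ‖μ x‖ < 1)
    (h : dzbar f x = μ x * dz f x)
    (h0 : (conj (fderiv ℝ f x (1, 0)) * fderiv ℝ f x (0, 1)).im = 0) : fderiv ℝ f x = 0 := by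
  rw [← jacobian_eq, h, norm_mul, mul_pow] at h0
  have h1 : ‖μ x‖ ^ 2 < 1 := by
    rw [sq_lt_one_iff₀ (norm_nonneg _)]; exact hμ
  have h2 : dz f x = 0 := by
    by_contra hne
    have : 0 < ‖dz f x‖ ^ 2 := by positivity
    nlinarith
  exact fderiv_eq_zero_of_dz h2 (by rw [h, h2, mul_zero])

theorem jacobian_nonneg {f μ : ℝ × ℝ → ℂ} {x : ℝ × ℝ} (hμ : ‖μ x‖ < 1)
    (h : dzbar f x = μ x * dz f x) :
    0 ≤ (conj (fderiv ℝ f x (1, 0)) * fderiv ℝ f x (0, 1)).im := by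
  rw [← jacobian_eq, h, norm_mul, mul_pow]
  have h1 : ‖μ x‖ ^ 2 ≤ 1 := pow_le_one₀ (norm_nonneg _) hμ.le
  nlinarith [sq_nonneg ‖dz f x‖]

theorem fderiv_fderiv_apply {E F : Type*} [NormedAddCommGroup E] [NormedSpace ℝ E]
    [NormedAddCommGroup F] [NormedSpace ℝ F] {f : E → F} (hf : ContDiff ℝ ∞ f) (x v w : E) :
    fderiv ℝ (fun y => fderiv ℝ f y v) x w = fderiv ℝ (fderiv ℝ f) x w v := by
  have h : DifferentiableAt ℝ (fderiv ℝ f) x :=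
    (hf.fderiv_right (m := ∞) (by simp)).differentiable (by simp) x
  rw [fderiv_clm_apply h (by fun_prop)]
  simp

theorem fderiv_fderiv_comm {E F : Type*} [NormedAddCommGroup E] [NormedSpace ℝ E]
    [NormedAddCommGroup F] [NormedSpace ℝ F] {f : E → F} (hf : ContDiff ℝ ∞ f) (x v w : E) :
    fderiv ℝ (fun y => fderiv ℝ f y v) x w = fderiv ℝ (fun y => fderiv ℝ f y w) x v := by
  rw [fderiv_fderiv_apply hf, fderiv_fderiv_apply hf]
  exact (hf.contDiffAt.isSymmSndFDerivAt (by
    simp only [minSmoothness_of_isRCLikeNormedField]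
    exact WithTop.coe_le_coe.2 (le_top : (2 : ℕ∞) ≤ ⊤))).eq _ _

theorem ContDiff.fderiv_apply_const {E F : Type*} [NormedAddCommGroup E] [NormedSpace ℝ E]
    [NormedAddCommGroup F] [NormedSpace ℝ F] {f : E → F} (hf : ContDiff ℝ ∞ f) (v : E) :
    ContDiff ℝ ∞ fun x => fderiv ℝ f x v :=
  (hf.fderiv_right (m := ∞) (by simp)).clm_apply contDiff_const

/-- A solution of the Beltrami equation on the torus with a unitary character is constant. -/
theorem fderiv_eq_zero_of_beltrami {h μ : ℝ × ℝ → ℂ} (hh : ContDiff ℝ ∞ h)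
    (hμ : ∀ x, ‖μ x‖ < 1) (hb : ∀ x, dzbar h x = μ x * dz h x)
    (hp : ∀ v, TorusPeriodic fun x => conj (h x) * fderiv ℝ h x v) (x : ℝ × ℝ) :
    fderiv ℝ h x = 0 := by
  have hs : ∀ v, ContDiff ℝ ∞ fun x => (conj (h x) * fderiv ℝ h x v).im := fun v =>
    Complex.imCLM.contDiff.comp ((Complex.conjCLE.contDiff.comp hh).mul (hh.fderiv_apply_const v))
  have hd : ∀ (v w x : ℝ × ℝ), fderiv ℝ (fun x => (conj (h x) * fderiv ℝ h x v).im) x w =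
      (conj (fderiv ℝ h x w) * fderiv ℝ h x v +
        conj (h x) * fderiv ℝ (fun y => fderiv ℝ h y v) x w).im := by
    intro v w x
    have h1 : HasFDerivAt h (fderiv ℝ h x) x := (hh.differentiable (by simp) x).hasFDerivAt
    have h2 : HasFDerivAt (fun y => fderiv ℝ h y v) _ x :=
      ((hh.fderiv_apply_const v).differentiable (by simp) x).hasFDerivAt
    have h3 : HasFDerivAt (fun y => conj (h y)) _ x :=
      (Complex.conjCLE : ℂ →L[ℝ] ℂ).hasFDerivAt.comp x h1
    have h4 := Complex.imCLM.hasFDerivAt.comp x (h3.mul h2)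
    have h5 := h4.fderiv
    have h6 : (⇑Complex.imCLM ∘ ((fun y => conj (h y)) * fun y => fderiv ℝ h y v)) =
      fun x => (conj (h x) * fderiv ℝ h x v).im := rfl
    rw [h6] at h5
    rw [h5]
    simp
    ring
  -- By `hp` the 1-form Im(conj h dh) descends to the torus, even if h itself is periodic only up to
  -- a unitary factor. Its exterior derivative is twice the Jacobian, which is nonnegative and must
  -- therefore vanish.
  have key : ∀ x, fderiv ℝ (fun x => (conj (h x) * fderiv ℝ h x (0, 1)).im) x (1, 0) +
      fderiv ℝ (fun x => -(conj (h x) * fderiv ℝ h x (1, 0)).im) x (0, 1) =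
      2 * (conj (fderiv ℝ h x (1, 0)) * fderiv ℝ h x (0, 1)).im := by
    intro x
    rw [fderiv_fun_neg, neg_apply, hd, hd, fderiv_fderiv_comm hh x (0, 1) (1, 0)]
    simp
    ring
  have h1 := divergence_eq_zero_of_torusPeriodic ((hs (0, 1)).of_le (by simp))
    ((hs (1, 0)).neg.of_le (by simp))
    (fun m n x => congrArg Complex.im (hp (0, 1) m n x))
    (fun m n x => congrArg (fun z => -Complex.im z) (hp (1, 0) m n x))
    (fun x => by rw [key]; exact mul_nonneg zero_le_two (jacobian_nonneg (hμ x) (hb x))) x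
  rw [key] at h1
  exact fderiv_eq_zero_of_jacobian (hμ x) (hb x) (by linarith)

theorem dz_mul {f g : ℝ × ℝ → ℂ} (hf : Differentiable ℝ f) (hg : Differentiable ℝ g)
    (x : ℝ × ℝ) : dz (fun y => f y * g y) x = dz f x * g x + f x * dz g x := by
  rw [dz, dz, dz, fderiv_fun_mul (hf x) (hg x)]
  simp
  ring

theorem dzbar_mul {f g : ℝ × ℝ → ℂ} (hf : Differentiable ℝ f) (hg : Differentiable ℝ g)
    (x : ℝ × ℝ) : dzbar (fun y => f y * g y) x = dzbar f x * g x + f x * dzbar g x := by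
  rw [dzbar, dzbar, dzbar, fderiv_fun_mul (hf x) (hg x)]
  simp
  ring

theorem dz_cexp {f : ℝ × ℝ → ℂ} (hf : Differentiable ℝ f) (x : ℝ × ℝ) :
    dz (fun y => Complex.exp (f y)) x = Complex.exp (f x) * dz f x := by
  rw [dz, dz, ((hf x).hasFDerivAt.cexp).fderiv]
  simp
  ring

theorem dzbar_cexp {f : ℝ × ℝ → ℂ} (hf : Differentiable ℝ f) (x : ℝ × ℝ) :
    dzbar (fun y => Complex.exp (f y)) x = Complex.exp (f x) * dzbar f x := by
  rw [dzbar, dzbar, ((hf x).hasFDerivAt.cexp).fderiv]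
  simp
  ring

theorem contDiff_dz {f : ℝ × ℝ → ℂ} (hf : ContDiff ℝ ∞ f) : ContDiff ℝ ∞ (dz f) :=
  ((hf.fderiv_apply_const _).sub (contDiff_const.mul (hf.fderiv_apply_const _))).div_const 2

theorem dzbar_dz {f : ℝ × ℝ → ℂ} (hf : ContDiff ℝ ∞ f) (x : ℝ × ℝ) :
    dzbar (dz f) x = dz (dzbar f) x := by
  have h1 : ∀ v, DifferentiableAt ℝ (fun y => fderiv ℝ f y v) x := fun v =>
    (hf.fderiv_apply_const v).differentiable (by simp) x
  have a : HasFDerivAt (dz f) _ x := (((h1 (1, 0)).hasFDerivAt.sub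
    ((h1 (0, 1)).hasFDerivAt.const_mul Complex.I)).mul_const (2 : ℂ)⁻¹)
  have b : HasFDerivAt (dzbar f) _ x := (((h1 (1, 0)).hasFDerivAt.add
    ((h1 (0, 1)).hasFDerivAt.const_mul Complex.I)).mul_const (2 : ℂ)⁻¹)
  rw [dzbar, a.fderiv, dz, b.fderiv]
  have c := fderiv_fderiv_comm hf x (1, 0) (0, 1)
  simp [c]
  ring

/-- The affine function `x ↦ α x₁ + i x₂`. -/
def affCoord (α : ℂ) (x : ℝ × ℝ) : ℂ := α * x.1 + Complex.I * x.2

theorem contDiff_affCoord (α : ℂ) : ContDiff ℝ ∞ (affCoord α) :=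
  (contDiff_const.mul (Complex.ofRealCLM.contDiff.comp contDiff_fst)).add
    (contDiff_const.mul (Complex.ofRealCLM.contDiff.comp contDiff_snd))

theorem fderiv_affCoord (α : ℂ) (x v : ℝ × ℝ) : fderiv ℝ (affCoord α) x v = affCoord α v := by
  have h := ((Complex.ofRealCLM.comp (ContinuousLinearMap.fst ℝ ℝ ℝ)).hasFDerivAt
    (x := x)).const_mul α |>.add (((Complex.ofRealCLM.comp
      (ContinuousLinearMap.snd ℝ ℝ ℝ)).hasFDerivAt (x := x)).const_mul Complex.I)
  have h2 : HasFDerivAt (affCoord α) _ x := h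
  rw [h2.fderiv]
  simp [affCoord]

theorem dz_add {f g : ℝ × ℝ → ℂ} (hf : Differentiable ℝ f) (hg : Differentiable ℝ g)
    (x : ℝ × ℝ) : dz (fun y => f y + g y) x = dz f x + dz g x := by
  rw [dz, dz, dz, fderiv_fun_add (hf x) (hg x)]
  simp
  ring

theorem dzbar_add {f g : ℝ × ℝ → ℂ} (hf : Differentiable ℝ f) (hg : Differentiable ℝ g)
    (x : ℝ × ℝ) : dzbar (fun y => f y + g y) x = dzbar f x + dzbar g x := by
  rw [dzbar, dzbar, dzbar, fderiv_fun_add (hf x) (hg x)]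
  simp
  ring

theorem eq_of_fderiv_eq_zero {E : Type*} [NormedAddCommGroup E] [NormedSpace ℝ E]
    {f : ℝ × ℝ → E} (hf : Differentiable ℝ f) (h : ∀ x, fderiv ℝ f x = 0) (x y : ℝ × ℝ) :
    f x = f y :=
  is_const_of_fderiv_eq_zero hf h x y

/-- Uniformization of a torus: the Beltrami equation has a solution which is a local
diffeomorphism and the sum of a linear and a periodic function. -/
theorem exists_periodic_coordinate {μ : ℝ × ℝ → ℂ} (hμ : ContDiff ℝ ∞ μ) (pμ : TorusPeriodic μ)
    {k : ℝ} (hk1 : k < 1) (hk : ∀ x, ‖μ x‖ ≤ k) :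
    ∃ (f : ℝ × ℝ → ℂ) (α : ℂ), ContDiff ℝ ∞ f ∧ TorusPeriodic (fun x => f x - affCoord α x) ∧
      α.re ≠ 0 ∧ (∀ x, dzbar f x = μ x * dz f x) ∧ ∀ x, dz f x ≠ 0 := by
  have hμ1 : ∀ x, ‖μ x‖ < 1 := fun x => (hk x).trans_lt hk1
  have pdμ : TorusPeriodic (dz μ) := fun m n x => by
    have h1 := pμ.fderiv m n x
    simp only [dz, h1]
  -- With right side μ, the function f = z + g₀ solves the homogeneous equation. Differentiating
  -- that equation gives ∂bar(∂f) = μ ∂(∂f) + ∂μ ∂f, so a solution g₁ with right side ∂μ plays the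
  -- role of log ∂f.
  obtain ⟨g₀, c₀, hg₀, pg₀, eg₀⟩ := exists_periodic_beltrami hμ hμ pμ pμ hk1 hk
  obtain ⟨g₁, c₁, hg₁, pg₁, eg₁⟩ := exists_periodic_beltrami hμ (contDiff_dz hμ) pμ pdμ hk1 hk
  let f : ℝ × ℝ → ℂ := fun x => affCoord 1 x + g₀ x
  let α : ℂ := 1 + 2 * c₀
  have hf : ContDiff ℝ ∞ f := (contDiff_affCoord 1).add hg₀
  have df : Differentiable ℝ f := hf.differentiable (by simp)
  have pf : TorusPeriodic fun x => f x - affCoord α x := by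
    intro m n x
    have := pg₀ m n x
    simp only [f, α, affCoord] at this ⊢
    linear_combination this
  have pf' : ∀ (m n : ℤ) x, f (x.1 + m, x.2 + n) = f x + (α * m + Complex.I * n) := by
    intro m n x
    have := pf m n x
    simp only [affCoord] at this
    push_cast at this
    linear_combination this
  have ef : ∀ x, dzbar f x = μ x * dz f x := by
    intro x
    have d1 : Differentiable ℝ (affCoord 1) := (contDiff_affCoord 1).differentiable (by simp)
    have d2 : Differentiable ℝ g₀ := hg₀.differentiable (by simp)
    have e1 : dz (affCoord 1) x = 1 := by
      rw [dz, fderiv_affCoord, fderiv_affCoord]; simp [affCoord]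
    have e2 : dzbar (affCoord 1) x = 0 := by
      rw [dzbar, fderiv_affCoord, fderiv_affCoord]; simp [affCoord]
    simp only [f]
    rw [dz_add d1 d2, dzbar_add d1 d2, e1, e2, eg₀]
    ring
  have fne : ¬ ∀ x, fderiv ℝ f x = 0 := by
    intro h
    have h1 := eq_of_fderiv_eq_zero df h (0, 1) (0, 0)
    have h2 := pf' 0 1 (0, 0)
    simp at h2
    rw [h2] at h1
    simp at h1
  have pdf : ∀ v, TorusPeriodic fun x => fderiv ℝ f x v := by
    intro v m n x
    have h1 := pf.fderiv_apply v m n x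
    have h2 : ∀ x, fderiv ℝ (fun x => f x - affCoord α x) x v = fderiv ℝ f x v - affCoord α v := by
      intro x
      rw [fderiv_fun_sub (df x) ((contDiff_affCoord α).differentiable (by simp) x)]
      rw [← fderiv_affCoord α x v]; rfl
    simp only [h2] at h1
    simpa using h1
  -- If Re α = 0, then Re f is periodic and the Jacobian form d(Re f) ∧ d(Im f) is exact on the
  -- torus, hence zero. Then df = 0, which contradicts f(0, 1) = f(0, 0) + i.
  have hα : α.re ≠ 0 := by
    intro h0
    apply fne
    have hre : ContDiff ℝ ∞ fun x => (f x).re := Complex.reCLM.contDiff.comp hf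
    have him : ContDiff ℝ ∞ fun x => (f x).im := Complex.imCLM.contDiff.comp hf
    have dre : ∀ x v, fderiv ℝ (fun x => (f x).re) x v = (fderiv ℝ f x v).re := fun x v => by
      have := (Complex.reCLM.hasFDerivAt.comp x (df x).hasFDerivAt).fderiv
      exact congrArg (fun L => L v) this
    have dim : ∀ x v, fderiv ℝ (fun x => (f x).im) x v = (fderiv ℝ f x v).im := fun x v => by
      have := (Complex.imCLM.hasFDerivAt.comp x (df x).hasFDerivAt).fderiv
      exact congrArg (fun L => L v) this
    have pre : TorusPeriodic fun x => (f x).re := fun m n x => by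
      simp only [pf']; simp [h0]
    have hd : ∀ v w x : ℝ × ℝ, fderiv ℝ (fun y => (f y).re * fderiv ℝ (fun y => (f y).im) y v) x w =
        (fderiv ℝ f x w).re * (fderiv ℝ f x v).im +
          (f x).re * fderiv ℝ (fun y => fderiv ℝ (fun y => (f y).im) y v) x w := by
      intro v w x
      rw [fderiv_fun_mul (hre.differentiable (by simp) x)
        ((him.fderiv_apply_const v).differentiable (by simp) x)]
      simp [dre, dim]
      ring
    have key : ∀ x, fderiv ℝ (fun y => (f y).re * fderiv ℝ (fun y => (f y).im) y (0, 1)) x (1, 0) +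
        fderiv ℝ (fun y => -((f y).re * fderiv ℝ (fun y => (f y).im) y (1, 0))) x (0, 1) =
        (conj (fderiv ℝ f x (1, 0)) * fderiv ℝ f x (0, 1)).im := by
      intro x
      rw [fderiv_fun_neg, neg_apply, hd, hd, fderiv_fderiv_comm him x (0, 1) (1, 0)]
      simp
      ring
    have pp : ∀ v, TorusPeriodic fun y => (f y).re * fderiv ℝ (fun y => (f y).im) y v := by
      intro v m n x
      have h1 := pre m n x
      have h2 := pdf v m n x
      simp only [dim] at h1 h2 ⊢
      rw [h1, h2]
    have hs : ∀ v, ContDiff ℝ 1 fun y => (f y).re * fderiv ℝ (fun y => (f y).im) y v :=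
      fun v => (hre.mul (him.fderiv_apply_const v)).of_le (by simp)
    intro x
    refine fderiv_eq_zero_of_jacobian (hμ1 x) (ef x) ?_
    rw [← key]
    exact divergence_eq_zero_of_torusPeriodic (hs _) (hs _).neg (pp _)
      (fun m n x => congrArg Neg.neg (pp _ m n x))
      (fun x => by rw [key]; exact jacobian_nonneg (hμ1 x) (ef x)) x
  -- The real multiple of f whose period along the first generator cancels the real part of the
  -- period of g₁. Along the second generator g₁ has period 0 and f has period i, so all periods of
  -- G are imaginary and exp(-G) changes by unitary factors.
  let a : ℝ := -2 * c₁.re / α.re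
  let G : ℝ × ℝ → ℂ := fun x => g₁ x + a * f x
  have hG : ContDiff ℝ ∞ G := hg₁.add (contDiff_const.mul hf)
  have pG : ∀ (m n : ℤ), ∃ t : ℝ, ∀ x, G (x.1 + m, x.2 + n) = G x + t * Complex.I := by
    intro m n
    refine ⟨2 * c₁.im * m + a * (α.im * m + n), fun x => ?_⟩
    have h1 := pg₁ m n x
    have h2 := pf' m n x
    have h3 : a * α.re = -2 * c₁.re := by simp only [a]; field_simp
    simp only [G]
    rw [h2]
    have h4 : g₁ (x.1 + m, x.2 + n) = g₁ x + 2 * c₁ * m := by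
      push_cast at h1
      linear_combination h1
    rw [h4]
    apply Complex.ext
    · simp
      linear_combination (m : ℝ) * h3
    · simp
      ring
  have eG : ∀ x, dzbar G x = μ x * dz G x + dz μ x := by
    intro x
    have d1 : Differentiable ℝ g₁ := hg₁.differentiable (by simp)
    have d2 : Differentiable ℝ fun _ : ℝ × ℝ => (a : ℂ) := by fun_prop
    have z1 : dz (fun _ : ℝ × ℝ => (a : ℂ)) x = 0 := by simp [dz]
    have z2 : dzbar (fun _ : ℝ × ℝ => (a : ℂ)) x = 0 := by simp [dzbar]
    simp only [G]
    have d3 : Differentiable ℝ fun x => (a : ℂ) * f x := d2.mul df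
    rw [dz_add d1 d3, dzbar_add d1 d3, dz_mul d2 df, dzbar_mul d2 df, eg₁, ef,
      z1, z2]
    ring
  have hdf : ContDiff ℝ ∞ (dz f) := contDiff_dz hf
  have dG : Differentiable ℝ fun x => -G x := hG.neg.differentiable (by simp)
  let h : ℝ × ℝ → ℂ := fun x => dz f x * Complex.exp (-G x)
  have hh : ContDiff ℝ ∞ h := hdf.mul hG.neg.cexp
  have eh : ∀ x, dzbar h x = μ x * dz h x := by
    intro x
    have e1 : dzbar (dz f) x = dz μ x * dz f x + μ x * dz (dz f) x := by
      rw [dzbar_dz hf, funext ef, dz_mul (hμ.differentiable (by simp))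
        (hdf.differentiable (by simp))]
    have e2 : dzbar (fun x => -G x) x = -(μ x * dz G x + dz μ x) := by
      rw [← eG, dzbar, dzbar, fderiv_fun_neg]; simp; ring
    have e3 : dz (fun x => -G x) x = -dz G x := by
      rw [dz, dz, fderiv_fun_neg]; simp; ring
    simp only [h]
    rw [dzbar_mul (hdf.differentiable (by simp)) dG.cexp,
      dz_mul (hdf.differentiable (by simp)) dG.cexp, dz_cexp dG, dzbar_cexp dG, e1, e2, e3]
    ring
  have ph : ∀ (m n : ℤ), ∀ v, (fun x => conj (h x) * fderiv ℝ h x v) = fun x : ℝ × ℝ =>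
      conj (h (x.1 + m, x.2 + n)) * fderiv ℝ h (x.1 + m, x.2 + n) v := by
    intro m n v
    obtain ⟨t, ht⟩ := pG m n
    have h1 : ∀ x, h (x + ((m : ℝ), (n : ℝ))) = Complex.exp (-(t * Complex.I)) * h x := by
      intro x
      have h2 : dz f (x.1 + m, x.2 + n) = dz f x := by
        have a1 := pdf (1, 0) m n x
        have a2 := pdf (0, 1) m n x
        simp only at a1 a2
        rw [dz, dz, a1, a2]
      change dz f (x.1 + m, x.2 + n) * Complex.exp (-G (x.1 + m, x.2 + n)) = _
      rw [ht, h2, neg_add, Complex.exp_add]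
      simp only [h]
      ring
    funext x
    have h3 : fderiv ℝ h (x + ((m : ℝ), (n : ℝ))) v =
        Complex.exp (-(t * Complex.I)) * fderiv ℝ h x v := by
      rw [← fderiv_comp_add_right, funext h1, fderiv_const_mul (hh.differentiable (by simp) x)]
      rfl
    have h4 : conj (Complex.exp (-(t * Complex.I))) * Complex.exp (-(t * Complex.I)) = 1 := by
      rw [← Complex.exp_conj, ← Complex.exp_add]
      simp
    change _ = conj (h (x + ((m : ℝ), (n : ℝ)))) * fderiv ℝ h (x + ((m : ℝ), (n : ℝ))) v
    rw [h3, h1, map_mul conj (Complex.exp (-(t * Complex.I))) (h x)]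
    linear_combination (-(conj (h x) * fderiv ℝ h x v)) * h4
  have hconst := fderiv_eq_zero_of_beltrami hh hμ1 eh
    (fun v m n x => (congrFun (ph m n v) x).symm)
  -- The function h is constant, so a single zero of ∂f would make ∂f, and with it df, vanish
  -- everywhere.
  refine ⟨f, α, hf, pf, hα, ef, fun x hx => fne fun y => ?_⟩
  have h1 : h y = h x := eq_of_fderiv_eq_zero (hh.differentiable (by simp)) hconst y x
  simp only [h, hx, zero_mul, mul_eq_zero, Complex.exp_ne_zero, or_false] at h1
  exact fderiv_eq_zero_of_dz h1 (by rw [ef, h1, mul_zero])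

end Beltrami

/-! ### Uniformization of complex structures on the torus -/

noncomputable section Uniformization

open scoped ComplexConjugate

theorem bijective_of_injective_complex {L : ℝ × ℝ →L[ℝ] ℂ} (h : Function.Injective L) :
    Function.Bijective L :=
  ⟨h, (LinearMap.injective_iff_surjective_of_finrank_eq_finrank (f := L.toLinearMap)
    (by simp)).1 h⟩

theorem isLocalHomeomorph_of_bijective_fderiv {f : ℝ × ℝ → ℂ} (hf : ContDiff ℝ ∞ f)
    (hb : ∀ x, Function.Bijective (fderiv ℝ f x)) : IsLocalHomeomorph f := by
  intro x
  let e : (ℝ × ℝ) ≃L[ℝ] ℂ := ContinuousLinearEquiv.ofBijective (fderiv ℝ f x)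
    (LinearMap.ker_eq_bot.2 (hb x).1) (LinearMap.range_eq_top.2 (hb x).2)
  have h : HasFDerivAt f (e : ℝ × ℝ →L[ℝ] ℂ) x := by
    have h1 : (e : ℝ × ℝ →L[ℝ] ℂ) = fderiv ℝ f x := by ext <;> rfl
    rw [h1]
    exact (hf.differentiable (by simp) x).hasFDerivAt
  exact ⟨hf.contDiffAt.toOpenPartialHomeomorph f h (by simp),
    hf.contDiffAt.mem_toOpenPartialHomeomorph_source h (by simp), rfl⟩

/-- Since Re α ≠ 0, the linear map `affCoord α` is invertible, and `f` stays at bounded distance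
from it; so `f` is proper. A proper local homeomorphism is a covering with finite fibres, and the
simply connected ℂ admits a section. -/
theorem bijective_of_sub_affCoord_periodic {f : ℝ × ℝ → ℂ} {α : ℂ} (hf : ContDiff ℝ ∞ f)
    (hb : ∀ x, Function.Bijective (fderiv ℝ f x))
    (hp : TorusPeriodic fun x => f x - affCoord α x) (hα : α.re ≠ 0) : Function.Bijective f := by
  have hloc := isLocalHomeomorph_of_bijective_fderiv hf hb
  obtain ⟨C, hC⟩ : ∃ C, ∀ x, ‖f x - affCoord α x‖ ≤ C := by
    have hcont : Continuous fun x => f x - affCoord α x :=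
      hf.continuous.sub (contDiff_affCoord α).continuous
    obtain ⟨C, hC⟩ := (isCompact_Icc.prod isCompact_Icc :
      IsCompact (Set.Icc (0 : ℝ) 1 ×ˢ Set.Icc (0 : ℝ) 1)).exists_bound_of_continuousOn
        hcont.continuousOn
    refine ⟨C, fun x => ?_⟩
    obtain ⟨y, hy, hyx⟩ := hp.exists_mem_Icc x
    rw [← hyx]
    exact hC y hy
  have hproper : IsProperMap f := by
    rw [isProperMap_iff_tendsto_cocompact]
    refine ⟨hf.continuous, ?_⟩
    rw [← Metric.cobounded_eq_cocompact, ← Metric.cobounded_eq_cocompact,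
      ← tendsto_norm_atTop_iff_cobounded]
    let K : ℝ := |α.re|⁻¹ + (1 + |α.im| * |α.re|⁻¹)
    have hK : 0 < K := by positivity
    have hlin : ∀ x : ℝ × ℝ, ‖x‖ ≤ K * ‖affCoord α x‖ := by
      intro x
      have h1 : |x.1| ≤ |α.re|⁻¹ * ‖affCoord α x‖ := by
        have : x.1 = α.re⁻¹ * (affCoord α x).re := by simp [affCoord]; field_simp
        rw [this, abs_mul, abs_inv]
        gcongr
        exact Complex.abs_re_le_norm _
      have h2 : |x.2| ≤ (1 + |α.im| * |α.re|⁻¹) * ‖affCoord α x‖ := by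
        have : x.2 = (affCoord α x).im - α.im * x.1 := by simp [affCoord]
        rw [this, add_mul, one_mul]
        refine (abs_sub _ _).trans (add_le_add (Complex.abs_im_le_norm _) ?_)
        rw [abs_mul, mul_assoc]
        gcongr
      have h3 := norm_nonneg (affCoord α x)
      have h4 : 0 ≤ |α.re|⁻¹ := by positivity
      have h5 : 0 ≤ 1 + |α.im| * |α.re|⁻¹ := by positivity
      refine max_le (h1.trans ?_) (h2.trans ?_)
      · simp only [K]; nlinarith
      · simp only [K]; nlinarith
    have hlow : ∀ x : ℝ × ℝ, K⁻¹ * ‖x‖ - C ≤ ‖f x‖ := by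
      intro x
      have h1 : K⁻¹ * ‖x‖ ≤ ‖affCoord α x‖ := by
        rw [inv_mul_le_iff₀ hK]; exact hlin x
      have h2 := norm_sub_norm_le (affCoord α x) (f x)
      rw [norm_sub_rev] at h2
      linarith [hC x]
    refine Filter.tendsto_atTop_mono hlow ?_
    exact Filter.tendsto_atTop_add_const_right _ _
      (tendsto_norm_cobounded_atTop.const_mul_atTop (inv_pos.2 hK))
  have hcov : IsCoveringMap f := by
    rw [isCoveringMap_iff_isCoveringMapOn_univ]
    refine hproper.isClosedMap.isCoveringMapOn_of_isLocalHomeomorphOn (fun y _ => ?_)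
      ((isLocalHomeomorph_iff_isLocalHomeomorphOn_univ.1 hloc).mono (Set.subset_univ _))
    refine (hproper.isCompact_preimage isCompact_singleton).finite ?_
    exact (IsDiscrete.of_openPartialHomeomorph f subset_rfl (fun e _ => by
      obtain ⟨φ, hφ, h⟩ := hloc e
      exact ⟨φ, hφ, h.symm⟩))
  -- The lift E of the identity is a section of f. Both E ∘ f and the identity lift f and agree at
  -- 0, so E is a two-sided inverse.
  obtain ⟨E, ⟨hE0, hE⟩, -⟩ := hcov.existsUnique_continuousMap_lifts (ContinuousMap.id ℂ)
    (f 0) 0 rfl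
  have hfE : ∀ z, f (E z) = z := fun z => congrFun hE z
  have hEf : (fun x => E (f x)) = id := by
    refine hcov.eq_of_comp_eq (E.continuous.comp hf.continuous) continuous_id ?_ 0 hE0
    funext x
    exact hfE (f x)
  exact ⟨fun x y h => by
    have h1 := congrFun hEf x
    have h2 := congrFun hEf y
    simp only [id] at h1 h2
    rw [← h1, ← h2, h], fun z => ⟨E z, hfE z⟩⟩

/-- `Z` is a global holomorphic coordinate for the complex structure `J`. -/
structure IsGlobalCoordinate (J : ℝ × ℝ → (ℝ × ℝ →L[ℝ] ℝ × ℝ)) (p : ℝ) (Z : ℝ × ℝ → ℂ) : Prop where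
  contDiff : ContDiff ℝ ∞ Z
  map_J : ∀ x v, fderiv ℝ Z x (J x v) = Complex.I * fderiv ℝ Z x v
  bijective_fderiv : ∀ x, Function.Bijective (fderiv ℝ Z x)
  fderiv_periodic : ∀ (m n : ℤ) (x : ℝ × ℝ), fderiv ℝ Z (x.1 + p * m, x.2 + n) = fderiv ℝ Z x
  bijective : Function.Bijective Z
  liouville : ∀ H : ℝ × ℝ → ℂ, ContDiff ℝ ∞ H →
    (∀ (m n : ℤ) (x : ℝ × ℝ), H (x.1 + p * m, x.2 + n) = H x) →
    (∀ x v, fderiv ℝ H x (J x v) = Complex.I * fderiv ℝ H x v) → ∀ x, fderiv ℝ H x = 0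

theorem complexStructure_coeff {J : ℝ × ℝ →L[ℝ] ℝ × ℝ} (hJ2 : ∀ v, J (J v) = -v) :
    (J (1, 0)).1 ^ 2 + (J (1, 0)).2 * (J (0, 1)).1 = -1 ∧
    (J (1, 0)).2 * ((J (1, 0)).1 + (J (0, 1)).2) = 0 := by
  have h := hJ2 (1, 0)
  have hdec : J (1, 0) = (J (1, 0)).1 • (1, 0) + (J (1, 0)).2 • (0, 1) := by ext <;> simp
  rw [hdec, map_add, map_smul, map_smul] at h
  have h1 := congrArg Prod.fst h
  have h2 := congrArg Prod.snd h
  simp at h1 h2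
  constructor <;> nlinarith

theorem complexStructure_coeff_ne_zero {J : ℝ × ℝ →L[ℝ] ℝ × ℝ} (hJ2 : ∀ v, J (J v) = -v) :
    (J (1, 0)).2 ≠ 0 := by
  intro h
  have := (complexStructure_coeff hJ2).1
  rw [h] at this
  nlinarith [sq_nonneg (J (1, 0)).1]

/-- With J e₁ = (a, c), a function is J-holomorphic iff c ∂₂ = (i - a) ∂₁, that is, ∂bar = μ ∂ with
μ = (i(c - 1) + a) / (i(c + 1) - a). The condition c > 0 is exactly |μ| < 1, and periodicity makes
the bound uniform. -/
theorem exists_globalCoordinate_of_pos {J : ℝ × ℝ → (ℝ × ℝ →L[ℝ] ℝ × ℝ)} (hJ : ContDiff ℝ ∞ J)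
    (hJ2 : ∀ x v, J x (J x v) = -v) (pJ : TorusPeriodic J) (hpos : ∀ x, 0 < (J x (1, 0)).2) :
    ∃ Z, IsGlobalCoordinate J 1 Z := by
  let a : ℝ × ℝ → ℝ := fun x => (J x (1, 0)).1
  let c : ℝ × ℝ → ℝ := fun x => (J x (1, 0)).2
  have hJ1 : ContDiff ℝ ∞ fun x => J x (1, 0) := hJ.clm_apply contDiff_const
  have ha : ContDiff ℝ ∞ fun x => (a x : ℂ) :=
    Complex.ofRealCLM.contDiff.comp (contDiff_fst.comp hJ1)
  have hc : ContDiff ℝ ∞ fun x => (c x : ℂ) :=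
    Complex.ofRealCLM.contDiff.comp (contDiff_snd.comp hJ1)
  have den : ∀ x, (Complex.I * (c x + 1) - a x : ℂ) ≠ 0 := by
    intro x h
    have := congrArg Complex.im h
    have hx := hpos x
    simp [c] at this
    linarith
  have cne : ∀ x, (c x : ℂ) ≠ 0 := fun x => by
    simpa using (hpos x).ne'
  let μ : ℝ × ℝ → ℂ := fun x => (Complex.I * (c x - 1) + a x) / (Complex.I * (c x + 1) - a x)
  have hμ : ContDiff ℝ ∞ μ := by
    simp only [μ, div_eq_mul_inv]
    exact ((contDiff_const.mul (hc.sub contDiff_const)).add ha).mul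
      (((contDiff_const.mul (hc.add contDiff_const)).sub ha).inv den)
  have pμ : TorusPeriodic μ := fun m n x => by simp only [μ, a, c, pJ m n x]
  have hμ1 : ∀ x, ‖μ x‖ < 1 := by
    intro x
    have hx := hpos x
    rw [norm_div, div_lt_one (norm_pos_iff.2 (den x))]
    rw [← sq_lt_sq₀ (norm_nonneg _) (norm_nonneg _), ← Complex.normSq_eq_norm_sq,
      ← Complex.normSq_eq_norm_sq, Complex.normSq_apply, Complex.normSq_apply]
    simp
    simp only [c] 
    nlinarith
  obtain ⟨k, hk1, hk⟩ : ∃ k < 1, ∀ x, ‖μ x‖ ≤ k := by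
    obtain ⟨y, -, hy⟩ := (isCompact_Icc.prod isCompact_Icc :
      IsCompact (Set.Icc (0 : ℝ) 1 ×ˢ Set.Icc (0 : ℝ) 1)).exists_isMaxOn
        ⟨(0, 0), by simp⟩ hμ.continuous.norm.continuousOn
    refine ⟨‖μ y‖, hμ1 y, fun x => ?_⟩
    obtain ⟨z, hz, hzx⟩ := pμ.exists_mem_Icc x
    rw [← hzx]
    exact hy hz
  obtain ⟨f, α, hf, pf, hα, ef, nf⟩ := exists_periodic_coordinate hμ pμ hk1 hk
  have coord : ∀ (L : ℝ × ℝ →L[ℝ] ℂ) v, L v = v.1 * L (1, 0) + v.2 * L (0, 1) := by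
    intro L v
    have hdec : v = v.1 • (1, 0) + v.2 • (0, 1) := by ext <;> simp
    nth_rewrite 1 [hdec]
    rw [map_add, map_smul, map_smul, Complex.real_smul, Complex.real_smul]
  have hmapJ : ∀ x (L : ℝ × ℝ →L[ℝ] ℂ), (c x : ℂ) * L (0, 1) = (Complex.I - a x) * L (1, 0) →
      ∀ v, L (J x v) = Complex.I * L v := by
    intro x L hL v
    obtain ⟨r1, r2⟩ := complexStructure_coeff (hJ2 x)
    have hdec : v = v.1 • (1, 0) + v.2 • (0, 1) := by ext <;> simp
    have e1 : L (J x (1, 0)) = Complex.I * L (1, 0) := by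
      rw [coord L (J x (1, 0))]
      linear_combination hL
    have e2 : L (J x (0, 1)) = Complex.I * L (0, 1) := by
      have r1' : ((J x (1, 0)).1 : ℂ) ^ 2 + (J x (1, 0)).2 * (J x (0, 1)).1 = -1 := by
        exact_mod_cast r1
      have r2' : ((J x (1, 0)).1 : ℂ) + (J x (0, 1)).2 = 0 := by
        exact_mod_cast (mul_eq_zero.1 r2).resolve_left (hpos x).ne'
      rw [coord L (J x (0, 1))]
      apply mul_left_cancel₀ (cne x)
      simp only [a, c] at hL ⊢
      linear_combination L (1, 0) * r1' + ((J x (0, 1)).2 - Complex.I) * hL +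
        (Complex.I - (J x (1, 0)).1) * L (1, 0) * r2' - L (1, 0) * Complex.I_sq
    nth_rewrite 1 [hdec]
    rw [map_add, map_smul, map_smul, map_add, map_smul, map_smul, e1, e2, coord L v]
    simp only [Complex.real_smul]
    ring
  have hJmap : ∀ x (L : ℝ × ℝ →L[ℝ] ℂ), (∀ v, L (J x v) = Complex.I * L v) →
      (c x : ℂ) * L (0, 1) = (Complex.I - a x) * L (1, 0) := by
    intro x L hL
    have := hL (1, 0)
    rw [coord L (J x (1, 0))] at this
    linear_combination this
  have hbij : ∀ x, Function.Bijective (fderiv ℝ f x) := by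
    intro x
    refine bijective_of_injective_complex ?_
    rw [injective_iff_map_eq_zero]
    intro v hv
    rw [coord] at hv
    have hj : 0 < (conj (fderiv ℝ f x (1, 0)) * fderiv ℝ f x (0, 1)).im := by
      rw [← jacobian_eq, ef, norm_mul, mul_pow]
      have h1 : ‖μ x‖ ^ 2 < 1 := by
        rw [sq_lt_one_iff₀ (norm_nonneg _)]; exact hμ1 x
      have : 0 < ‖dz f x‖ ^ 2 := by have := nf x; positivity
      nlinarith
    have h1 := congrArg Complex.re hv
    have h2 := congrArg Complex.im hv
    simp at h1 h2 hj
    have e1 : v.2 = 0 := by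
      refine (mul_eq_zero.1 ?_).resolve_right (sub_ne_zero.2 hj.ne')
      linear_combination (fderiv ℝ f x (1, 0)).re * h2 - (fderiv ℝ f x (1, 0)).im * h1
    have e2 : v.1 = 0 := by
      refine (mul_eq_zero.1 ?_).resolve_right (sub_ne_zero.2 hj.ne')
      linear_combination (fderiv ℝ f x (0, 1)).im * h1 - (fderiv ℝ f x (0, 1)).re * h2
    ext <;> simp [e1, e2]
  have hper : TorusPeriodic (fderiv ℝ f) := by
    intro m n x
    have h1 := pf.fderiv m n x
    have h2 : ∀ x, fderiv ℝ (fun x => f x - affCoord α x) x =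
        fderiv ℝ f x - fderiv ℝ (affCoord α) 0 := by
      intro x
      rw [fderiv_fun_sub (hf.differentiable (by simp) x)
        ((contDiff_affCoord α).differentiable (by simp) x)]
      congr 1
      ext <;> simp [fderiv_affCoord]
    rw [h2, h2] at h1
    simpa using h1
  refine ⟨f, hf, fun x => hmapJ x _ ?_, hbij, fun m n x => by simpa using hper m n x,
    bijective_of_sub_affCoord_periodic hf hbij pf hα, fun H hH pH eH => ?_⟩
  · have e1 : fderiv ℝ f x (1, 0) = (1 + μ x) * dz f x := by
      have := ef x
      rw [dzbar, dz] at this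
      rw [dz]
      linear_combination this
    have e2 : fderiv ℝ f x (0, 1) = Complex.I * (1 - μ x) * dz f x := by
      have := ef x
      rw [dzbar, dz] at this
      rw [dz]
      linear_combination (-Complex.I) * this + fderiv ℝ f x (0, 1) * Complex.I_sq
    have e3 : (c x : ℂ) * (Complex.I * (1 - μ x)) = (Complex.I - a x) * (1 + μ x) := by
      have := den x
      simp only [μ]
      field_simp
      ring
    rw [e1, e2]
    linear_combination dz f x * e3
  · refine fderiv_eq_zero_of_beltrami hH hμ1 (fun x => ?_) ?_
    · have h := hJmap x _ (eH x)
      have e3 : μ x * (Complex.I * (c x + 1) - a x) = Complex.I * (c x - 1) + a x := by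
        simp only [μ]
        exact div_mul_cancel₀ _ (den x)
      apply mul_left_cancel₀ (mul_ne_zero (cne x) (den x))
      simp only [dz, dzbar]
      linear_combination (Complex.I * (Complex.I * c x)) * h -
        (c x * (fderiv ℝ H x (1, 0) - Complex.I * fderiv ℝ H x (0, 1)) / 2) * e3 +
        c x * fderiv ℝ H x (1, 0) * (Complex.I - a x) * Complex.I_sq
    · intro v m n x
      have pH' : TorusPeriodic H := fun m n x => by simpa using pH m n x
      have h1 := pH' m n x
      have h2 := pH'.fderiv_apply v m n x
      simp only at h1 h2 ⊢
      rw [h1, h2]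

/-- The vector J e₁ is never parallel to e₁, so its second component has constant sign. If that is
negative, the conjugate of a coordinate for -J serves. -/
theorem exists_globalCoordinate_torus {J : ℝ × ℝ → (ℝ × ℝ →L[ℝ] ℝ × ℝ)} (hJ : ContDiff ℝ ∞ J)
    (hJ2 : ∀ x v, J x (J x v) = -v) (pJ : TorusPeriodic J) : ∃ Z, IsGlobalCoordinate J 1 Z := by
  have hcont : Continuous fun x => (J x (1, 0)).2 :=
    continuous_snd.comp (hJ.continuous.clm_apply continuous_const)
  have hne : ∀ x, (J x (1, 0)).2 ≠ 0 := fun x => complexStructure_coeff_ne_zero (hJ2 x)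
  have hsign : (∀ x, 0 < (J x (1, 0)).2) ∨ ∀ x, (J x (1, 0)).2 < 0 := by
    by_contra! hcon
    obtain ⟨⟨x, hx⟩, y, hy⟩ := hcon
    obtain ⟨z, hz⟩ := mem_range_of_exists_le_of_exists_ge hcont ⟨x, hx⟩ ⟨y, hy⟩
    exact hne z hz
  rcases hsign with h | h
  · exact exists_globalCoordinate_of_pos hJ hJ2 pJ h
  · obtain ⟨Z, hZ⟩ := exists_globalCoordinate_of_pos (J := fun x => -J x) hJ.neg
      (fun x v => by simp [hJ2]) (fun m n x => congrArg Neg.neg (pJ m n x))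
      (fun x => by simpa using h x)
    have conjd : ∀ (H : ℝ × ℝ → ℂ), ContDiff ℝ ∞ H → ∀ x v,
        fderiv ℝ (fun x => conj (H x)) x v = conj (fderiv ℝ H x v) := by
      intro H hH x v
      have := ((Complex.conjCLE : ℂ →L[ℝ] ℂ).hasFDerivAt.comp x
        (hH.differentiable (by simp) x).hasFDerivAt).fderiv
      exact congrArg (fun L => L v) this
    have cs : ∀ (H : ℝ × ℝ → ℂ), ContDiff ℝ ∞ H → ContDiff ℝ ∞ fun x => conj (H x) :=
      fun H hH => Complex.conjCLE.contDiff.comp hH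
    refine ⟨fun x => conj (Z x), cs Z hZ.contDiff, fun x v => ?_, fun x => ?_, fun m n x => ?_, ?_,
      fun H hH pH eH x => ?_⟩
    · have := hZ.map_J x v
      simp only [neg_apply, map_neg] at this
      rw [conjd Z hZ.contDiff, conjd Z hZ.contDiff, neg_eq_iff_eq_neg.1 this]
      simp
    · have h1 : ⇑(fderiv ℝ (fun x => conj (Z x)) x) = conj ∘ fderiv ℝ Z x :=
        funext fun v => conjd Z hZ.contDiff x v
      rw [h1]
      exact (starRingAut (R := ℂ)).bijective.comp (hZ.bijective_fderiv x)
    · ext1 <;> ext <;> simp only [ContinuousLinearMap.comp_apply, conjd Z hZ.contDiff,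
        hZ.fderiv_periodic]
    · exact (starRingAut (R := ℂ)).bijective.comp hZ.bijective
    · have h1 := hZ.liouville (fun x => conj (H x)) (cs H hH)
        (fun m n x => congrArg conj (pH m n x)) (fun x v => by
          rw [conjd H hH, conjd H hH, neg_apply, map_neg, eH]
          simp) x
      ext
      · have := conjd H hH x (1, 0)
        rw [h1] at this
        simpa using this.symm
      · have := conjd H hH x (0, 1)
        rw [h1] at this
        simpa using this.symm

/-- Uniformization of the torus `ℝ² / (pℤ × ℤ)` with an arbitrary complex structure. -/
theorem exists_globalCoordinate {p : ℝ} (hp : p ≠ 0) {J : ℝ × ℝ → (ℝ × ℝ →L[ℝ] ℝ × ℝ)}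
    (hJ : ContDiff ℝ ∞ J) (hJ2 : ∀ x v, J x (J x v) = -v)
    (pJ : ∀ (m n : ℤ) (x : ℝ × ℝ), J (x.1 + p * m, x.2 + n) = J x) :
    ∃ Z, IsGlobalCoordinate J p Z := by
  let S : (ℝ × ℝ) ≃L[ℝ] (ℝ × ℝ) :=
    (ContinuousLinearEquiv.smulLeft (Units.mk0 p hp)).prodCongr (ContinuousLinearEquiv.refl ℝ ℝ)
  have S1 : ∀ x, S x = (p * x.1, x.2) := fun x => rfl
  have S2 : ∀ x, S.symm x = (p⁻¹ * x.1, x.2) := fun x => rfl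
  let J' : ℝ × ℝ → (ℝ × ℝ →L[ℝ] ℝ × ℝ) := fun x =>
    (S.symm : ℝ × ℝ →L[ℝ] ℝ × ℝ) ∘L J (S x) ∘L (S : ℝ × ℝ →L[ℝ] ℝ × ℝ)
  have hJ'S : ∀ x v, S (J' x v) = J (S x) (S v) := fun x v => by simp [J']
  obtain ⟨Z, hZ⟩ := exists_globalCoordinate_torus (J := J')
    (contDiff_const.clm_comp ((hJ.comp S.contDiff).clm_comp contDiff_const))
    (fun x v => by simp [J', hJ2]) (fun m n x => by
      have h : S (x.1 + m, x.2 + n) = ((S x).1 + p * m, (S x).2 + n) := by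
        rw [S1, S1]; ext <;> simp; ring
      simp only [J', h, pJ])
  have dZ : ∀ (H : ℝ × ℝ → ℂ) x v, fderiv ℝ (fun y => H (S.symm y)) x v =
      fderiv ℝ H (S.symm x) (S.symm v) := by
    intro H x v
    have := S.symm.comp_right_fderiv (f := H) (x := x)
    exact congrArg (fun L => L v) this
  refine ⟨fun x => Z (S.symm x), hZ.contDiff.comp S.symm.contDiff, fun x v => ?_, fun x => ?_,
    fun m n x => ?_, hZ.bijective.comp S.symm.bijective, fun H hH pH eH x => ?_⟩
  · rw [dZ, dZ, ← hZ.map_J]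
    congr 1
    apply S.injective
    rw [hJ'S]
    simp
  · have h1 : ⇑(fderiv ℝ (fun x => Z (S.symm x)) x) = fderiv ℝ Z (S.symm x) ∘ S.symm :=
      funext fun v => dZ Z x v
    rw [h1]
    exact (hZ.bijective_fderiv _).comp S.symm.bijective
  · have h : S.symm (x.1 + p * m, x.2 + n) = ((S.symm x).1 + 1 * m, (S.symm x).2 + n) := by
      rw [S2, S2]; ext <;> simp; field_simp
    apply ContinuousLinearMap.ext
    intro v
    rw [dZ, dZ, h, hZ.fderiv_periodic]
  · have dH : ∀ x v, fderiv ℝ (fun y => H (S y)) x v = fderiv ℝ H (S x) (S v) := by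
      intro x v
      have := S.comp_right_fderiv (f := H) (x := x)
      exact congrArg (fun L => L v) this
    have h1 := hZ.liouville (fun x => H (S x)) (hH.comp S.contDiff) (fun m n x => by
      have h : S (x.1 + 1 * m, x.2 + n) = ((S x).1 + p * m, (S x).2 + n) := by
        rw [S1, S1]; ext <;> simp; ring
      simp only [h, pH]) (fun x v => by
        rw [dH, dH, hJ'S, eH]) (S.symm x)
    apply ContinuousLinearMap.ext
    intro v
    have := dH (S.symm x) (S.symm v)
    rw [h1] at this
    simpa using this.symm

end Uniformization

/-! ### The antilinear cross product and calibrated triples -/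

noncomputable section CrossProduct

open scoped ComplexConjugate

/-- The complex antilinear cross product on `ℂ³`, with `⟪ccross u v, w⟫ = Ω(u, v, w)`. -/
def ccross (u v : C3) : C3 :=
  WithLp.toLp 2 fun i => conj ((crossProduct (u : Fin 3 → ℂ) (v : Fin 3 → ℂ)) i)

theorem ccross_zero_apply (u v : C3) : ccross u v 0 = conj (u 1 * v 2 - u 2 * v 1) := by
  simp [ccross, cross_apply]
theorem ccross_one_apply (u v : C3) : ccross u v 1 = conj (u 2 * v 0 - u 0 * v 2) := by
  simp [ccross, cross_apply]
theorem ccross_two_apply (u v : C3) : ccross u v 2 = conj (u 0 * v 1 - u 1 * v 0) := by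
  simp [ccross, cross_apply]

theorem inner_complex_eq (u v : C3) :
    inner ℂ u v = conj (u 0) * v 0 + conj (u 1) * v 1 + conj (u 2) * v 2 := by
  simp [PiLp.inner_apply, Fin.sum_univ_three]; ring

theorem inner_real_eq (u v : C3) : inner ℝ u v = (inner ℂ u v).re := rfl

theorem holVol_eq (u v w : C3) : holVol ![u, v, w] = inner ℂ (ccross u v) w := by
  rw [inner_complex_eq, ccross_zero_apply, ccross_one_apply, ccross_two_apply, holVol,
    Matrix.det_fin_three]
  simp
  ring

theorem C3_ext {u v : C3} (h0 : u 0 = v 0) (h1 : u 1 = v 1) (h2 : u 2 = v 2) : u = v := by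
  ext i; fin_cases i <;> assumption

theorem ccross_add_right (u v w : C3) : ccross u (v + w) = ccross u v + ccross u w := by
  apply C3_ext <;> simp [ccross_zero_apply, ccross_one_apply, ccross_two_apply] <;> ring

theorem ccross_add_left (u v w : C3) : ccross (u + v) w = ccross u w + ccross v w := by
  apply C3_ext <;> simp [ccross_zero_apply, ccross_one_apply, ccross_two_apply] <;> ring

theorem ccross_smul_right (c : ℝ) (u v : C3) : ccross u (c • v) = c • ccross u v := by
  apply C3_ext <;> simp [ccross_zero_apply, ccross_one_apply, ccross_two_apply] <;> ring

theorem ccross_smul_left (c : ℝ) (u v : C3) : ccross (c • u) v = c • ccross u v := by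
  apply C3_ext <;> simp [ccross_zero_apply, ccross_one_apply, ccross_two_apply] <;> ring

theorem ccross_self (u : C3) : ccross u u = 0 := by
  apply C3_ext <;> simp [ccross_zero_apply, ccross_one_apply, ccross_two_apply] <;> ring

theorem ccross_ccross (u v w : C3) :
    ccross (ccross u v) w = WithLp.toLp 2 fun i => v i * inner ℂ w u - u i * inner ℂ w v := by
  simp only [inner_complex_eq]
  apply C3_ext <;> simp [ccross_zero_apply, ccross_one_apply, ccross_two_apply] <;> ring

theorem inner_ccross_left (u v : C3) : inner ℂ (ccross u v) u = 0 := by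
  rw [inner_complex_eq, ccross_zero_apply, ccross_one_apply, ccross_two_apply]; simp; ring

theorem inner_ccross_right (u v : C3) : inner ℂ (ccross u v) v = 0 := by
  rw [inner_complex_eq, ccross_zero_apply, ccross_one_apply, ccross_two_apply]; simp; ring

theorem inner_ccross_ccross (u v w z : C3) : inner ℂ (ccross u v) (ccross w z) =
    inner ℂ w u * inner ℂ z v - inner ℂ w v * inner ℂ z u := by
  simp only [inner_complex_eq]
  simp [ccross_zero_apply, ccross_one_apply, ccross_two_apply]; ring

theorem norm_ccross_sq (u v : C3) : ‖ccross u v‖ ^ 2 = ‖u‖ ^ 2 * ‖v‖ ^ 2 - ‖inner ℂ u v‖ ^ 2 := by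
  have h := inner_ccross_ccross u v u v
  rw [inner_self_eq_norm_sq_to_K, inner_self_eq_norm_sq_to_K, inner_self_eq_norm_sq_to_K,
    ← inner_conj_symm v u, Complex.mul_conj, Complex.normSq_eq_norm_sq] at h
  apply Complex.ofReal_injective
  simpa using h

/-- The cross product as a continuous bilinear map over `ℝ`. -/
def ccrossL : C3 →L[ℝ] C3 →L[ℝ] C3 :=
  LinearMap.toContinuousLinearMap (LinearMap.toContinuousLinearMap.toLinearMap ∘ₗ
    LinearMap.mk₂ ℝ ccross (ccross_add_left) (ccross_smul_left) ccross_add_right ccross_smul_right)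

@[simp] theorem ccrossL_apply (u v : C3) : ccrossL u v = ccross u v := rfl

theorem holVol_sum (A : Matrix (Fin 3) (Fin 3) ℝ) (u : Fin 3 → C3) :
    holVol (fun i => ∑ j, A i j • u j) = A.det * holVol u := by
  have h : (Matrix.of fun i j => (∑ k, A i k • u k : C3) j) =
      (A.map Complex.ofReal) * Matrix.of fun i j => u i j := by
    ext i j
    simp [Matrix.mul_apply]
  rw [holVol, h, Matrix.det_mul, holVol]
  congr 1
  exact (RingHom.map_det Complex.ofRealHom A).symm

/-- Ω scales by det A and the volume by |det A|. So calibration of a tangent space needs checking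
only on one spanning triple. -/
theorem IsCalibratedTriple.sum {u : Fin 3 → C3} (h : IsCalibratedTriple u)
    (A : Matrix (Fin 3) (Fin 3) ℝ) : IsCalibratedTriple fun i => ∑ j, A i j • u j := by
  unfold IsCalibratedTriple at h ⊢
  have h1 : (Matrix.of fun i j => inner ℝ (∑ k, A i k • u k) (∑ k, A j k • u k)) =
      A * (Matrix.of fun i j => inner ℝ (u i) (u j)) * A.transpose := by
    ext i j
    simp [Matrix.mul_apply, Fin.sum_univ_three, inner_add_left, inner_add_right, inner_smul_left,
      inner_smul_right]
    ring
  rw [h1, Matrix.det_mul, Matrix.det_mul, Matrix.det_transpose, holVol_sum]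
  rw [show A.det * (Matrix.of fun i j => inner ℝ (u i) (u j)).det * A.det =
    A.det ^ 2 * (Matrix.of fun i j => inner ℝ (u i) (u j)).det by ring,
    Real.sqrt_mul (sq_nonneg _), Real.sqrt_sq_eq_abs, ← h, ← abs_mul]
  simp

/-- A unit vector `u`, a vector `a` with `⟪u, a⟫` real, and `u × a + c u` span a special
Lagrangian plane. -/
theorem isCalibratedTriple_ccross {u a : C3} (hu : ‖u‖ = 1) (hua : (inner ℂ u a).im = 0) (c : ℝ) :
    IsCalibratedTriple ![u, a, ccross u a + c • u] := by
  have hua' : inner ℂ u a = ((inner ℝ u a : ℝ) : ℂ) := Complex.ext rfl (by simpa using hua)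
  -- Reality of ⟪u, a⟫ makes |u × a|² equal to the real Gram determinant of u and a.
  have hN : ‖ccross u a‖ ^ 2 = ‖a‖ ^ 2 - (inner ℝ u a) ^ 2 := by
    rw [norm_ccross_sq, hu, hua', Complex.norm_real, Real.norm_eq_abs, sq_abs]
    ring
  have h1 : (holVol ![u, a, ccross u a + c • u]).re = ‖ccross u a‖ ^ 2 := by
    rw [holVol_eq, inner_add_right, Complex.add_re, ← inner_real_eq, ← inner_real_eq,
      real_inner_self_eq_norm_sq, inner_smul_right, inner_real_eq _ u, inner_ccross_left]
    simp
  have e1 : inner ℝ (ccross u a) u = 0 := by rw [inner_real_eq, inner_ccross_left]; rfl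
  have e2 : inner ℝ (ccross u a) a = 0 := by rw [inner_real_eq, inner_ccross_right]; rfl
  have e3 : inner ℝ u (ccross u a) = 0 := by rw [real_inner_comm, e1]
  have e4 : inner ℝ a (ccross u a) = 0 := by rw [real_inner_comm, e2]
  have e5 : inner ℝ u u = 1 := by rw [real_inner_self_eq_norm_sq, hu]; norm_num
  have e6 : ‖ccross u a + c • u‖ ^ 2 = ‖ccross u a‖ ^ 2 + c ^ 2 := by
    rw [norm_add_sq_real, inner_smul_right, e1, norm_smul, hu]
    simp
  unfold IsCalibratedTriple
  rw [h1, Matrix.det_fin_three, abs_of_nonneg (sq_nonneg _), eq_comm]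
  refine (congrArg Real.sqrt ?_).trans (Real.sqrt_sq (sq_nonneg _))
  simp [inner_add_left, inner_add_right, inner_smul_left, inner_smul_right, e1, e2, e3, e4,
    real_inner_comm u a]
  rw [e6, hN, hu]
  ring

end CrossProduct

/-! ### Deck transformations and first order geometry of ruled 3-folds -/

noncomputable section Cone

open scoped ComplexConjugate

/-- The sign `(-1)ᵐ` as a real number. -/
def deckSign (m : ℤ) : ℝ := ((m.negOnePow : ℤ) : ℝ)

theorem deckSign_mul_self (m : ℤ) : deckSign m * deckSign m = 1 := negOnePow_mul_self_real m

theorem deckSign_eq_or (m : ℤ) : deckSign m = 1 ∨ deckSign m = -1 :=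
  mul_self_eq_one_iff.1 (deckSign_mul_self m)

theorem deck_eq (m n : ℤ) (x : ℝ × ℝ) : deck m n x = (x.1 + m, deckSign m * x.2 + n) := rfl

/-- The linear part of a deck transformation as a continuous linear map. -/
def deckCLM (m : ℤ) : ℝ × ℝ →L[ℝ] ℝ × ℝ :=
  (ContinuousLinearMap.fst ℝ ℝ ℝ).prod (deckSign m • ContinuousLinearMap.snd ℝ ℝ ℝ)

@[simp] theorem deckCLM_apply (m : ℤ) (v : ℝ × ℝ) : deckCLM m v = deckLin m v := rfl

theorem deckLin_eq (m : ℤ) (v : ℝ × ℝ) : deckLin m v = (v.1, deckSign m * v.2) := rfl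

theorem deck_eq_add (m n : ℤ) (x : ℝ × ℝ) : deck m n x = deckCLM m x + ((m : ℝ), (n : ℝ)) := by
  ext <;> simp [deck_eq, deckLin_eq]

theorem hasFDerivAt_deck (m n : ℤ) (x : ℝ × ℝ) : HasFDerivAt (deck m n) (deckCLM m) x := by
  rw [funext (deck_eq_add m n)]
  exact (deckCLM m).hasFDerivAt.add_const _

theorem continuous_deck (m n : ℤ) : Continuous (deck m n) :=
  continuous_iff_continuousAt.2 fun x => (hasFDerivAt_deck m n x).continuousAt

theorem continuous_kleinMk : Continuous kleinMk := continuous_quotient_mk'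

theorem kleinMk_eq_iff {x y : ℝ × ℝ} : kleinMk x = kleinMk y ↔ ∃ m n, deck m n x = y :=
  Quotient.eq''

theorem kleinMk_deck (m n : ℤ) (x : ℝ × ℝ) : kleinMk (deck m n x) = kleinMk x :=
  (kleinMk_eq_iff.2 ⟨m, n, rfl⟩).symm

theorem deckLin_deckLin (m : ℤ) (v : ℝ × ℝ) : deckLin m (deckLin m v) = v := by
  ext
  · simp [deckLin_eq]
  · simp only [deckLin_eq]
    linear_combination v.2 * deckSign_mul_self m

/-- A continuous sign is constant. -/
theorem eq_or_eq_neg_of_continuous {f g : ℝ × ℝ → C3} (hf : Continuous f) (hg : Continuous g)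
    (hg1 : ∀ x, ‖g x‖ = 1) (h : ∀ x, f x = g x ∨ f x = -g x) :
    (∀ x, f x = g x) ∨ ∀ x, f x = -g x := by
  have hc : Continuous fun x => inner ℝ (f x) (g x) := hf.inner hg
  have h1 : ∀ x, f x = g x → inner ℝ (f x) (g x) = 1 := fun x hx => by
    rw [hx, real_inner_self_eq_norm_sq, hg1]; norm_num
  have h2 : ∀ x, f x = -g x → inner ℝ (f x) (g x) = -1 := fun x hx => by
    rw [hx, inner_neg_left, real_inner_self_eq_norm_sq, hg1]; norm_num
  by_contra! hcon
  obtain ⟨⟨x, hx⟩, y, hy⟩ := hcon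
  have hx' := h2 x ((h x).resolve_left hx)
  have hy' := h1 y ((h y).resolve_right hy)
  obtain ⟨z, hz⟩ := mem_range_of_exists_le_of_exists_ge (c := (0 : ℝ)) hc
    ⟨x, by rw [hx']; norm_num⟩ ⟨y, by rw [hy']; norm_num⟩
  change inner ℝ (f z) (g z) = 0 at hz
  rcases h z with h | h
  · rw [h1 z h] at hz; norm_num at hz
  · rw [h2 z h] at hz; norm_num at hz

theorem eq_zero_of_eq_neg_self {v : C3} (h : v = -v) : v = 0 := by
  have h1 := eq_neg_iff_add_eq_zero.1 h
  rw [← two_smul ℝ] at h1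
  simpa using h1

namespace RuledThreefold

variable (N : RuledThreefold)

theorem hasFDerivAt_imm (y : ℝ × ℝ × ℝ) : HasFDerivAt N.imm
    (y.1 • (fderiv ℝ N.dir y.2 ∘L ContinuousLinearMap.snd ℝ ℝ (ℝ × ℝ)) +
      (ContinuousLinearMap.fst ℝ ℝ (ℝ × ℝ)).smulRight (N.dir y.2) +
      fderiv ℝ N.foot y.2 ∘L ContinuousLinearMap.snd ℝ ℝ (ℝ × ℝ)) y := by
  have h1 : HasFDerivAt (fun y : ℝ × ℝ × ℝ => N.dir y.2) _ y :=
    ((N.contDiff_dir.differentiable (by simp) y.2).hasFDerivAt).comp y hasFDerivAt_snd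
  have h2 : HasFDerivAt (fun y : ℝ × ℝ × ℝ => N.foot y.2) _ y :=
    ((N.contDiff_foot.differentiable (by simp) y.2).hasFDerivAt).comp y hasFDerivAt_snd
  exact ((hasFDerivAt_fst (p := y)).smul h1).add h2

theorem fderiv_imm (y v : ℝ × ℝ × ℝ) : fderiv ℝ N.imm y v =
    v.1 • N.dir y.2 + (y.1 • fderiv ℝ N.dir y.2 v.2 + fderiv ℝ N.foot y.2 v.2) := by
  rw [(N.hasFDerivAt_imm y).fderiv]
  simp
  abel

theorem contDiff_imm : ContDiff ℝ ∞ N.imm :=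
  (contDiff_fst.smul (N.contDiff_dir.comp contDiff_snd)).add (N.contDiff_foot.comp contDiff_snd)

theorem inner_dir_fderiv (x v : ℝ × ℝ) : inner ℝ (N.dir x) (fderiv ℝ N.dir x v) = 0 := by
  have h1 : HasFDerivAt N.dir (fderiv ℝ N.dir x) x :=
    (N.contDiff_dir.differentiable (by simp) x).hasFDerivAt
  have h2 := (h1.inner ℝ h1).fderiv
  have h3 : (fun x => inner ℝ (N.dir x) (N.dir x)) = fun _ => (1 : ℝ) := by
    funext x; rw [real_inner_self_eq_norm_sq, N.norm_dir]; norm_num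
  rw [h3] at h2
  have h4 := congrArg (fun L => L v) h2
  simp [real_inner_comm] at h4
  linarith [real_inner_comm (N.dir x) (fderiv ℝ N.dir x v)]

/-- An r-orientation pulls back to `dir` with a globally constant sign. It takes the same value at 0
and at its image under the glide reflection, whereas `dir` takes opposite values there. -/
theorem not_rOrientable_of_dir (h : ∀ x, N.dir (deck 1 0 x) = -N.dir x) : ¬ N.ROrientable := by
  rintro ⟨u, hu, hx⟩
  have hne : N.dir 0 ≠ 0 := fun h0 => by simpa [h0] using N.norm_dir 0
  have key := kleinMk_deck 1 0 0
  rcases eq_or_eq_neg_of_continuous (hu.comp continuous_kleinMk) N.contDiff_dir.continuous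
    N.norm_dir hx with h1 | h1
  · have h2 := h1 (deck 1 0 0)
    have h3 := h1 0
    simp only [Function.comp_apply] at h2 h3
    rw [key, h3, h] at h2
    exact hne (eq_zero_of_eq_neg_self h2)
  · have h2 := h1 (deck 1 0 0)
    have h3 := h1 0
    simp only [Function.comp_apply] at h2 h3
    rw [key, h3, h, neg_inj] at h2
    exact hne (eq_zero_of_eq_neg_self h2)

theorem dir_deck_or (m n : ℤ) :
    (∀ x, N.dir (deck m n x) = N.dir x) ∨ ∀ x, N.dir (deck m n x) = -N.dir x :=
  eq_or_eq_neg_of_continuous (N.contDiff_dir.continuous.comp (continuous_deck m n))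
    N.contDiff_dir.continuous N.norm_dir (N.dir_deck m n)

theorem fderiv_dir_deck {m n : ℤ} {s : ℝ} (h : ∀ x, N.dir (deck m n x) = s • N.dir x)
    (x v : ℝ × ℝ) : fderiv ℝ N.dir (deck m n x) (deckLin m v) = s • fderiv ℝ N.dir x v := by
  have h1 := ((N.contDiff_dir.differentiable (by simp) (deck m n x)).hasFDerivAt.comp x
    (hasFDerivAt_deck m n x)).fderiv
  have h2 : N.dir ∘ deck m n = fun x => s • N.dir x := funext h
  rw [h2, fderiv_fun_const_smul (N.contDiff_dir.differentiable (by simp) x)] at h1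
  exact (congrArg (fun L => L v) h1).symm

/-! ### First fundamental form of the link -/

/-- `ReΩ (dir, ∂₁ dir, ∂₂ dir)`. -/
def volCoeff (x : ℝ × ℝ) : ℝ :=
  (holVol ![N.dir x, fderiv ℝ N.dir x (1, 0), fderiv ℝ N.dir x (0, 1)]).re

/-- The metric coefficients of the link. -/
def metricE (x : ℝ × ℝ) : ℝ := inner ℝ (fderiv ℝ N.dir x (1, 0)) (fderiv ℝ N.dir x (1, 0))
def metricF (x : ℝ × ℝ) : ℝ := inner ℝ (fderiv ℝ N.dir x (1, 0)) (fderiv ℝ N.dir x (0, 1))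
def metricG (x : ℝ × ℝ) : ℝ := inner ℝ (fderiv ℝ N.dir x (0, 1)) (fderiv ℝ N.dir x (0, 1))

theorem fderiv_dir_eq (x v : ℝ × ℝ) : fderiv ℝ N.dir x v =
    v.1 • fderiv ℝ N.dir x (1, 0) + v.2 • fderiv ℝ N.dir x (0, 1) := by
  have hdec : v = v.1 • (1, 0) + v.2 • (0, 1) := by ext <;> simp
  nth_rewrite 1 [hdec]
  rw [map_add, map_smul, map_smul]

theorem inner_fderiv_dir (x u v : ℝ × ℝ) :
    inner ℝ (fderiv ℝ N.dir x u) (fderiv ℝ N.dir x v) =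
      u.1 * v.1 * N.metricE x + (u.1 * v.2 + u.2 * v.1) * N.metricF x +
        u.2 * v.2 * N.metricG x := by
  rw [fderiv_dir_eq N x u, fderiv_dir_eq N x v]
  simp only [inner_add_left, inner_add_right, inner_smul_left, inner_smul_right, metricE, metricF,
    metricG, conj_trivial, real_inner_comm (fderiv ℝ N.dir x (1, 0)) (fderiv ℝ N.dir x (0, 1))]
  ring

theorem re_holVol_fderiv_dir (x u v : ℝ × ℝ) :
    (holVol ![N.dir x, fderiv ℝ N.dir x u, fderiv ℝ N.dir x v]).re =
      (u.1 * v.2 - u.2 * v.1) * N.volCoeff x := by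
  have h := congrArg Complex.re (holVol_sum !![1, 0, 0; 0, u.1, u.2; 0, v.1, v.2]
    ![N.dir x, fderiv ℝ N.dir x (1, 0), fderiv ℝ N.dir x (0, 1)])
  rw [Complex.re_ofReal_mul] at h
  convert h using 2
  · congr 1
    funext i
    fin_cases i <;> simp [Fin.sum_univ_three, fderiv_dir_eq N x u, fderiv_dir_eq N x v]
  · simp [Matrix.det_fin_three]
  · rfl

end RuledThreefold

end Cone

/-! ### The link of a special Lagrangian cone: orientation and complex structure -/

noncomputable section ConeStructure

namespace RuledThreefold

variable {N : RuledThreefold}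

theorem fderiv_imm_of_cone (hcone : N.IsTwoSidedCone) (y v : ℝ × ℝ × ℝ) :
    fderiv ℝ N.imm y v = v.1 • N.dir y.2 + y.1 • fderiv ℝ N.dir y.2 v.2 := by
  rw [fderiv_imm, show N.foot = fun _ => 0 from funext hcone.1]
  simp

theorem injective_fderiv_dir (hcone : N.IsTwoSidedCone) (x : ℝ × ℝ) :
    Function.Injective (fderiv ℝ N.dir x) := by
  refine (injective_iff_map_eq_zero _).2 fun v hv => ?_
  have h := hcone.2 (1, x) one_ne_zero
  have h1 : fderiv ℝ N.imm (1, x) (0, v) = fderiv ℝ N.imm (1, x) 0 := by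
    rw [fderiv_imm_of_cone hcone, map_zero]
    simp [hv]
  exact congrArg Prod.snd (h h1)

theorem norm_fderiv_dir_pos (hcone : N.IsTwoSidedCone) (x : ℝ × ℝ) {v : ℝ × ℝ} (hv : v ≠ 0) :
    0 < inner ℝ (fderiv ℝ N.dir x v) (fderiv ℝ N.dir x v) := by
  refine real_inner_self_pos.2 fun h => hv ?_
  exact injective_fderiv_dir hcone x (by rw [h, map_zero])

theorem metricE_pos (hcone : N.IsTwoSidedCone) (x : ℝ × ℝ) : 0 < N.metricE x :=
  norm_fderiv_dir_pos hcone x (by simp)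

theorem gram_pos (hcone : N.IsTwoSidedCone) (x : ℝ × ℝ) :
    0 < N.metricE x * N.metricG x - N.metricF x ^ 2 := by
  have hE := metricE_pos hcone x
  have h := norm_fderiv_dir_pos hcone x (v := (-N.metricF x, N.metricE x))
    fun h => hE.ne' (congrArg Prod.snd h)
  rw [inner_fderiv_dir] at h
  simp only at h
  refine pos_of_mul_pos_right (a := N.metricE x) ?_ hE.le
  linarith

/-- This is calibration at r = 1: φ is a unit vector orthogonal to the image of dφ, so the 3 × 3
Gram determinant reduces to that of the link. -/
theorem volCoeff_sq (hcone : N.IsTwoSidedCone) (hSL : N.IsSpecialLagrangian) (x : ℝ × ℝ) :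
    N.volCoeff x ^ 2 = N.metricE x * N.metricG x - N.metricF x ^ 2 := by
  have h := hSL.2 (1, x) (hcone.2 (1, x) one_ne_zero) ![(1, 0), (0, (1, 0)), (0, (0, 1))]
  have e : (fun i => fderiv ℝ N.imm (1, x) ((![(1, 0), (0, (1, 0)), (0, (0, 1))] :
      Fin 3 → ℝ × ℝ × ℝ) i)) = ![N.dir x, fderiv ℝ N.dir x (1, 0), fderiv ℝ N.dir x (0, 1)] := by
    funext i
    fin_cases i <;> simp [fderiv_imm_of_cone hcone]
  rw [e] at h
  have hdet : Matrix.det (Matrix.of fun i j => inner ℝ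
      ((![N.dir x, fderiv ℝ N.dir x (1, 0), fderiv ℝ N.dir x (0, 1)] : Fin 3 → C3) i)
      ((![N.dir x, fderiv ℝ N.dir x (1, 0), fderiv ℝ N.dir x (0, 1)] : Fin 3 → C3) j)) =
      N.metricE x * N.metricG x - N.metricF x ^ 2 := by
    have h0 : inner ℝ (N.dir x) (N.dir x) = 1 := by
      rw [real_inner_self_eq_norm_sq, N.norm_dir]; norm_num
    have h1 := N.inner_dir_fderiv x
    have h2 : ∀ v, inner ℝ (fderiv ℝ N.dir x v) (N.dir x) = 0 := fun v => by
      rw [real_inner_comm, h1]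
    have h3 : inner ℝ (fderiv ℝ N.dir x (0, 1)) (fderiv ℝ N.dir x (1, 0)) = N.metricF x :=
      real_inner_comm _ _
    rw [Matrix.det_fin_three]
    simp only [Matrix.of_apply, Matrix.cons_val, h0, h1, h2, h3]
    simp only [metricE, metricG, metricF]
    ring
  unfold IsCalibratedTriple at h
  rw [hdet] at h
  have h' : |N.volCoeff x| = _ := h
  rw [← sq_abs, h', Real.sq_sqrt (gram_pos hcone x).le]

theorem volCoeff_ne_zero (hcone : N.IsTwoSidedCone) (hSL : N.IsSpecialLagrangian) (x : ℝ × ℝ) :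
    N.volCoeff x ≠ 0 := fun h => by
  have := volCoeff_sq hcone hSL x
  have h2 := gram_pos hcone x
  rw [h] at this
  nlinarith

theorem contDiff_fderiv_dir (N : RuledThreefold) (v : ℝ × ℝ) :
    ContDiff ℝ ∞ fun x => fderiv ℝ N.dir x v :=
  N.contDiff_dir.fderiv_apply_const v

theorem re_holVol_eq_inner (u v w : C3) : (holVol ![u, v, w]).re = inner ℝ (ccross u v) w := by
  rw [holVol_eq, inner_real_eq]

theorem contDiff_volCoeff (N : RuledThreefold) : ContDiff ℝ ∞ N.volCoeff := by
  have e : N.volCoeff = fun x => inner ℝ (ccrossL (N.dir x) (fderiv ℝ N.dir x (1, 0)))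
      (fderiv ℝ N.dir x (0, 1)) := funext fun x => re_holVol_eq_inner _ _ _
  rw [e]
  exact ((ccrossL.contDiff.comp N.contDiff_dir).clm_apply (N.contDiff_fderiv_dir _)).inner ℝ
    (N.contDiff_fderiv_dir _)

theorem volCoeff_mul_pos (hcone : N.IsTwoSidedCone) (hSL : N.IsSpecialLagrangian) (x y : ℝ × ℝ) :
    0 < N.volCoeff x * N.volCoeff y := by
  by_contra! hcon
  have hc := N.contDiff_volCoeff.continuous
  have hx := volCoeff_ne_zero hcone hSL x
  have hy := volCoeff_ne_zero hcone hSL y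
  have : ∃ z, N.volCoeff z = 0 := by
    rcases hx.lt_or_gt with h | h
    · exact mem_range_of_exists_le_of_exists_ge (c := (0 : ℝ)) hc ⟨x, h.le⟩ ⟨y, by nlinarith⟩
    · exact mem_range_of_exists_le_of_exists_ge (c := (0 : ℝ)) hc ⟨y, by nlinarith⟩ ⟨x, h.le⟩
  obtain ⟨z, hz⟩ := this
  exact volCoeff_ne_zero hcone hSL z hz

/-- The cube comes from the trilinearity of Ω in (φ, dφ, dφ); `deckSign m` is the determinant of the
linear part of the deck transformation. -/
theorem sq_mul_volCoeff_deck {m n : ℤ} {s : ℝ} (h : ∀ x, N.dir (deck m n x) = s • N.dir x)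
    (x : ℝ × ℝ) : deckSign m * N.volCoeff (deck m n x) = s ^ 3 * N.volCoeff x := by
  have h1 := N.re_holVol_fderiv_dir (deck m n x) (deckLin m (1, 0)) (deckLin m (0, 1))
  rw [fderiv_dir_deck N h, fderiv_dir_deck N h, h, re_holVol_eq_inner, ccross_smul_left,
    ccross_smul_right, real_inner_smul_left, real_inner_smul_left, real_inner_smul_right,
    ← re_holVol_eq_inner] at h1
  change s * (s * (s * N.volCoeff x)) = _ at h1
  simp only [deckLin_eq] at h1
  linarith

/-- The deck transformations which reverse the orientation change the sign of `dir`. -/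
theorem dir_deck_eq (hcone : N.IsTwoSidedCone) (hSL : N.IsSpecialLagrangian) (m n : ℤ)
    (x : ℝ × ℝ) : N.dir (deck m n x) = deckSign m • N.dir x := by
  -- `volCoeff` has constant sign on ℝ², so `deckSign m` and s³ must have the same sign.
  have hpos := volCoeff_mul_pos hcone hSL x (deck m n x)
  have h0 := sq_nonneg (N.volCoeff x)
  have h1 := sq_nonneg (N.volCoeff (deck m n x))
  rcases N.dir_deck_or m n with h | h
  · have h2 := sq_mul_volCoeff_deck (s := 1) (fun x => by rw [h, one_smul]) x
    rcases deckSign_eq_or m with hm | hm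
    · rw [h, hm, one_smul]
    · rw [hm] at h2; nlinarith
  · have h2 := sq_mul_volCoeff_deck (s := -1) (fun x => by rw [h, neg_smul, one_smul]) x
    rcases deckSign_eq_or m with hm | hm
    · rw [hm] at h2; nlinarith
    · rw [h, hm, neg_smul, one_smul]

theorem deckSign_one : deckSign 1 = -1 := by simp [deckSign]

theorem deckSign_two_mul (m : ℤ) : deckSign (2 * m) = 1 := by
  simp [deckSign, Int.negOnePow_two_mul]

theorem deck_two_mul (m n : ℤ) (x : ℝ × ℝ) : deck (2 * m) n x = (x.1 + 2 * m, x.2 + n) := by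
  rw [deck_eq, deckSign_two_mul]
  simp

theorem deckLin_two_mul (m : ℤ) (v : ℝ × ℝ) : deckLin (2 * m) v = v := by
  rw [deckLin_eq, deckSign_two_mul]
  simp

theorem not_rOrientable (hcone : N.IsTwoSidedCone) (hSL : N.IsSpecialLagrangian) {N' : RuledThreefold}
    (h : N'.dir = N.dir) : ¬ N'.ROrientable :=
  N'.not_rOrientable_of_dir fun x => by
    rw [h, dir_deck_eq hcone hSL, deckSign_one, neg_smul, one_smul]

/-! ### The complex structure of the link -/

/-- Rotation by 90 degrees on the link of a special Lagrangian cone. -/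
def rot (N : RuledThreefold) (x : ℝ × ℝ) : ℝ × ℝ →L[ℝ] ℝ × ℝ :=
  (N.volCoeff x)⁻¹ •
    ((-N.metricF x) • (ContinuousLinearMap.fst ℝ ℝ ℝ).smulRight ((1 : ℝ), (0 : ℝ)) +
      (-N.metricG x) • (ContinuousLinearMap.snd ℝ ℝ ℝ).smulRight ((1 : ℝ), (0 : ℝ)) +
      N.metricE x • (ContinuousLinearMap.fst ℝ ℝ ℝ).smulRight ((0 : ℝ), (1 : ℝ)) +
      N.metricF x • (ContinuousLinearMap.snd ℝ ℝ ℝ).smulRight ((0 : ℝ), (1 : ℝ)))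

theorem rot_fst (x v : ℝ × ℝ) :
    (N.rot x v).1 = -(N.metricF x * v.1 + N.metricG x * v.2) / N.volCoeff x := by
  simp [rot]
  ring

theorem rot_snd (x v : ℝ × ℝ) :
    (N.rot x v).2 = (N.metricE x * v.1 + N.metricF x * v.2) / N.volCoeff x := by
  simp [rot]
  ring

theorem contDiff_rot (hcone : N.IsTwoSidedCone) (hSL : N.IsSpecialLagrangian) :
    ContDiff ℝ ∞ N.rot := by
  have hD : ContDiff ℝ ∞ fun x => (N.volCoeff x)⁻¹ :=
    N.contDiff_volCoeff.inv (volCoeff_ne_zero hcone hSL)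
  have hE : ContDiff ℝ ∞ N.metricE := (N.contDiff_fderiv_dir _).inner ℝ (N.contDiff_fderiv_dir _)
  have hF : ContDiff ℝ ∞ N.metricF := (N.contDiff_fderiv_dir _).inner ℝ (N.contDiff_fderiv_dir _)
  have hG : ContDiff ℝ ∞ N.metricG := (N.contDiff_fderiv_dir _).inner ℝ (N.contDiff_fderiv_dir _)
  exact hD.smul ((((hF.neg.smul contDiff_const).add (hG.neg.smul contDiff_const)).add
    (hE.smul contDiff_const)).add (hF.smul contDiff_const))

theorem re_holVol_rot (hcone : N.IsTwoSidedCone) (hSL : N.IsSpecialLagrangian) (x v : ℝ × ℝ) :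
    (holVol ![N.dir x, fderiv ℝ N.dir x v, fderiv ℝ N.dir x (N.rot x v)]).re =
      inner ℝ (fderiv ℝ N.dir x v) (fderiv ℝ N.dir x v) := by
  have hD := volCoeff_ne_zero hcone hSL x
  rw [re_holVol_fderiv_dir, inner_fderiv_dir, rot_fst, rot_snd]
  field_simp
  ring

theorem inner_rot_rot (hcone : N.IsTwoSidedCone) (hSL : N.IsSpecialLagrangian) (x v : ℝ × ℝ) :
    inner ℝ (fderiv ℝ N.dir x (N.rot x v)) (fderiv ℝ N.dir x (N.rot x v)) =
      inner ℝ (fderiv ℝ N.dir x v) (fderiv ℝ N.dir x v) := by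
  have hD := volCoeff_ne_zero hcone hSL x
  have hq := volCoeff_sq hcone hSL x
  rw [inner_fderiv_dir, inner_fderiv_dir, rot_fst, rot_snd]
  field_simp
  rw [hq]
  ring

theorem inner_rot (x v : ℝ × ℝ) :
    inner ℝ (fderiv ℝ N.dir x (N.rot x v)) (fderiv ℝ N.dir x v) = 0 := by
  rw [inner_fderiv_dir, rot_fst, rot_snd]
  ring

theorem isComplexStructure_rot (hcone : N.IsTwoSidedCone) (hSL : N.IsSpecialLagrangian) :
    N.IsComplexStructure N.rot := fun x v hv => by
  refine ⟨?_, inner_rot x v, ?_⟩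
  · have h := inner_rot_rot hcone hSL x v
    rw [real_inner_self_eq_norm_sq, real_inner_self_eq_norm_sq] at h
    exact (sq_eq_sq₀ (norm_nonneg _) (norm_nonneg _)).1 h
  · rw [re_holVol_rot hcone hSL]
    exact norm_fderiv_dir_pos hcone x hv

theorem rot_rot (hcone : N.IsTwoSidedCone) (hSL : N.IsSpecialLagrangian) (x v : ℝ × ℝ) :
    N.rot x (N.rot x v) = -v := by
  have hD := volCoeff_ne_zero hcone hSL x
  have hq := volCoeff_sq hcone hSL x
  ext
  · rw [rot_fst, rot_fst, rot_snd, Prod.fst_neg]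
    field_simp
    rw [hq]
    ring
  · rw [rot_snd, rot_fst, rot_snd, Prod.snd_neg]
    field_simp
    rw [hq]
    ring

/-- Equality case of the calibration inequality. Put A = φ × dφ(v), B = dφ(Jv) and D = |dφ(v)|².
Then ⟪A, B⟫ = |B|² = D in the real inner product, while |A|² = D - |⟪φ, dφ(v)⟫|². Hence |A - B|² =
-|⟪φ, dφ(v)⟫|², and both sides vanish. -/
theorem ccross_and_inner (hcone : N.IsTwoSidedCone) (hSL : N.IsSpecialLagrangian) (x v : ℝ × ℝ) :
    ccross (N.dir x) (fderiv ℝ N.dir x v) = fderiv ℝ N.dir x (N.rot x v) ∧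
      inner ℂ (N.dir x) (fderiv ℝ N.dir x v) = 0 := by
  have h1 := re_holVol_rot hcone hSL x v
  rw [re_holVol_eq_inner, real_inner_self_eq_norm_sq] at h1
  have h2 := inner_rot_rot hcone hSL x v
  rw [real_inner_self_eq_norm_sq, real_inner_self_eq_norm_sq] at h2
  have h3 := norm_ccross_sq (N.dir x) (fderiv ℝ N.dir x v)
  rw [N.norm_dir] at h3
  have h4 := norm_sub_sq_real (ccross (N.dir x) (fderiv ℝ N.dir x v))
    (fderiv ℝ N.dir x (N.rot x v))
  have h5 := sq_nonneg ‖ccross (N.dir x) (fderiv ℝ N.dir x v) - fderiv ℝ N.dir x (N.rot x v)‖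
  have h6 := sq_nonneg ‖inner ℂ (N.dir x) (fderiv ℝ N.dir x v)‖
  constructor
  · refine sub_eq_zero.1 (norm_eq_zero.1 (pow_eq_zero_iff two_ne_zero |>.1 ?_))
    linarith
  · refine norm_eq_zero.1 (pow_eq_zero_iff two_ne_zero |>.1 ?_)
    linarith

/-- The link of a special Lagrangian cone is a pseudoholomorphic curve for the cross product. -/
theorem fderiv_dir_rot (hcone : N.IsTwoSidedCone) (hSL : N.IsSpecialLagrangian) (x v : ℝ × ℝ) :
    fderiv ℝ N.dir x (N.rot x v) = ccross (N.dir x) (fderiv ℝ N.dir x v) :=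
  (ccross_and_inner hcone hSL x v).1.symm

theorem inner_complex_dir_fderiv (hcone : N.IsTwoSidedCone) (hSL : N.IsSpecialLagrangian)
    (x v : ℝ × ℝ) : inner ℂ (N.dir x) (fderiv ℝ N.dir x v) = 0 :=
  (ccross_and_inner hcone hSL x v).2

/-- The product φ × dφ is quadratic in φ and does not see its sign s, whereas dφ does. So J commutes
with the deck transformation up to s: odd ones are antiholomorphic. -/
theorem rot_deck (hcone : N.IsTwoSidedCone) (hSL : N.IsSpecialLagrangian) (m n : ℤ)
    (x v : ℝ × ℝ) : N.rot (deck m n x) (deckLin m v) = deckSign m • deckLin m (N.rot x v) := by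
  apply injective_fderiv_dir hcone (deck m n x)
  have h := dir_deck_eq hcone hSL m n
  rw [fderiv_dir_rot hcone hSL, map_smul, fderiv_dir_deck N h, fderiv_dir_deck N h, h,
    fderiv_dir_rot hcone hSL, ccross_smul_left, ccross_smul_right]

theorem rot_add_period (hcone : N.IsTwoSidedCone) (hSL : N.IsSpecialLagrangian) (m n : ℤ)
    (x : ℝ × ℝ) : N.rot (x.1 + 2 * m, x.2 + n) = N.rot x := by
  refine ContinuousLinearMap.ext fun v => ?_
  have h := rot_deck hcone hSL (2 * m) n x v
  rwa [deckLin_two_mul, deckLin_two_mul, deckSign_two_mul, one_smul, deck_two_mul] at h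

end RuledThreefold

end ConeStructure

/-! ### Holomorphic vector fields on the torus that change sign under the glide reflection -/

noncomputable section HolomorphicFields

open scoped ComplexConjugate

/-- The Lie derivative of `J` along `w`, in terms of a `J`-holomorphic function `Z`. -/
theorem fderiv_lie_complexStructure {J : ℝ × ℝ → (ℝ × ℝ →L[ℝ] ℝ × ℝ)} (hJ : ContDiff ℝ ∞ J)
    {Z : ℝ × ℝ → ℂ} (hZ : ContDiff ℝ ∞ Z)
    (hZJ : ∀ x v, fderiv ℝ Z x (J x v) = Complex.I * fderiv ℝ Z x v)
    {w : ℝ × ℝ → ℝ × ℝ} (hw : ContDiff ℝ ∞ w) (x v : ℝ × ℝ) :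
    fderiv ℝ Z x (fderiv ℝ (fun y => J y v) x (w x) - fderiv ℝ w x (J x v) +
      J x (fderiv ℝ w x v)) =
    Complex.I * fderiv ℝ (fun y => fderiv ℝ Z y (w y)) x v -
      fderiv ℝ (fun y => fderiv ℝ Z y (w y)) x (J x v) := by
  have hdZ : HasFDerivAt (fderiv ℝ Z) (fderiv ℝ (fderiv ℝ Z) x) x :=
    ((hZ.fderiv_right (m := ∞) (by simp)).differentiable (by simp) x).hasFDerivAt
  have h1 : ∀ u, fderiv ℝ (fun y => fderiv ℝ Z y (w y)) x u =
      fderiv ℝ (fderiv ℝ Z) x u (w x) + fderiv ℝ Z x (fderiv ℝ w x u) := fun u => by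
    rw [(hdZ.clm_apply (hw.differentiable (by simp) x).hasFDerivAt).fderiv]
    simp [add_comm]
  have hJv : ContDiff ℝ ∞ fun y => J y v := hJ.clm_apply contDiff_const
  have h2 : fderiv ℝ (fun y => fderiv ℝ Z y (J y v)) x (w x) =
      fderiv ℝ (fderiv ℝ Z) x (w x) (J x v) +
        fderiv ℝ Z x (fderiv ℝ (fun y => J y v) x (w x)) := by
    rw [(hdZ.clm_apply (hJv.differentiable (by simp) x).hasFDerivAt).fderiv]
    simp [add_comm]
  have h3 : fderiv ℝ (fun y => fderiv ℝ Z y (J y v)) x (w x) =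
      Complex.I * fderiv ℝ (fderiv ℝ Z) x (w x) v := by
    rw [funext fun y => hZJ y v, fderiv_const_mul
      ((hZ.fderiv_apply_const v).differentiable (by simp) x), smul_apply,
      fderiv_fderiv_apply hZ, smul_eq_mul]
  have hsymm : ∀ u, fderiv ℝ (fderiv ℝ Z) x (w x) u = fderiv ℝ (fderiv ℝ Z) x u (w x) := by
    intro u
    rw [← fderiv_fderiv_apply hZ, ← fderiv_fderiv_apply hZ, fderiv_fderiv_comm hZ]
  have h4 := hsymm v
  have h5 := hsymm (J x v)
  rw [map_add, map_sub, hZJ, h1, h1]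
  rw [h2] at h3
  rw [h4, h5] at h3
  linear_combination h3

/-- The vector field with constant coefficient `h` in the coordinate `Z`. -/
def coordField (Z : ℝ × ℝ → ℂ) (h : ℂ) (x : ℝ × ℝ) : ℝ × ℝ := (fderiv ℝ Z x).inverse h

namespace IsGlobalCoordinate

variable {J : ℝ × ℝ → (ℝ × ℝ →L[ℝ] ℝ × ℝ)} {p : ℝ} {Z : ℝ × ℝ → ℂ}

/-- The derivative of a global coordinate as a linear equivalence. -/
def equiv (hZ : IsGlobalCoordinate J p Z) (x : ℝ × ℝ) : (ℝ × ℝ) ≃L[ℝ] ℂ :=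
  ContinuousLinearEquiv.ofBijective (fderiv ℝ Z x)
    (LinearMap.ker_eq_bot.2 (hZ.bijective_fderiv x).1)
    (LinearMap.range_eq_top.2 (hZ.bijective_fderiv x).2)

theorem coe_equiv (hZ : IsGlobalCoordinate J p Z) (x : ℝ × ℝ) :
    (hZ.equiv x : ℝ × ℝ →L[ℝ] ℂ) = fderiv ℝ Z x := by
  ext <;> rfl

theorem fderiv_coordField (hZ : IsGlobalCoordinate J p Z) (h : ℂ) (x : ℝ × ℝ) :
    fderiv ℝ Z x (coordField Z h x) = h := by
  rw [coordField, ← hZ.coe_equiv, ContinuousLinearMap.inverse_equiv]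
  simp

theorem contDiff_coordField (hZ : IsGlobalCoordinate J p Z) (h : ℂ) :
    ContDiff ℝ ∞ (coordField Z h) := by
  refine ContDiff.clm_apply (contDiff_iff_contDiffAt.2 fun x => ?_) contDiff_const
  have h1 := contDiffAt_map_inverse (n := ∞) (hZ.equiv x)
  rw [coe_equiv] at h1
  exact h1.comp x (hZ.contDiff.fderiv_right (m := ∞) (by simp)).contDiffAt

theorem eq_of_fderiv_eq (hZ : IsGlobalCoordinate J p Z) {x u v : ℝ × ℝ}
    (h : fderiv ℝ Z x u = fderiv ℝ Z x v) : u = v := (hZ.bijective_fderiv x).1 h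

/-- The Lie derivative of the complex structure along `w` vanishes iff `dZ w` is holomorphic. -/
theorem lie_eq_zero_iff (hZ : IsGlobalCoordinate J p Z) (hJ : ContDiff ℝ ∞ J)
    {w : ℝ × ℝ → ℝ × ℝ} (hw : ContDiff ℝ ∞ w) (x v : ℝ × ℝ) :
    fderiv ℝ (fun y => J y v) x (w x) - fderiv ℝ w x (J x v) + J x (fderiv ℝ w x v) = 0 ↔
    fderiv ℝ (fun y => fderiv ℝ Z y (w y)) x (J x v) =
      Complex.I * fderiv ℝ (fun y => fderiv ℝ Z y (w y)) x v := by
  have key := fderiv_lie_complexStructure hJ hZ.contDiff hZ.map_J hw x v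
  constructor
  · intro h
    rw [h, map_zero] at key
    exact (sub_eq_zero.1 key.symm).symm
  · intro h
    rw [h, sub_self] at key
    exact hZ.eq_of_fderiv_eq (key.trans (map_zero _).symm)

theorem lie_coordField (hZ : IsGlobalCoordinate J p Z) (hJ : ContDiff ℝ ∞ J) (h : ℂ)
    (x v : ℝ × ℝ) : fderiv ℝ (fun y => J y v) x (coordField Z h x) -
      fderiv ℝ (coordField Z h) x (J x v) + J x (fderiv ℝ (coordField Z h) x v) = 0 := by
  rw [hZ.lie_eq_zero_iff hJ (hZ.contDiff_coordField h), funext (hZ.fderiv_coordField h)]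
  simp

theorem coordField_periodic (hZ : IsGlobalCoordinate J p Z) (h : ℂ) (m n : ℤ) (x : ℝ × ℝ) :
    coordField Z h (x.1 + p * m, x.2 + n) = coordField Z h x := by
  rw [coordField, hZ.fderiv_periodic, coordField]

/-- A complex linear map on the tangent space is determined by its value on a coordinate field. -/
theorem eq_mul_of_complexLinear (hZ : IsGlobalCoordinate J p Z) {x : ℝ × ℝ} {L : ℝ × ℝ → ℂ}
    (hadd : ∀ u v, L (u + v) = L u + L v) (hsmul : ∀ (c : ℝ) u, L (c • u) = c * L u)
    (hL : ∀ v, L (J x v) = Complex.I * L v) {h0 : ℂ} (h00 : h0 ≠ 0) {u : ℝ × ℝ}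
    (hu : fderiv ℝ Z x u = h0) {k : ℂ} (hLu : L u = k * h0) (v : ℝ × ℝ) :
    L v = k * fderiv ℝ Z x v := by
  obtain ⟨c, hc⟩ : ∃ c, fderiv ℝ Z x v = c * h0 := ⟨fderiv ℝ Z x v / h0, by field_simp⟩
  have hv : v = c.re • u + c.im • J x u := hZ.eq_of_fderiv_eq (by
    rw [map_add, map_smul, map_smul, hZ.map_J, hu, hc, Complex.real_smul, Complex.real_smul]
    conv_lhs => rw [← Complex.re_add_im c]
    ring)
  rw [hv, hadd, hsmul, hsmul, hL, hLu, map_add, map_smul, map_smul, hZ.map_J, hu,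
    Complex.real_smul, Complex.real_smul]
  ring

end IsGlobalCoordinate

namespace RuledThreefold

variable {N : RuledThreefold}

theorem dir_ne_neg_dir (N : RuledThreefold) (x : ℝ × ℝ) : N.dir x ≠ -N.dir x := fun h => by
  have h1 := N.norm_dir x
  rw [eq_zero_of_eq_neg_self h, norm_zero] at h1
  exact zero_ne_one h1

/-- Since `dir` transforms by `deckSign m`, the conditions for invariant and for reversed directions
merge into one equivariance rule. -/
theorem mem_antiInvariantFields_iff (hcone : N.IsTwoSidedCone) (hSL : N.IsSpecialLagrangian)
    {J : ℝ × ℝ → (ℝ × ℝ →L[ℝ] ℝ × ℝ)} {w : ℝ × ℝ → ℝ × ℝ} :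
    w ∈ N.antiInvariantFields J ↔ ContDiff ℝ ∞ w ∧
    (∀ x v, fderiv ℝ (fun y => J y v) x (w x) - fderiv ℝ w x (J x v) + J x (fderiv ℝ w x v) = 0) ∧
    ∀ (m n : ℤ) (x : ℝ × ℝ), w (deck m n x) = deckSign m • deckLin m (w x) := by
  refine and_congr_right fun _ => and_congr_right fun _ => ⟨?_, fun h => ⟨?_, ?_⟩⟩
  · rintro ⟨h1, h2⟩ m n x
    have hd := dir_deck_eq hcone hSL m n x
    rcases deckSign_eq_or m with hm | hm
    · rw [hm, one_smul] at hd ⊢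
      exact h1 m n x hd
    · rw [hm, neg_smul, one_smul] at hd ⊢
      exact h2 m n x hd
  · intro m n x hx
    have hd := dir_deck_eq hcone hSL m n x
    rcases deckSign_eq_or m with hm | hm
    · rw [h, hm, one_smul]
    · rw [hm, neg_smul, one_smul, hx] at hd
      exact absurd hd (N.dir_ne_neg_dir x)
  · intro m n x hx
    have hd := dir_deck_eq hcone hSL m n x
    rcases deckSign_eq_or m with hm | hm
    · rw [hm, one_smul, hx] at hd
      exact absurd hd.symm (N.dir_ne_neg_dir x)
    · rw [h, hm, neg_smul, one_smul]

/-- The glide reflection acts antiholomorphically in the global coordinate. -/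
theorem exists_glide_coeff (hcone : N.IsTwoSidedCone) (hSL : N.IsSpecialLagrangian)
    {Z : ℝ × ℝ → ℂ} (hZ : IsGlobalCoordinate N.rot 2 Z) :
    ∃ κ : ℂ, κ * conj κ = 1 ∧
      ∀ x v, conj (fderiv ℝ Z (deck 1 0 x) (deckLin 1 v)) = κ * fderiv ℝ Z x v := by
  -- The glide reflection and conjugation each reverse J, so Y is J-holomorphic.
  set Y : ℝ × ℝ → ℂ := fun x => conj (Z (deck 1 0 x)) with hY
  have hdeck : ContDiff ℝ ∞ (deck 1 0) := by
    rw [funext (deck_eq_add 1 0)]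
    exact (deckCLM 1).contDiff.add contDiff_const
  have hYs : ContDiff ℝ ∞ Y := Complex.conjCLE.contDiff.comp (hZ.contDiff.comp hdeck)
  have hYd : ∀ x v, fderiv ℝ Y x v = conj (fderiv ℝ Z (deck 1 0 x) (deckLin 1 v)) := fun x v => by
    have h1 := (Complex.conjCLE.toContinuousLinearMap.hasFDerivAt (x := Z (deck 1 0 x))).comp x
      ((hZ.contDiff.differentiable (by simp) (deck 1 0 x)).hasFDerivAt.comp x
        (hasFDerivAt_deck 1 0 x))
    have h2 : fderiv ℝ Y x = _ := h1.fderiv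
    rw [h2]
    rfl
  have hYJ : ∀ x v, fderiv ℝ Y x (N.rot x v) = Complex.I * fderiv ℝ Y x v := fun x v => by
    have h1 : deckLin 1 (N.rot x v) = -N.rot (deck 1 0 x) (deckLin 1 v) := by
      rw [rot_deck hcone hSL, deckSign_one]
      simp
    rw [hYd, hYd, h1, map_neg, hZ.map_J]
    simp
  have hsm := hZ.contDiff_coordField 1
  -- The ratio dY/dZ, evaluated on the unit coordinate field, is holomorphic on the torus; by
  -- Liouville it is a constant, κ.
  have hH : ∀ x, fderiv ℝ (fun y => fderiv ℝ Y y (coordField Z 1 y)) x = 0 := by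
    refine hZ.liouville _ ((hYs.fderiv_right (m := ∞) (by simp)).clm_apply hsm) ?_ ?_
    · intro m n x
      have h1 : deck 1 0 (x.1 + 2 * (m : ℝ), x.2 + n) =
          ((deck 1 0 x).1 + 2 * (m : ℝ), (deck 1 0 x).2 + ((-n : ℤ) : ℝ)) := by
        ext <;> simp [deck_eq, deckSign_one] <;> ring
      rw [hYd, hYd, h1, hZ.fderiv_periodic, hZ.coordField_periodic]
    · intro x v
      have key := fderiv_lie_complexStructure (contDiff_rot hcone hSL) hYs hYJ hsm x v
      rw [hZ.lie_coordField (contDiff_rot hcone hSL), map_zero] at key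
      exact (sub_eq_zero.1 key.symm).symm
  have hconst := eq_of_fderiv_eq_zero
    (((hYs.fderiv_right (m := ∞) (by simp)).clm_apply hsm).differentiable (by simp)) hH
  have hmain : ∀ x v, conj (fderiv ℝ Z (deck 1 0 x) (deckLin 1 v)) =
      fderiv ℝ Y 0 (coordField Z 1 0) * fderiv ℝ Z x v := fun x v => by
    rw [← hYd]
    refine hZ.eq_mul_of_complexLinear (map_add _) (fun c u => ?_) (hYJ x) one_ne_zero
      (hZ.fderiv_coordField 1 x) ?_ v
    · rw [map_smul, Complex.real_smul]
    · rw [mul_one]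
      exact hconst x 0
  refine ⟨_, ?_, hmain⟩
  set κ := fderiv ℝ Y 0 (coordField Z 1 0)
  have h1 := hmain (deck 1 0 0) (deckLin 1 (coordField Z 1 0))
  -- The square of the glide reflection is a period of dZ, and applying the relation twice
  -- multiplies by κ conj κ, so |κ| = 1.
  have h2 : deck 1 0 (deck 1 0 0) = ((0 : ℝ × ℝ).1 + 2 * ((1 : ℤ) : ℝ), (0 : ℝ × ℝ).2 + ((0 : ℤ) : ℝ)) := by
    ext <;> simp [deck_eq]; norm_num
  have h3 := congrArg conj (hmain 0 (coordField Z 1 0))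
  rw [Complex.conj_conj, hZ.fderiv_coordField, mul_one] at h3
  rw [deckLin_deckLin, h2, hZ.fderiv_periodic, hZ.fderiv_coordField, h3] at h1
  simpa using h1.symm

/-- The map h ↦ -conj(κ h) is a real reflection of ℂ. Its fixed vector 1 - conj κ is the
symmetrization of 1, and works unless κ = 1, where i does. -/
theorem exists_conj_eq_neg_mul {κ : ℂ} (hκ : κ * conj κ = 1) :
    ∃ h : ℂ, h ≠ 0 ∧ conj h = -(κ * h) := by
  by_cases h1 : κ = 1
  · exact ⟨Complex.I, Complex.I_ne_zero, by simp [h1]⟩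
  · refine ⟨1 - conj κ, fun h => h1 ?_, ?_⟩
    · have := congrArg conj (sub_eq_zero.1 h)
      simpa using this.symm
    · simp only [map_sub, map_one, Complex.conj_conj]
      linear_combination -hκ

theorem fderiv_field_eq_const (hcone : N.IsTwoSidedCone) (hSL : N.IsSpecialLagrangian)
    {Z : ℝ × ℝ → ℂ} (hZ : IsGlobalCoordinate N.rot 2 Z) {w : ℝ × ℝ → ℝ × ℝ}
    (hw : w ∈ N.antiInvariantFields N.rot) (x : ℝ × ℝ) :
    fderiv ℝ Z x (w x) = fderiv ℝ Z 0 (w 0) := by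
  obtain ⟨h1, h2, h3⟩ := (mem_antiInvariantFields_iff hcone hSL).1 hw
  have hs : ContDiff ℝ ∞ fun y => fderiv ℝ Z y (w y) :=
    (hZ.contDiff.fderiv_right (m := ∞) (by simp)).clm_apply h1
  refine eq_of_fderiv_eq_zero (f := fun y => fderiv ℝ Z y (w y)) (hs.differentiable (by simp))
    (hZ.liouville _ hs (fun m n x => ?_) fun x v =>
      (hZ.lie_eq_zero_iff (contDiff_rot hcone hSL) h1 x v).1 (h2 x v)) x 0
  have h4 := h3 (2 * m) n x
  rw [deckLin_two_mul, deckSign_two_mul, one_smul, deck_two_mul] at h4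
  rw [h4, hZ.fderiv_periodic]

theorem coordField_mem (hcone : N.IsTwoSidedCone) (hSL : N.IsSpecialLagrangian)
    {Z : ℝ × ℝ → ℂ} (hZ : IsGlobalCoordinate N.rot 2 Z) {κ h : ℂ}
    (hκ : ∀ x v, conj (fderiv ℝ Z (deck 1 0 x) (deckLin 1 v)) = κ * fderiv ℝ Z x v)
    (hh : conj h = -(κ * h)) : coordField Z h ∈ N.antiInvariantFields N.rot := by
  refine (mem_antiInvariantFields_iff hcone hSL).2 ⟨hZ.contDiff_coordField h,
    hZ.lie_coordField (contDiff_rot hcone hSL) h, fun m n x => hZ.eq_of_fderiv_eq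
      (x := deck m n x) ?_⟩
  rw [hZ.fderiv_coordField, map_smul]
  obtain ⟨k, rfl | rfl⟩ := Int.even_or_odd' m
  · rw [deckSign_two_mul, one_smul, deckLin_two_mul, deck_two_mul, hZ.fderiv_periodic,
      hZ.fderiv_coordField]
  · have hs : deckSign (2 * k + 1) = -1 := by simp [deckSign, Int.negOnePow_succ, Int.negOnePow_two_mul]
    have h1 : deck (2 * k + 1) n x =
        ((deck 1 0 x).1 + 2 * (k : ℝ), (deck 1 0 x).2 + (n : ℝ)) := by
      ext
      · simp [deck_eq]; ring
      · simp [deck_eq, hs, deckSign_one]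
    have h2 : deckLin (2 * k + 1) (coordField Z h x) = deckLin 1 (coordField Z h x) := by
      rw [deckLin_eq, deckLin_eq, hs, deckSign_one]
    have h3 := congrArg conj (hκ x (coordField Z h x))
    rw [Complex.conj_conj, hZ.fderiv_coordField, map_mul] at h3
    rw [hs, h2, h1, hZ.fderiv_periodic, h3]
    have h4 := congrArg conj hh
    simp only [Complex.conj_conj, map_neg, map_mul] at h4
    rw [neg_smul, one_smul]
    exact h4

/-- A field is determined by the constant g = dZ(w), and the sign change says conj g = -κ g. For two
solutions g, h of this equation g conj h is real, so the solutions form a real line. -/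
theorem exists_field_generator (hcone : N.IsTwoSidedCone) (hSL : N.IsSpecialLagrangian)
    {Z : ℝ × ℝ → ℂ} (hZ : IsGlobalCoordinate N.rot 2 Z) :
    ∃ h : ℂ, h ≠ 0 ∧ coordField Z h ∈ N.antiInvariantFields N.rot ∧
      ∀ w ∈ N.antiInvariantFields N.rot, ∃ c : ℝ, w = c • coordField Z h := by
  obtain ⟨κ, hκ1, hκ⟩ := exists_glide_coeff hcone hSL hZ
  obtain ⟨h, h0, hh⟩ := exists_conj_eq_neg_mul hκ1
  refine ⟨h, h0, coordField_mem hcone hSL hZ hκ hh, fun w hw => ?_⟩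
  have h3 := ((mem_antiInvariantFields_iff hcone hSL).1 hw).2.2 1 0 0
  set g := fderiv ℝ Z 0 (w 0) with hg
  have h1 : conj g = -(κ * g) := by
    have h5 := hκ 0 (w 0)
    have h6 : deckLin 1 (w 0) = -w (deck 1 0 0) := by
      rw [h3, deckSign_one]; simp
    rw [h6, map_neg, fderiv_field_eq_const hcone hSL hZ hw, map_neg] at h5
    rw [← h5, neg_neg]
  obtain ⟨r, hr⟩ : ∃ r : ℝ, g * conj h = r := by
    refine ⟨_, (Complex.conj_eq_iff_re.1 ?_).symm⟩
    rw [map_mul, Complex.conj_conj]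
    linear_combination h * h1 - g * hh
  refine ⟨r / Complex.normSq h, funext fun x => hZ.eq_of_fderiv_eq (x := x) ?_⟩
  rw [fderiv_field_eq_const hcone hSL hZ hw, Pi.smul_apply, map_smul, hZ.fderiv_coordField,
    Complex.real_smul]
  push_cast
  rw [← hr, ← Complex.mul_conj]
  have : conj h ≠ 0 := by simpa using h0
  field_simp
  exact hg

theorem finrank_antiInvariantFields (hcone : N.IsTwoSidedCone) (hSL : N.IsSpecialLagrangian)
    {Z : ℝ × ℝ → ℂ} (hZ : IsGlobalCoordinate N.rot 2 Z) :
    Module.finrank ℝ (N.antiInvariantFields N.rot) = 1 := by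
  obtain ⟨h, h0, hm, hg⟩ := exists_field_generator hcone hSL hZ
  refine finrank_eq_one (⟨_, hm⟩ : N.antiInvariantFields N.rot) (fun h1 => h0 ?_) ?_
  · have h2 := hZ.fderiv_coordField h 0
    rw [show coordField Z h = 0 from congrArg Subtype.val h1] at h2
    simpa using h2.symm
  · rintro ⟨w, hw⟩
    obtain ⟨c, rfl⟩ := hg w hw
    exact ⟨c, rfl⟩

end RuledThreefold

end HolomorphicFields

/-! ### The translated ruled 3-folds are special Lagrangian -/

noncomputable section TranslatedCone

open scoped ComplexConjugate

namespace RuledThreefold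

variable {N : RuledThreefold}

/-- The link of a special Lagrangian cone is Legendrian. -/
theorem inner_fderiv_dir_comm (hcone : N.IsTwoSidedCone) (hSL : N.IsSpecialLagrangian)
    (x u v : ℝ × ℝ) : inner ℂ (fderiv ℝ N.dir x u) (fderiv ℝ N.dir x v) =
      inner ℂ (fderiv ℝ N.dir x v) (fderiv ℝ N.dir x u) := by
  -- Differentiating ⟪φ, dφ(v)⟫ = 0 in the direction u expresses the product through the symmetric
  -- second derivative of φ.
  have key : ∀ u v, inner ℂ (fderiv ℝ N.dir x u) (fderiv ℝ N.dir x v) =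
      -inner ℂ (N.dir x) (fderiv ℝ (fderiv ℝ N.dir) x u v) := fun u v => by
    have h1 := ((N.contDiff_dir.differentiable (by simp) x).hasFDerivAt.inner ℂ
      ((N.contDiff_fderiv_dir v).differentiable (by simp) x).hasFDerivAt).fderiv
    rw [show (fun y => inner ℂ (N.dir y) (fderiv ℝ N.dir y v)) = fun _ => (0 : ℂ) from
      funext fun y => inner_complex_dir_fderiv hcone hSL y v] at h1
    have h2 := congrArg (fun L => L u) h1
    simp only [fderiv_fun_const, Pi.zero_apply, zero_apply, ContinuousLinearMap.comp_apply,
      ContinuousLinearMap.prod_apply, fderivInnerCLM_apply] at h2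
    rw [fderiv_fderiv_apply N.contDiff_dir] at h2
    linear_combination -h2
  rw [key, key, ← fderiv_fderiv_apply N.contDiff_dir, ← fderiv_fderiv_apply N.contDiff_dir,
    fderiv_fderiv_comm N.contDiff_dir]

theorem im_inner_fderiv_dir (hcone : N.IsTwoSidedCone) (hSL : N.IsSpecialLagrangian)
    (x u v : ℝ × ℝ) : (inner ℂ (fderiv ℝ N.dir x u) (fderiv ℝ N.dir x v)).im = 0 := by
  have h := inner_fderiv_dir_comm hcone hSL x u v
  rw [← inner_conj_symm (fderiv ℝ N.dir x v)] at h
  exact Complex.conj_eq_iff_im.1 h.symm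

/-- Write dφ(u) = φ × dφ(-Ju) and expand the double product. One term contains ⟪dφ(v), φ⟫ = 0; the
other is φ times a Hermitian product of tangent vectors, which is real by the Legendrian condition.
-/
theorem ccross_fderiv_fderiv (hcone : N.IsTwoSidedCone) (hSL : N.IsSpecialLagrangian)
    (x u v : ℝ × ℝ) :
    ∃ c : ℝ, ccross (fderiv ℝ N.dir x u) (fderiv ℝ N.dir x v) = c • N.dir x := by
  have h1 : fderiv ℝ N.dir x u = ccross (N.dir x) (fderiv ℝ N.dir x (-(N.rot x u))) := by
    rw [← fderiv_dir_rot hcone hSL, map_neg, rot_rot hcone hSL, neg_neg]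
  have h2 : inner ℂ (fderiv ℝ N.dir x v) (N.dir x) = 0 := by
    rw [← inner_conj_symm, inner_complex_dir_fderiv hcone hSL, map_zero]
  set k := inner ℂ (fderiv ℝ N.dir x v) (fderiv ℝ N.dir x (-(N.rot x u))) with hk
  have h3 : (k.re : ℂ) = k := Complex.ext rfl (im_inner_fderiv_dir hcone hSL x _ _).symm
  refine ⟨-k.re, ?_⟩
  rw [h1, ccross_ccross, h2, ← hk]
  ext i
  simp [h3]
  ring

/-- The first order deformation `L_w dir` of the link along a vector field `w`. -/
def variation (N : RuledThreefold) (w : ℝ × ℝ → ℝ × ℝ) (x : ℝ × ℝ) : C3 := fderiv ℝ N.dir x (w x)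

theorem contDiff_variation (N : RuledThreefold) {w : ℝ × ℝ → ℝ × ℝ} (hw : ContDiff ℝ ∞ w) :
    ContDiff ℝ ∞ (N.variation w) :=
  (N.contDiff_dir.fderiv_right (m := ∞) (by simp)).clm_apply hw

theorem fderiv_variation (N : RuledThreefold) {w : ℝ × ℝ → ℝ × ℝ} (hw : ContDiff ℝ ∞ w)
    (x u : ℝ × ℝ) : fderiv ℝ (N.variation w) x u =
      fderiv ℝ (fderiv ℝ N.dir) x u (w x) + fderiv ℝ N.dir x (fderiv ℝ w x u) := by
  have hd : HasFDerivAt (fderiv ℝ N.dir) (fderiv ℝ (fderiv ℝ N.dir) x) x :=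
    ((N.contDiff_dir.fderiv_right (m := ∞) (by simp)).differentiable (by simp) x).hasFDerivAt
  have h1 : fderiv ℝ (N.variation w) x = _ :=
    (hd.clm_apply (hw.differentiable (by simp) x).hasFDerivAt).fderiv
  rw [h1]
  simp [add_comm]

/-- The Lie derivative along w of dφ(Jv) = φ × dφ(v). Symmetry of second derivatives and L_w J = 0
turn it into the linearized equation for ψ = L_w φ. -/
theorem fderiv_variation_rot (hcone : N.IsTwoSidedCone) (hSL : N.IsSpecialLagrangian)
    {w : ℝ × ℝ → ℝ × ℝ} (hw : w ∈ N.antiInvariantFields N.rot) (x v : ℝ × ℝ) :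
    fderiv ℝ (N.variation w) x (N.rot x v) =
      ccross (N.variation w x) (fderiv ℝ N.dir x v) +
        ccross (N.dir x) (fderiv ℝ (N.variation w) x v) := by
  obtain ⟨hw1, hw2, -⟩ := (mem_antiInvariantFields_iff hcone hSL).1 hw
  have hd : HasFDerivAt (fderiv ℝ N.dir) (fderiv ℝ (fderiv ℝ N.dir) x) x :=
    ((N.contDiff_dir.fderiv_right (m := ∞) (by simp)).differentiable (by simp) x).hasFDerivAt
  have hJv : ContDiff ℝ ∞ fun y => N.rot y v := (contDiff_rot hcone hSL).clm_apply contDiff_const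
  have h2 : fderiv ℝ (fun y => fderiv ℝ N.dir y (N.rot y v)) x (w x) =
      fderiv ℝ (fderiv ℝ N.dir) x (w x) (N.rot x v) +
        fderiv ℝ N.dir x (fderiv ℝ (fun y => N.rot y v) x (w x)) := by
    rw [(hd.clm_apply (hJv.differentiable (by simp) x).hasFDerivAt).fderiv]
    simp [add_comm]
  have h3 : fderiv ℝ (fun y => ccrossL (N.dir y) (fderiv ℝ N.dir y v)) x (w x) =
      ccross (fderiv ℝ N.dir x (w x)) (fderiv ℝ N.dir x v) +
        ccross (N.dir x) (fderiv ℝ (fderiv ℝ N.dir) x (w x) v) := by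
    have h4 := (ccrossL.hasFDerivAt (x := N.dir x)).comp x
      (N.contDiff_dir.differentiable (by simp) x).hasFDerivAt
    have h5 : fderiv ℝ (fun y => ccrossL (N.dir y) (fderiv ℝ N.dir y v)) x = _ :=
      (h4.clm_apply ((N.contDiff_fderiv_dir v).differentiable (by simp) x).hasFDerivAt).fderiv
    rw [h5, ← fderiv_fderiv_apply N.contDiff_dir]
    simp [add_comm]
  rw [show (fun y => fderiv ℝ N.dir y (N.rot y v)) =
    fun y => ccrossL (N.dir y) (fderiv ℝ N.dir y v) from
    funext fun y => fderiv_dir_rot hcone hSL y v, h3] at h2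
  have hsymm : ∀ u, fderiv ℝ (fderiv ℝ N.dir) x (w x) u = fderiv ℝ (fderiv ℝ N.dir) x u (w x) := by
    intro u
    rw [← fderiv_fderiv_apply N.contDiff_dir, ← fderiv_fderiv_apply N.contDiff_dir,
      fderiv_fderiv_comm N.contDiff_dir]
  have h6 : fderiv ℝ w x (N.rot x v) =
      fderiv ℝ (fun y => N.rot y v) x (w x) + N.rot x (fderiv ℝ w x v) := by
    have h7 := hw2 x v
    rw [sub_add_eq_add_sub, sub_eq_zero] at h7
    exact h7.symm
  rw [fderiv_variation N hw1, fderiv_variation N hw1, h6, map_add, fderiv_dir_rot hcone hSL,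
    ccross_add_right, ← hsymm, ← hsymm, ← add_assoc, ← h2, variation]
  abel

theorem inner_dir_variation (hcone : N.IsTwoSidedCone) (hSL : N.IsSpecialLagrangian)
    (w : ℝ × ℝ → ℝ × ℝ) (x : ℝ × ℝ) : inner ℂ (N.dir x) (N.variation w x) = 0 :=
  inner_complex_dir_fderiv hcone hSL x _

/-- Differentiate ⟪φ, ψ⟫ = 0; the remaining term ⟪dφ(v), dφ(w)⟫ is real. -/
theorem im_inner_dir_fderiv_variation (hcone : N.IsTwoSidedCone) (hSL : N.IsSpecialLagrangian)
    {w : ℝ × ℝ → ℝ × ℝ} (hw : ContDiff ℝ ∞ w) (x v : ℝ × ℝ) :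
    (inner ℂ (N.dir x) (fderiv ℝ (N.variation w) x v)).im = 0 := by
  have h1 := ((N.contDiff_dir.differentiable (by simp) x).hasFDerivAt.inner ℂ
    ((N.contDiff_variation hw).differentiable (by simp) x).hasFDerivAt).fderiv
  rw [show (fun y => inner ℂ (N.dir y) (N.variation w y)) = fun _ => (0 : ℂ) from
    funext fun y => inner_dir_variation hcone hSL w y] at h1
  have h2 := congrArg (fun L => (L v).im) h1
  simp only [fderiv_fun_const, Pi.zero_apply, zero_apply, ContinuousLinearMap.comp_apply,
    ContinuousLinearMap.prod_apply, fderivInnerCLM_apply, Complex.add_im, Complex.zero_im] at h2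
  rw [variation, im_inner_fderiv_dir hcone hSL, add_zero] at h2
  exact h2.symm

/-- The ruled 3-fold obtained by translating the lines of a cone by the variation along `w`. -/
def translate (N : RuledThreefold) (hcone : N.IsTwoSidedCone) (hSL : N.IsSpecialLagrangian)
    (w : N.antiInvariantFields N.rot) : RuledThreefold where
  dir := N.dir
  foot := N.variation w
  contDiff_dir := N.contDiff_dir
  contDiff_foot := N.contDiff_variation ((mem_antiInvariantFields_iff hcone hSL).1 w.2).1
  norm_dir := N.norm_dir
  inner_dir_foot := fun x => N.inner_dir_fderiv x _
  dir_deck := N.dir_deck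
  foot_deck := fun m n x => by
    rw [variation, ((mem_antiInvariantFields_iff hcone hSL).1 w.2).2.2, map_smul,
      fderiv_dir_deck N (dir_deck_eq hcone hSL m n), smul_smul, deckSign_mul_self, one_smul]
    rfl

/-- The horizontal part of the derivative of the immersion of a translated cone. -/
def horizontal (N : RuledThreefold) (w : ℝ × ℝ → ℝ × ℝ) (r : ℝ) (x : ℝ × ℝ) : ℝ × ℝ →L[ℝ] C3 :=
  r • fderiv ℝ N.dir x + fderiv ℝ (N.variation w) x

theorem fderiv_imm_translate
    (hcone : N.IsTwoSidedCone) (hSL : N.IsSpecialLagrangian)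
    (w : N.antiInvariantFields N.rot) (y v : ℝ × ℝ × ℝ) :
    fderiv ℝ (N.translate hcone hSL w).imm y v =
      v.1 • N.dir y.2 + N.horizontal w y.1 y.2 v.2 := by
  rw [fderiv_imm]
  rfl

/-- Adds r times the equation of φ to the linearized equation of ψ; the extra term dφ(w) × dφ(v) is
a multiple of φ. Together with `im_inner_dir_horizontal` it puts the tangent space into the form φ,
a, φ × a + cφ. -/
theorem horizontal_rot
    (hcone : N.IsTwoSidedCone) (hSL : N.IsSpecialLagrangian)
    (w : N.antiInvariantFields N.rot) (r : ℝ) (x v : ℝ × ℝ) : ∃ c : ℝ, N.horizontal w r x (N.rot x v) =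
    ccross (N.dir x) (N.horizontal w r x v) + c • N.dir x := by
  obtain ⟨c, hc⟩ := ccross_fderiv_fderiv hcone hSL x ((w : ℝ × ℝ → ℝ × ℝ) x) v
  refine ⟨c, ?_⟩
  simp only [horizontal, add_apply, smul_apply]
  rw [fderiv_variation_rot hcone hSL w.2, fderiv_dir_rot hcone hSL, ccross_add_right,
    ccross_smul_right, variation, hc]
  abel

theorem im_inner_dir_horizontal
    (hcone : N.IsTwoSidedCone) (hSL : N.IsSpecialLagrangian)
    (w : N.antiInvariantFields N.rot) (r : ℝ) (x v : ℝ × ℝ) :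
    (inner ℂ (N.dir x) (N.horizontal w r x v)).im = 0 := by
  have h := im_inner_dir_fderiv_variation hcone hSL
    ((mem_antiInvariantFields_iff hcone hSL).1 w.2).1 x v
  simp only [horizontal, add_apply, smul_apply]
  rw [inner_add_right, Complex.add_im, h, inner_smul_right_eq_smul,
    inner_complex_dir_fderiv hcone hSL]
  simp

theorem exists_eq_smul_add_smul_rot
    (hcone : N.IsTwoSidedCone) (hSL : N.IsSpecialLagrangian) (x v : ℝ × ℝ) {u : ℝ × ℝ} (hu : u ≠ 0) :
    ∃ a b : ℝ, v = a • u + b • N.rot x u := by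
  have h1 := re_holVol_rot hcone hSL x u
  rw [re_holVol_fderiv_dir] at h1
  have h2 := norm_fderiv_dir_pos hcone x hu
  rw [← h1] at h2
  have h3 := (mul_ne_zero_iff.1 h2.ne').1
  refine ⟨(v.1 * (N.rot x u).2 - v.2 * (N.rot x u).1) / (u.1 * (N.rot x u).2 - u.2 * (N.rot x u).1),
    (u.1 * v.2 - u.2 * v.1) / (u.1 * (N.rot x u).2 - u.2 * (N.rot x u).1), ?_⟩
  ext
  · simp only [Prod.fst_add, Prod.smul_fst, smul_eq_mul]
    rw [div_mul_eq_mul_div, div_mul_eq_mul_div, ← add_div, eq_div_iff h3]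
    ring
  · simp only [Prod.snd_add, Prod.smul_snd, smul_eq_mul]
    rw [div_mul_eq_mul_div, div_mul_eq_mul_div, ← add_div, eq_div_iff h3]
    ring

theorem isCalibratedTriple_translate
    (hcone : N.IsTwoSidedCone) (hSL : N.IsSpecialLagrangian)
    (w : N.antiInvariantFields N.rot) (y : ℝ × ℝ × ℝ) (v : Fin 3 → ℝ × ℝ × ℝ) :
    IsCalibratedTriple fun i => fderiv ℝ (N.translate hcone hSL w).imm y (v i) := by
  have he : ((1, 0) : ℝ × ℝ) ≠ 0 := by simp
  choose a b hab using fun i =>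
    exists_eq_smul_add_smul_rot hcone hSL y.2 (v i).2 he
  obtain ⟨c, hc⟩ := horizontal_rot hcone hSL w y.1 y.2 (1, 0)
  have h1 := (isCalibratedTriple_ccross (N.norm_dir y.2)
    (im_inner_dir_horizontal hcone hSL w y.1 y.2 (1, 0)) c).sum
      (Matrix.of fun i => ![(v i).1, a i, b i])
  convert h1 using 1
  funext i
  rw [fderiv_imm_translate, hab i, map_add, map_smul, map_smul, hc]
  simp [Fin.sum_univ_three]
  abel

/-- If the derivative along v is parallel to φ, so is the one along Jv, because φ × φ = 0. Hence a
degenerate direction makes the whole horizontal image parallel to φ. -/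
theorem horizontal_mem_of_mem
    (hcone : N.IsTwoSidedCone) (hSL : N.IsSpecialLagrangian)
    (w : N.antiInvariantFields N.rot) {r : ℝ} {x v : ℝ × ℝ} (hv : v ≠ 0) {t : ℝ}
    (h : N.horizontal w r x v = t • N.dir x) (u : ℝ × ℝ) :
    ∃ s : ℝ, N.horizontal w r x u = s • N.dir x := by
  obtain ⟨a, b, rfl⟩ := exists_eq_smul_add_smul_rot hcone hSL x u hv
  obtain ⟨c, hc⟩ := horizontal_rot hcone hSL w r x v
  refine ⟨a * t + b * c, ?_⟩
  rw [map_add, map_smul, map_smul, hc, h, ccross_smul_right, ccross_self, smul_zero, zero_add,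
    smul_smul, smul_smul, add_smul]

theorem exists_of_not_nonsingular
    (hcone : N.IsTwoSidedCone) (hSL : N.IsSpecialLagrangian)
    (w : N.antiInvariantFields N.rot) {r : ℝ} {x : ℝ × ℝ}
    (h : ¬ (N.translate hcone hSL w).IsNonsingularAt (r, x)) (u : ℝ × ℝ) :
    ∃ s : ℝ, N.horizontal w r x u = s • N.dir x := by
  unfold IsNonsingularAt at h
  rw [injective_iff_map_eq_zero] at h
  push Not at h
  obtain ⟨⟨t, v⟩, hv, hne⟩ := h
  rw [fderiv_imm_translate] at hv
  simp only at hv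
  refine horizontal_mem_of_mem hcone hSL w (v := v) (t := -t) ?_ ?_ u
  · rintro rfl
    rw [map_zero, add_zero, smul_eq_zero] at hv
    rcases hv with rfl | hv
    · exact hne rfl
    · have h1 := N.norm_dir x
      rw [hv, norm_zero] at h1
      exact zero_ne_one h1
  · rw [neg_smul]
    exact eq_neg_of_add_eq_zero_right hv

/-- Two singular values r ≠ r' on the same line would make (r - r') ∂₁φ parallel to φ, but ∂₁φ is
nonzero and orthogonal to φ. So singular points are nowhere dense along each line. -/
theorem subsingleton_singular
    (hcone : N.IsTwoSidedCone) (hSL : N.IsSpecialLagrangian)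
    (w : N.antiInvariantFields N.rot) (x : ℝ × ℝ) :
    {r | ¬ (N.translate hcone hSL w).IsNonsingularAt (r, x)}.Subsingleton := by
  intro r hr r' hr'
  obtain ⟨s, hs⟩ := exists_of_not_nonsingular hcone hSL w hr (1, 0)
  obtain ⟨s', hs'⟩ := exists_of_not_nonsingular hcone hSL w hr' (1, 0)
  have h1 : (r - r') • fderiv ℝ N.dir x (1, 0) = (s - s') • N.dir x := by
    rw [sub_smul, sub_smul, ← hs, ← hs']
    simp [horizontal]
  have h2 := congrArg (fun z => inner ℝ z (fderiv ℝ N.dir x (1, 0))) h1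
  simp only [real_inner_smul_left, inner_dir_fderiv, mul_zero] at h2
  exact sub_eq_zero.1 ((mul_eq_zero.1 h2).resolve_right (metricE_pos hcone x).ne')

theorem isSpecialLagrangian_translate
    (hcone : N.IsTwoSidedCone) (hSL : N.IsSpecialLagrangian)
    (w : N.antiInvariantFields N.rot) : (N.translate hcone hSL w).IsSpecialLagrangian := by
  refine ⟨fun y => ?_, fun y _ v => isCalibratedTriple_translate hcone hSL w y v⟩
  have h1 : Dense {r | ¬ (N.translate hcone hSL w).IsNonsingularAt (r, y.2)}ᶜ :=
    (subsingleton_singular hcone hSL w y.2).finite.countable.dense_compl ℝ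
  refine map_mem_closure (f := fun r : ℝ => (r, y.2)) (by fun_prop) (h1 y.1) fun r hr => ?_
  exact not_not.1 hr

theorem asymptoticCone_translate
    (hcone : N.IsTwoSidedCone) (hSL : N.IsSpecialLagrangian)
    (w : N.antiInvariantFields N.rot) :
    (N.translate hcone hSL w).asymptoticCone = Set.range N.imm := by
  ext v
  constructor
  · rintro ⟨x, c, rfl⟩
    exact ⟨(c, x), by simp [imm, hcone.1]; rfl⟩
  · rintro ⟨⟨c, x⟩, rfl⟩
    exact ⟨x, c, by simp [imm, hcone.1]; rfl⟩

end RuledThreefold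

end TranslatedCone

/-! ### Covariant derivatives of an induced metric: smoothness and scaling -/

noncomputable section CovariantDerivatives

variable {ι : ℝ × ℝ × ℝ → C3}

/-- The real inner product of `ℂ³` as a continuous bilinear map. -/
def realInner : C3 →L[ℝ] C3 →L[ℝ] ℝ :=
  (isBoundedBilinearMap_inner (𝕜 := ℝ) (E := C3)).toContinuousLinearMap

/-- The bilinear form induced by a linear map to `ℂ³`. -/
def gramMap (D : ℝ × ℝ × ℝ →L[ℝ] C3) : ℝ × ℝ × ℝ →L[ℝ] ℝ × ℝ × ℝ →L[ℝ] ℝ :=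
  ((ContinuousLinearMap.compL ℝ (ℝ × ℝ × ℝ) C3 ℝ).flip D).comp (realInner.comp D)

theorem gramMap_apply (D : ℝ × ℝ × ℝ →L[ℝ] C3) (u v : ℝ × ℝ × ℝ) :
    gramMap D u v = inner ℝ (D u) (D v) := rfl

theorem contDiff_gramMap : ContDiff ℝ ∞ gramMap :=
  (ContinuousLinearMap.contDiff _).clm_comp (contDiff_const.clm_comp contDiff_id)

theorem injective_gramMap {D : ℝ × ℝ × ℝ →L[ℝ] C3} (hD : Function.Injective D) :
    Function.Injective (gramMap D) := by
  refine (injective_iff_map_eq_zero _).2 fun v hv => ?_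
  have h : inner ℝ (D v) (D v) = 0 := by rw [← gramMap_apply, hv]; rfl
  exact hD (by rw [inner_self_eq_zero.1 h, map_zero])

theorem exists_equiv_gramMap {D : ℝ × ℝ × ℝ →L[ℝ] C3} (hD : Function.Injective D) :
    ∃ e : (ℝ × ℝ × ℝ) ≃L[ℝ] (ℝ × ℝ × ℝ →L[ℝ] ℝ), (e : ℝ × ℝ × ℝ →L[ℝ] ℝ × ℝ × ℝ →L[ℝ] ℝ) = gramMap D := by
  have hfin : Module.finrank ℝ (ℝ × ℝ × ℝ) = Module.finrank ℝ ((ℝ × ℝ × ℝ) →L[ℝ] ℝ) := by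
    rw [← (LinearMap.toContinuousLinearMap (𝕜 := ℝ) (E := ℝ × ℝ × ℝ) (F' := ℝ)).finrank_eq]
    exact Subspace.dual_finrank_eq.symm
  refine ⟨(LinearMap.linearEquivOfInjective (gramMap D).toLinearMap
    (injective_gramMap hD) hfin).toContinuousLinearEquiv, ?_⟩
  refine ContinuousLinearMap.ext fun v => ?_
  exact LinearMap.linearEquivOfInjective_apply (f := (gramMap D).toLinearMap)
    (hf := injective_gramMap hD) (hdim := hfin) v

/-- The right hand side of the equation for the Christoffel symbols. -/
def christoffelForm (ι : ℝ × ℝ × ℝ → C3) (q : (ℝ × ℝ × ℝ) × (ℝ × ℝ × ℝ) × (ℝ × ℝ × ℝ)) :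
    ℝ × ℝ × ℝ →L[ℝ] ℝ :=
  (ContinuousLinearMap.compL ℝ (ℝ × ℝ × ℝ) C3 ℝ).flip (fderiv ℝ ι q.1)
    (realInner (fderiv ℝ (fderiv ℝ ι) q.1 q.2.1 q.2.2))

theorem christoffelForm_apply (hι : ContDiff ℝ ∞ ι) (y u v w : ℝ × ℝ × ℝ) :
    christoffelForm ι (y, u, v) w =
      inner ℝ (fderiv ℝ (fun p => fderiv ℝ ι p v) y u) (fderiv ℝ ι y w) := by
  rw [fderiv_fderiv_apply hι]
  rfl

theorem gramMap_christoffel (hι : ContDiff ℝ ∞ ι) {y : ℝ × ℝ × ℝ}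
    (hy : Function.Injective (fderiv ℝ ι y)) (u v : ℝ × ℝ × ℝ) :
    gramMap (fderiv ℝ ι y) (christoffel ι y u v) = christoffelForm ι (y, u, v) := by
  obtain ⟨e, he⟩ := exists_equiv_gramMap hy
  have hex : ∃ z : ℝ × ℝ × ℝ, ∀ w : ℝ × ℝ × ℝ, inner ℝ (fderiv ℝ ι y z) (fderiv ℝ ι y w) =
      inner ℝ (fderiv ℝ (fun p => fderiv ℝ ι p v) y u) (fderiv ℝ ι y w) := by
    refine ⟨e.symm (christoffelForm ι (y, u, v)), fun w => ?_⟩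
    rw [← gramMap_apply, ← he, ← christoffelForm_apply hι]
    simp
  refine ContinuousLinearMap.ext fun w => ?_
  rw [christoffelForm_apply hι]
  exact Classical.epsilon_spec hex w

theorem christoffel_eq_of (hι : ContDiff ℝ ∞ ι) {y : ℝ × ℝ × ℝ}
    (hy : Function.Injective (fderiv ℝ ι y)) {u v z : ℝ × ℝ × ℝ}
    (hz : ∀ w, inner ℝ (fderiv ℝ ι y z) (fderiv ℝ ι y w) =
      inner ℝ (fderiv ℝ (fun p => fderiv ℝ ι p v) y u) (fderiv ℝ ι y w)) :
    christoffel ι y u v = z := by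
  apply injective_gramMap hy
  rw [gramMap_christoffel hι hy]
  refine ContinuousLinearMap.ext fun w => ?_
  rw [christoffelForm_apply hι, ← hz]
  rfl

theorem inner_christoffel (hι : ContDiff ℝ ∞ ι) {y : ℝ × ℝ × ℝ}
    (hy : Function.Injective (fderiv ℝ ι y)) (u v w : ℝ × ℝ × ℝ) :
    inner ℝ (fderiv ℝ ι y (christoffel ι y u v)) (fderiv ℝ ι y w) =
      inner ℝ (fderiv ℝ (fun p => fderiv ℝ ι p v) y u) (fderiv ℝ ι y w) := by
  rw [← gramMap_apply, gramMap_christoffel hι hy, christoffelForm_apply hι]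

/-- Although defined by a choice operator, the symbols equal the inverse Gram map applied to a
smooth form wherever ι is an immersion. -/
theorem contDiffOn_christoffel (hι : ContDiff ℝ ∞ ι) {U : Set (ℝ × ℝ × ℝ)}
    (hU : ∀ y ∈ U, Function.Injective (fderiv ℝ ι y)) :
    ContDiffOn ℝ ∞ (fun q : (ℝ × ℝ × ℝ) × (ℝ × ℝ × ℝ) × (ℝ × ℝ × ℝ) =>
      christoffel ι q.1 q.2.1 q.2.2) {q | q.1 ∈ U} := by
  have hd : ContDiff ℝ ∞ (fderiv ℝ ι) := hι.fderiv_right (m := ∞) (by simp)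
  have hd2 : ContDiff ℝ ∞ (fderiv ℝ (fderiv ℝ ι)) := hd.fderiv_right (m := ∞) (by simp)
  have hform : ContDiff ℝ ∞ (christoffelForm ι) := by
    refine ContDiff.clm_apply ((ContinuousLinearMap.contDiff _).comp (hd.comp contDiff_fst)) ?_
    exact realInner.contDiff.comp (((hd2.comp contDiff_fst).clm_apply
      (contDiff_fst.comp contDiff_snd)).clm_apply (contDiff_snd.comp contDiff_snd))
  have key : ∀ q ∈ {q : (ℝ × ℝ × ℝ) × (ℝ × ℝ × ℝ) × (ℝ × ℝ × ℝ) | q.1 ∈ U},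
      christoffel ι q.1 q.2.1 q.2.2 =
        (gramMap (fderiv ℝ ι q.1)).inverse (christoffelForm ι q) := fun q hq => by
    obtain ⟨e, he⟩ := exists_equiv_gramMap (hU _ hq)
    have h1 := gramMap_christoffel hι (hU _ hq) q.2.1 q.2.2
    rw [← he] at h1
    rw [← he, ContinuousLinearMap.inverse_equiv, ← h1]
    simp
  refine ContDiffOn.congr (fun q hq => ContDiffAt.contDiffWithinAt ?_) key
  obtain ⟨e, he⟩ := exists_equiv_gramMap (hU _ hq)
  have h1 := contDiffAt_map_inverse (n := ∞) e
  rw [he] at h1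
  have h2 : ContDiffAt ℝ ∞ (fun q : (ℝ × ℝ × ℝ) × (ℝ × ℝ × ℝ) × (ℝ × ℝ × ℝ) =>
      (gramMap (fderiv ℝ ι q.1)).inverse) q :=
    ContDiffAt.comp (g := ContinuousLinearMap.inverse) q h1
      (contDiff_gramMap.comp (hd.comp contDiff_fst)).contDiffAt
  exact h2.clm_apply hform.contDiffAt

theorem christoffel_smul_smul (hι : ContDiff ℝ ∞ ι) {y : ℝ × ℝ × ℝ}
    (hy : Function.Injective (fderiv ℝ ι y)) (a b : ℝ) (u v : ℝ × ℝ × ℝ) :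
    christoffel ι y (a • u) (b • v) = (a * b) • christoffel ι y u v := by
  refine christoffel_eq_of hι hy fun w => ?_
  rw [map_smul, real_inner_smul_left, inner_christoffel hι hy, fderiv_fderiv_apply hι,
    fderiv_fderiv_apply hι, map_smul, map_smul, smul_apply, smul_smul, real_inner_smul_left,
    mul_comm b a]

theorem fderiv_comp_affine {F : Type*} [NormedAddCommGroup F] [NormedSpace ℝ F]
    (g : ℝ × ℝ × ℝ → F) (L : (ℝ × ℝ × ℝ) ≃L[ℝ] (ℝ × ℝ × ℝ)) (b y u : ℝ × ℝ × ℝ) :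
    fderiv ℝ (fun p => g (L p + b)) y u = fderiv ℝ g (L y + b) (L u) := by
  have h := L.comp_right_fderiv (f := fun z => g (z + b)) (x := y)
  rw [fderiv_comp_add_right] at h
  exact congrArg (fun M => M u) h

theorem fderiv_smul_field {F : Type*} [NormedAddCommGroup F] [NormedSpace ℝ F]
    (g : ℝ × ℝ × ℝ → F) (c : ℝ) (y u : ℝ × ℝ × ℝ) :
    fderiv ℝ (fun p => c • g p) y u = c • fderiv ℝ g y u := by
  have h := fderiv_const_smul_field (𝕜 := ℝ) (f := g) c
  exact congrArg (fun M => M y u) h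

section Homothety

variable {L : (ℝ × ℝ × ℝ) ≃L[ℝ] (ℝ × ℝ × ℝ)} {b : ℝ × ℝ × ℝ} {c : ℝ}

theorem fderiv_homothety (hT : ∀ p, ι (L p + b) = c • ι p) (y u : ℝ × ℝ × ℝ) :
    fderiv ℝ ι (L y + b) (L u) = c • fderiv ℝ ι y u := by
  rw [← fderiv_comp_affine, funext hT, fderiv_smul_field]

/-- The induced metric is only rescaled by the constant c², which cancels in the defining equation,
so the affine map preserves the connection. -/
theorem christoffel_homothety (hι : ContDiff ℝ ∞ ι) (hc : c ≠ 0)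
    (hT : ∀ p, ι (L p + b) = c • ι p) {y : ℝ × ℝ × ℝ}
    (hy : Function.Injective (fderiv ℝ ι y)) (u v : ℝ × ℝ × ℝ) :
    christoffel ι (L y + b) (L u) (L v) = L (christoffel ι y u v) := by
  have hy' : Function.Injective (fderiv ℝ ι (L y + b)) := fun p q h => by
    have h1 := fderiv_homothety hT y (L.symm p)
    have h2 := fderiv_homothety hT y (L.symm q)
    simp only [L.apply_symm_apply] at h1 h2
    rw [h1, h2] at h
    exact L.symm.injective (hy (smul_right_injective _ hc h))
  refine christoffel_eq_of hι hy' fun w => ?_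
  obtain ⟨w, rfl⟩ := L.surjective w
  have h2 : fderiv ℝ (fun p => fderiv ℝ ι p (L v)) (L y + b) (L u) =
      c • fderiv ℝ (fun p => fderiv ℝ ι p v) y u := by
    rw [← fderiv_comp_affine, funext fun p => fderiv_homothety hT p v, fderiv_smul_field]
  rw [h2, fderiv_homothety hT, fderiv_homothety hT]
  simp only [real_inner_smul_left, real_inner_smul_right]
  rw [inner_christoffel hι hy]

end Homothety

section Nabla

variable {U : Set (ℝ × ℝ × ℝ)}

theorem nabla_congr (hUo : IsOpen U) {f g : ℝ × ℝ × ℝ → C3} (h : Set.EqOn f g U) (k : ℕ) :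
    ∀ y ∈ U, ∀ v, nabla ι f k y v = nabla ι g k y v := by
  induction k with
  | zero => exact fun y hy v => h hy
  | succ k ih =>
    intro y hy v
    have h1 : (fun p => nabla ι f k p (Fin.tail v)) =ᶠ[nhds y]
        fun p => nabla ι g k p (Fin.tail v) := by
      filter_upwards [hUo.mem_nhds hy] with p hp using ih p hp _
    simp only [nabla]
    rw [h1.fderiv_eq]
    simp only [ih y hy]

theorem nabla_const_smul (c : ℝ) (f : ℝ × ℝ × ℝ → C3) (k : ℕ) :
    ∀ y v, nabla ι (fun p => c • f p) k y v = c • nabla ι f k y v := by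
  induction k with
  | zero => exact fun y v => rfl
  | succ k ih =>
    intro y v
    simp only [nabla, ih]
    rw [fderiv_smul_field, smul_sub, Finset.smul_sum]

theorem nabla_homothety (hι : ContDiff ℝ ∞ ι) {L : (ℝ × ℝ × ℝ) ≃L[ℝ] (ℝ × ℝ × ℝ)}
    {b : ℝ × ℝ × ℝ} {c : ℝ} (hc : c ≠ 0) (hT : ∀ p, ι (L p + b) = c • ι p) (hUo : IsOpen U)
    (hU : ∀ y ∈ U, Function.Injective (fderiv ℝ ι y)) (f : ℝ × ℝ × ℝ → C3) (k : ℕ) :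
    ∀ y ∈ U, ∀ v : Fin k → ℝ × ℝ × ℝ, nabla ι f k (L y + b) (fun i => L (v i)) =
      nabla ι (fun p => f (L p + b)) k y v := by
  induction k with
  | zero => exact fun y hy v => rfl
  | succ k ih =>
    intro y hy v
    have htail : Fin.tail (fun i => L (v i)) = fun i => L (Fin.tail v i) := rfl
    simp only [nabla]
    rw [htail]
    congr 1
    · rw [← fderiv_comp_affine]
      have h1 : (fun p => nabla ι f k (L p + b) fun i => L (Fin.tail v i)) =ᶠ[nhds y]
          fun p => nabla ι (fun p => f (L p + b)) k p (Fin.tail v) := by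
        filter_upwards [hUo.mem_nhds hy] with p hp using ih p hp _
      rw [h1.fderiv_eq]
    · refine Finset.sum_congr rfl fun i _ => ?_
      rw [christoffel_homothety hι hc hT (hU y hy), ← ih y hy]
      congr 1
      funext j
      by_cases hj : j = i
      · subst hj; simp
      · simp [hj]

/-- The part of multilinearity needed to normalize the vectors v i to the compact unit ball. -/
theorem nabla_smul_apply (hι : ContDiff ℝ ∞ ι) (hUo : IsOpen U)
    (hU : ∀ y ∈ U, Function.Injective (fderiv ℝ ι y)) (f : ℝ × ℝ × ℝ → C3) (k : ℕ) :
    ∀ y ∈ U, ∀ (c : Fin k → ℝ) (v : Fin k → ℝ × ℝ × ℝ), nabla ι f k y (fun i => c i • v i) =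
      (∏ i, c i) • nabla ι f k y v := by
  induction k with
  | zero => exact fun y hy c v => by simp [nabla]
  | succ k ih =>
    intro y hy c v
    have htail : Fin.tail (fun i => c i • v i) = fun i => Fin.tail c i • Fin.tail v i := rfl
    simp only [nabla]
    rw [htail, Fin.prod_univ_succ]
    have h1 : (fun p => nabla ι f k p fun i => Fin.tail c i • Fin.tail v i) =ᶠ[nhds y]
        fun p => (∏ i, Fin.tail c i) • nabla ι f k p (Fin.tail v) := by
      filter_upwards [hUo.mem_nhds hy] with p hp using ih p hp _ _
    rw [h1.fderiv_eq, fderiv_smul_field, map_smul, smul_smul, smul_sub, Finset.smul_sum]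
    congr 1
    · rw [mul_comm]; rfl
    · refine Finset.sum_congr rfl fun i _ => ?_
      rw [christoffel_smul_smul hι (hU y hy)]
      have h2 : Function.update (fun i => Fin.tail c i • Fin.tail v i) i
          ((c 0 * Fin.tail c i) • christoffel ι y (v 0) (Fin.tail v i)) =
          fun j => Function.update (Fin.tail c) i (c 0 * Fin.tail c i) j •
            Function.update (Fin.tail v) i (christoffel ι y (v 0) (Fin.tail v i)) j := by
        funext j
        by_cases hj : j = i
        · subst hj; simp
        · simp [hj]
      rw [h2, ih y hy]
      congr 1
      rw [Finset.prod_update_of_mem (Finset.mem_univ i), mul_assoc,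
        ← Finset.erase_eq, Finset.mul_prod_erase _ _ (Finset.mem_univ i)]
      rfl

/-- Smoothness is claimed jointly in the parameter, the point and the vectors, so that compactness
bounds ∇ᵏ uniformly in the parameter, later 1/r. -/
theorem contDiffOn_nabla (hι : ContDiff ℝ ∞ ι) (hUo : IsOpen U)
    (hU : ∀ y ∈ U, Function.Injective (fderiv ℝ ι y)) {Q : ℝ × ℝ × ℝ × ℝ → C3}
    (hQ : ContDiffOn ℝ ∞ Q {m | m.2 ∈ U}) (k : ℕ) :
    ContDiffOn ℝ ∞ (fun m : ℝ × (ℝ × ℝ × ℝ) × (Fin k → ℝ × ℝ × ℝ) =>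
      nabla ι (fun p => Q (m.1, p)) k m.2.1 m.2.2) {m | m.2.1 ∈ U} := by
  induction k with
  | zero =>
    have h0 : ContDiff ℝ ∞ fun m : ℝ × (ℝ × ℝ × ℝ) × (Fin 0 → ℝ × ℝ × ℝ) => (m.1, m.2.1) :=
      contDiff_fst.prodMk (contDiff_fst.comp contDiff_snd)
    exact hQ.comp h0.contDiffOn (fun m hm => hm)
  | succ k ih =>
    have hopen : ∀ j : ℕ, IsOpen {m : ℝ × (ℝ × ℝ × ℝ) × (Fin j → ℝ × ℝ × ℝ) | m.2.1 ∈ U} :=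
      fun j => hUo.preimage (continuous_fst.comp continuous_snd)
    have hv : ∀ i, ContDiff ℝ ∞ fun m : ℝ × (ℝ × ℝ × ℝ) × (Fin (k + 1) → ℝ × ℝ × ℝ) =>
        m.2.2 i := fun i => (contDiff_apply ℝ _ i).comp (contDiff_snd.comp contDiff_snd)
    have ha : ContDiff ℝ ∞ fun m : ℝ × (ℝ × ℝ × ℝ) × (Fin (k + 1) → ℝ × ℝ × ℝ) =>
        (m.1, m.2.1, Fin.tail m.2.2) :=
      contDiff_fst.prodMk ((contDiff_fst.comp contDiff_snd).prodMk
        (contDiff_pi.2 fun i => hv i.succ))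
    set S := fun m : ℝ × (ℝ × ℝ × ℝ) × (Fin k → ℝ × ℝ × ℝ) =>
      nabla ι (fun p => Q (m.1, p)) k m.2.1 m.2.2 with hS
    have hdS := ih.fderiv_of_isOpen (hopen k) (m := ∞) (by simp)
    have h1 : ContDiffOn ℝ ∞ (fun m : ℝ × (ℝ × ℝ × ℝ) × (Fin (k + 1) → ℝ × ℝ × ℝ) =>
        fderiv ℝ S (m.1, m.2.1, Fin.tail m.2.2) (0, m.2.2 0, 0)) {m | m.2.1 ∈ U} :=
      (hdS.comp ha.contDiffOn fun m hm => hm).clm_apply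
        (contDiff_const.prodMk ((hv 0).prodMk contDiff_const)).contDiffOn
    have hΓ : ∀ i : Fin k, ContDiffOn ℝ ∞
        (fun m : ℝ × (ℝ × ℝ × ℝ) × (Fin (k + 1) → ℝ × ℝ × ℝ) =>
          christoffel ι m.2.1 (m.2.2 0) (Fin.tail m.2.2 i)) {m | m.2.1 ∈ U} := fun i => by
      have hq : ContDiff ℝ ∞ fun m : ℝ × (ℝ × ℝ × ℝ) × (Fin (k + 1) → ℝ × ℝ × ℝ) =>
          (m.2.1, m.2.2 0, Fin.tail m.2.2 i) :=
        (contDiff_fst.comp contDiff_snd).prodMk ((hv 0).prodMk (hv i.succ))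
      have hm : Set.MapsTo (fun m : ℝ × (ℝ × ℝ × ℝ) × (Fin (k + 1) → ℝ × ℝ × ℝ) =>
          (m.2.1, m.2.2 0, Fin.tail m.2.2 i)) {m | m.2.1 ∈ U} {q | q.1 ∈ U} := by
        intro m hm
        exact hm
      have h := (contDiffOn_christoffel hι hU).comp hq.contDiffOn hm
      simpa only [Function.comp_def] using h
    have hup : ∀ i : Fin k, ContDiffOn ℝ ∞
        (fun m : ℝ × (ℝ × ℝ × ℝ) × (Fin (k + 1) → ℝ × ℝ × ℝ) =>
          Function.update (Fin.tail m.2.2) i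
            (christoffel ι m.2.1 (m.2.2 0) (Fin.tail m.2.2 i))) {m | m.2.1 ∈ U} := fun i => by
      refine contDiffOn_pi.2 fun j => ?_
      by_cases hj : j = i
      · subst hj
        simp only [Function.update_self]
        exact hΓ j
      · simp only [Function.update_of_ne hj]
        exact (hv j.succ).contDiffOn
    have h2 : ∀ i : Fin k, ContDiffOn ℝ ∞
        (fun m : ℝ × (ℝ × ℝ × ℝ) × (Fin (k + 1) → ℝ × ℝ × ℝ) =>
          S (m.1, m.2.1, Function.update (Fin.tail m.2.2) i
            (christoffel ι m.2.1 (m.2.2 0) (Fin.tail m.2.2 i)))) {m | m.2.1 ∈ U} := fun i => by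
      exact ContDiffOn.comp (g := S) ih (contDiff_fst.contDiffOn.prodMk
        ((contDiff_fst.comp contDiff_snd).contDiffOn.prodMk (hup i))) (fun m hm => hm)
    refine (h1.sub (ContDiffOn.sum (s := Finset.univ) fun i _ => h2 i)).congr fun m hm => ?_
    simp only [nabla]
    congr 1
    have h3 : HasFDerivAt S (fderiv ℝ S (m.1, m.2.1, Fin.tail m.2.2))
        (m.1, m.2.1, Fin.tail m.2.2) :=
      ((ih.contDiffAt ((hopen k).mem_nhds hm)).differentiableAt (by simp)).hasFDerivAt
    have h4 := (hasFDerivAt_const (𝕜 := ℝ) m.1 m.2.1).prodMk ((hasFDerivAt_id (𝕜 := ℝ) m.2.1).prodMk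
        (hasFDerivAt_const (𝕜 := ℝ) (Fin.tail m.2.2) m.2.1))
    have h5 := (h3.comp m.2.1 h4).fderiv
    have h6 := congrArg (fun M => M (m.2.2 0)) h5
    exact h6

/-- Uniform bound for the covariant derivatives of a smooth family over a compact set. -/
theorem exists_nabla_bound (hι : ContDiff ℝ ∞ ι) (hUo : IsOpen U)
    (hU : ∀ y ∈ U, Function.Injective (fderiv ℝ ι y)) {Q : ℝ × ℝ × ℝ × ℝ → C3}
    (hQ : ContDiffOn ℝ ∞ Q {m | m.2 ∈ U}) {I : Set ℝ} (hI : IsCompact I)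
    {C : Set (ℝ × ℝ × ℝ)} (hC : IsCompact C) (hCU : C ⊆ U) (k : ℕ) :
    ∃ M : ℝ, 0 ≤ M ∧ ∀ μ ∈ I, ∀ y ∈ C, ∀ v : Fin k → ℝ × ℝ × ℝ,
      ‖nabla ι (fun p => Q (μ, p)) k y v‖ ≤ M * ∏ i, ‖v i‖ := by
  have hc := (contDiffOn_nabla hι hUo hU hQ k).continuousOn
  obtain ⟨M, hM⟩ := (hI.prod (hC.prod (isCompact_closedBall (0 : Fin k → ℝ × ℝ × ℝ) 1))
    ).exists_bound_of_continuousOn (hc.mono fun m hm => hCU hm.2.1)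
  refine ⟨max M 0, le_max_right _ _, fun μ hμ y hy v => ?_⟩
  have h1 : v = fun i => ‖v i‖ • (‖v i‖⁻¹ • v i) := by
    funext i
    by_cases hi : v i = 0
    · simp [hi]
    · rw [smul_smul, mul_inv_cancel₀ (norm_ne_zero_iff.2 hi), one_smul]
  have h2 : (fun i => ‖v i‖⁻¹ • v i) ∈ Metric.closedBall (0 : Fin k → ℝ × ℝ × ℝ) 1 := by
    rw [mem_closedBall_zero_iff, pi_norm_le_iff_of_nonneg zero_le_one]
    intro i
    rw [norm_smul, norm_inv, norm_norm]
    exact inv_mul_le_one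
  have h3 : ‖nabla ι (fun p => Q (μ, p)) k y fun i => ‖v i‖⁻¹ • v i‖ ≤ M :=
    hM (μ, y, _) ⟨hμ, hy, h2⟩
  have hp : 0 ≤ ∏ i, ‖v i‖ := Finset.prod_nonneg fun i _ => norm_nonneg _
  nth_rewrite 1 [h1]
  rw [nabla_smul_apply hι hUo hU _ k y (hCU hy), norm_smul, Real.norm_of_nonneg hp, mul_comm]
  exact mul_le_mul_of_nonneg_right (h3.trans (le_max_left _ _)) hp

end Nabla

end CovariantDerivatives

/-! ### Hadamard's lemma -/

noncomputable section Hadamard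

open intervalIntegral

variable {M : Type} [NormedAddCommGroup M] [NormedSpace ℝ M] [FiniteDimensional ℝ M]

/-- Differentiation under the integral sign on `[0, 1]`. -/
theorem hasFDerivAt_integral_unit {F : Type} [NormedAddCommGroup F] [NormedSpace ℝ F]
    [CompleteSpace F] {f : M × ℝ → F} (hf : ContDiff ℝ 1 f) (x : M) :
    HasFDerivAt (fun x => ∫ t in (0 : ℝ)..1, f (x, t))
      (∫ t in (0 : ℝ)..1, (fderiv ℝ f (x, t)).comp (ContinuousLinearMap.inl ℝ M ℝ)) x := by
  have hd : Continuous fun q : M × ℝ => (fderiv ℝ f q).comp (ContinuousLinearMap.inl ℝ M ℝ) :=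
    (hf.continuous_fderiv one_ne_zero).clm_comp continuous_const
  obtain ⟨C, hC⟩ := ((isCompact_closedBall x 1).prod
    (isCompact_uIcc (a := (0 : ℝ)) (b := 1))).exists_bound_of_continuousOn hd.continuousOn
  refine hasFDerivAt_integral_of_dominated_of_fderiv_le (bound := fun _ => C)
    (F' := fun x t => (fderiv ℝ f (x, t)).comp (ContinuousLinearMap.inl ℝ M ℝ))
    (Metric.closedBall_mem_nhds x one_pos) ?_ ?_ ?_ ?_ ?_ ?_
  · exact Filter.Eventually.of_forall fun y =>
      (hf.continuous.comp (by fun_prop : Continuous fun t : ℝ => (y, t))).aestronglyMeasurable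
  · exact (hf.continuous.comp (by fun_prop : Continuous fun t : ℝ => (x, t))).intervalIntegrable _ _
  · exact (hd.comp (by fun_prop : Continuous fun t : ℝ => (x, t))).aestronglyMeasurable
  · refine Filter.Eventually.of_forall fun t ht y hy => hC (y, t) ⟨hy, ?_⟩
    exact Set.uIoc_subset_uIcc ht
  · exact intervalIntegrable_const
  · refine Filter.Eventually.of_forall fun t _ y _ => ?_
    have h1 : HasFDerivAt f (fderiv ℝ f (y, t)) (y, t) :=
      (hf.differentiable one_ne_zero (y, t)).hasFDerivAt
    exact h1.comp y (hasFDerivAt_prodMk_left y t)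

theorem contDiff_integral_unit (n : ℕ) : ∀ {F : Type} [NormedAddCommGroup F] [NormedSpace ℝ F]
    [CompleteSpace F] {f : M × ℝ → F}, ContDiff ℝ n f →
    ContDiff ℝ n fun x => ∫ t in (0 : ℝ)..1, f (x, t) := by
  induction n with
  | zero =>
    intro F _ _ _ f hf
    refine contDiff_zero.2 ?_
    exact intervalIntegral.continuous_parametric_intervalIntegral_of_continuous'
      (show Continuous (Function.uncurry fun (x : M) (t : ℝ) => f (x, t)) from hf.continuous) 0 1
  | succ n ih =>
    intro F _ _ _ f hf
    have hf1 : ContDiff ℝ 1 f := hf.of_le (by norm_cast; omega)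
    have hfd : ContDiff ℝ n fun q : M × ℝ =>
        (fderiv ℝ f q).comp (ContinuousLinearMap.inl ℝ M ℝ) :=
      (hf.fderiv_right (m := n) (by norm_cast)).clm_comp contDiff_const
    refine contDiff_succ_iff_hasFDerivAt.2 ?_
    exact ⟨_, ih hfd, hasFDerivAt_integral_unit hf1⟩

/-- Hadamard's lemma with parameters. -/
theorem exists_smul_eq_of_zero {F : Type} [NormedAddCommGroup F] [NormedSpace ℝ F]
    [CompleteSpace F] {g : ℝ × M → F} (hg : ContDiff ℝ ∞ g) (h0 : ∀ x, g (0, x) = 0) :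
    ∃ g' : ℝ × M → F, ContDiff ℝ ∞ g' ∧ (∀ s x, g (s, x) = s • g' (s, x)) ∧
      ∀ x, g' (0, x) = fderiv ℝ g (0, x) (1, 0) := by
  have hd : ContDiff ℝ ∞ fun q : (ℝ × M) × ℝ => fderiv ℝ g (q.2 * q.1.1, q.1.2) (1, 0) := by
    refine ((hg.fderiv_right (m := ∞) (by simp)).comp ?_).clm_apply contDiff_const
    exact (contDiff_snd.mul (contDiff_fst.comp contDiff_fst)).prodMk
      (contDiff_snd.comp contDiff_fst)
  refine ⟨fun p => ∫ t in (0 : ℝ)..1, fderiv ℝ g (t * p.1, p.2) (1, 0), ?_, ?_, ?_⟩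
  · exact contDiff_infty.2 fun n => contDiff_integral_unit n
      (f := fun q : (ℝ × M) × ℝ => fderiv ℝ g (q.2 * q.1.1, q.1.2) (1, 0))
      (hd.of_le (by exact_mod_cast le_top))
  · intro s x
    have h1 : ∀ t : ℝ, HasDerivAt (fun t : ℝ => g (t * s, x))
        (s • fderiv ℝ g (t * s, x) (1, 0)) t := fun t => by
      have h2 : HasDerivAt (fun t : ℝ => (t * s, x)) (s, 0) t :=
        (hasDerivAt_mul_const s).prodMk (hasDerivAt_const t x)
      have h3 := ((hg.differentiable (by simp) (t * s, x)).hasFDerivAt).comp_hasDerivAt t h2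
      rwa [show ((s, 0) : ℝ × M) = s • (1, 0) by ext <;> simp, map_smul] at h3
    have hc : Continuous fun t : ℝ => fderiv ℝ g (t * s, x) (1, 0) :=
      hd.continuous.comp (by fun_prop : Continuous fun t : ℝ => (((s, x), t) : (ℝ × M) × ℝ))
    have h4 := intervalIntegral.integral_eq_sub_of_hasDerivAt (a := 0) (b := 1)
      (fun t _ => h1 t) ((hc.const_smul s).intervalIntegrable _ _)
    rw [intervalIntegral.integral_smul] at h4
    simp only [one_mul, zero_mul, h0, sub_zero] at h4
    exact h4.symm
  · intro x
    simp

/-- Hadamard's lemma twice: the first quotient equals the s-derivative of g at s = 0, so it vanishes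
there as well. -/
theorem exists_sq_smul_eq_of_zero {F : Type} [NormedAddCommGroup F] [NormedSpace ℝ F]
    [CompleteSpace F] {g : ℝ × M → F} (hg : ContDiff ℝ ∞ g) (h0 : ∀ x, g (0, x) = 0)
    (h1 : ∀ x, fderiv ℝ g (0, x) (1, 0) = 0) :
    ∃ g' : ℝ × M → F, ContDiff ℝ ∞ g' ∧ ∀ s x, g (s, x) = s ^ 2 • g' (s, x) := by
  obtain ⟨g₁, hs₁, he₁, hz₁⟩ := exists_smul_eq_of_zero hg h0
  obtain ⟨g₂, hs₂, he₂, -⟩ := exists_smul_eq_of_zero hs₁ fun x => by rw [hz₁, h1]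
  exact ⟨g₂, hs₂, fun s x => by rw [he₁, he₂, smul_smul, sq]⟩

end Hadamard

/-! ### The diffeomorphism between the ends of the cone and of its translate -/

noncomputable section ConeEnd

open scoped NNReal

theorem exists_mem_Icc_two (x : ℝ × ℝ) : ∃ (m n : ℤ) (x₀ : ℝ × ℝ),
    x₀ ∈ Set.Icc (0 : ℝ) 2 ×ˢ Set.Icc (0 : ℝ) 1 ∧ x = (x₀.1 + 2 * m, x₀.2 + n) := by
  refine ⟨⌊x.1 / 2⌋, ⌊x.2⌋, (x.1 - 2 * ⌊x.1 / 2⌋, x.2 - ⌊x.2⌋), ?_, by ext <;> simp⟩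
  have h1 := Int.floor_le (x.1 / 2)
  have h2 := Int.lt_floor_add_one (x.1 / 2)
  have h3 := Int.floor_le x.2
  have h4 := Int.lt_floor_add_one x.2
  refine ⟨⟨?_, ?_⟩, ⟨?_, ?_⟩⟩ <;> simp only <;> linarith

theorem isCompact_fundamentalRectangle :
    IsCompact (Set.Icc (0 : ℝ) 2 ×ˢ Set.Icc (0 : ℝ) 1) := isCompact_Icc.prod isCompact_Icc

theorem exists_norm_le_of_periodic {F : Type*} [NormedAddCommGroup F] {g : ℝ × ℝ → F}
    (hg : Continuous g) (hp : ∀ (m n : ℤ) x, g (x.1 + 2 * m, x.2 + n) = g x) :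
    ∃ C, ∀ x, ‖g x‖ ≤ C := by
  obtain ⟨C, hC⟩ := isCompact_fundamentalRectangle.exists_bound_of_continuousOn hg.continuousOn
  refine ⟨C, fun x => ?_⟩
  obtain ⟨m, n, x₀, hx₀, rfl⟩ := exists_mem_Icc_two x
  rw [hp]
  exact hC _ hx₀

theorem fderiv_periodic_two {F : Type*} [NormedAddCommGroup F] [NormedSpace ℝ F] {g : ℝ × ℝ → F}
    (hp : ∀ (m n : ℤ) x, g (x.1 + 2 * m, x.2 + n) = g x) (m n : ℤ) (x : ℝ × ℝ) :
    fderiv ℝ g (x.1 + 2 * m, x.2 + n) = fderiv ℝ g x := by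
  have h : (fun y : ℝ × ℝ => g (y + (2 * (m : ℝ), (n : ℝ)))) = g := funext fun y => hp m n y
  have h2 := fderiv_comp_add_right (𝕜 := ℝ) (f := g) (x := x) (2 * (m : ℝ), (n : ℝ))
  rw [h] at h2
  exact h2.symm

theorem exists_lipschitz_of_periodic {w : ℝ × ℝ → ℝ × ℝ} (hw : ContDiff ℝ ∞ w)
    (hp : ∀ (m n : ℤ) x, w (x.1 + 2 * m, x.2 + n) = w x) :
    ∃ K : ℝ≥0, (∀ x, ‖fderiv ℝ w x‖ ≤ K) ∧ LipschitzWith K w := by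
  obtain ⟨C, hC⟩ := exists_norm_le_of_periodic (hw.continuous_fderiv (by simp))
    (fderiv_periodic_two hp)
  have h0 : 0 ≤ C := (norm_nonneg _).trans (hC 0)
  exact ⟨⟨C, h0⟩, hC, lipschitzWith_of_nnnorm_fderiv_le (hw.differentiable (by simp))
    fun x => hC x⟩

/-- The map `(r, x) ↦ (r, x - r⁻¹ w x)` from the end of a cone. -/
def endMap (w : ℝ × ℝ → ℝ × ℝ) (y : ℝ × ℝ × ℝ) : ℝ × ℝ × ℝ := (y.1, y.2 - y.1⁻¹ • w y.2)

theorem contDiffOn_endMap {w : ℝ × ℝ → ℝ × ℝ} (hw : ContDiff ℝ ∞ w) :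
    ContDiffOn ℝ ∞ (endMap w) {y | y.1 ≠ 0} := by
  have h1 : ContDiffOn ℝ ∞ (fun y : ℝ × ℝ × ℝ => y.1⁻¹) {y | y.1 ≠ 0} :=
    contDiff_fst.contDiffOn.inv fun y hy => hy
  exact contDiff_fst.contDiffOn.prodMk (contDiff_snd.contDiffOn.sub
    (h1.smul (hw.comp contDiff_snd).contDiffOn))

section Contraction

variable {w : ℝ × ℝ → ℝ × ℝ} {K : ℝ≥0}

theorem fderiv_endMap (hw : ContDiff ℝ ∞ w) {y : ℝ × ℝ × ℝ} (hy : y.1 ≠ 0) (v : ℝ × ℝ × ℝ) :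
    fderiv ℝ (endMap w) y v =
      (v.1, v.2 - (y.1⁻¹ • fderiv ℝ w y.2 v.2 + (-v.1 / y.1 ^ 2) • w y.2)) := by
  have h1 : HasFDerivAt (fun y : ℝ × ℝ × ℝ => y.1⁻¹) _ y :=
    (hasDerivAt_inv hy).comp_hasFDerivAt y (hasFDerivAt_fst (𝕜 := ℝ) (p := y))
  have h2 : HasFDerivAt (fun y : ℝ × ℝ × ℝ => w y.2) _ y :=
    ((hw.differentiable (by simp) y.2).hasFDerivAt).comp y hasFDerivAt_snd
  have h3 : HasFDerivAt (endMap w) _ y :=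
    (hasFDerivAt_fst (p := y)).prodMk ((hasFDerivAt_snd (p := y)).sub (h1.smul h2))
  rw [h3.fderiv]
  ext <;> simp <;> ring

/-- For |r| > K the map x ↦ w(x)/r has derivative of norm less than 1, so at fixed r the derivative
is a small perturbation of the identity. -/
theorem bijective_fderiv_endMap (hw : ContDiff ℝ ∞ w) (hK : ∀ x, ‖fderiv ℝ w x‖ ≤ K)
    {y : ℝ × ℝ × ℝ} (hy : K < |y.1|) : Function.Bijective (fderiv ℝ (endMap w) y) := by
  have hpos : 0 < |y.1| := K.2.trans_lt hy
  have hy0 : y.1 ≠ 0 := abs_pos.1 hpos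
  have hinj : Function.Injective (fderiv ℝ (endMap w) y) := by
    refine (injective_iff_map_eq_zero _).2 fun v hv => ?_
    rw [fderiv_endMap hw hy0] at hv
    have hv1 : v.1 = 0 := congrArg Prod.fst hv
    have hv2 : v.2 - (y.1⁻¹ • fderiv ℝ w y.2 v.2 + (-v.1 / y.1 ^ 2) • w y.2) = 0 :=
      congrArg Prod.snd hv
    rw [hv1, neg_zero, zero_div, zero_smul, add_zero, sub_eq_zero] at hv2
    have h1 : |y.1| * ‖v.2‖ ≤ K * ‖v.2‖ := by
      have h2 : y.1 • v.2 = fderiv ℝ w y.2 v.2 := by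
        nth_rewrite 1 [hv2]
        rw [smul_smul, mul_inv_cancel₀ hy0, one_smul]
      calc |y.1| * ‖v.2‖ = ‖y.1 • v.2‖ := by rw [norm_smul, Real.norm_eq_abs]
        _ = ‖fderiv ℝ w y.2 v.2‖ := by rw [h2]
        _ ≤ K * ‖v.2‖ := (fderiv ℝ w y.2).le_of_opNorm_le (hK _) _
    have h3 : ‖v.2‖ = 0 := by
      by_contra h
      have h4 : 0 < ‖v.2‖ := lt_of_le_of_ne (norm_nonneg _) (Ne.symm h)
      nlinarith
    exact Prod.ext hv1 (norm_eq_zero.1 h3)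
  exact ⟨hinj, (LinearMap.injective_iff_surjective
    (f := (fderiv ℝ (endMap w) y).toLinearMap)).1 hinj⟩

theorem endMap_injective (hL : LipschitzWith K w) {y y' : ℝ × ℝ × ℝ} (hy : K < |y.1|)
    (h : endMap w y = endMap w y') : y = y' := by
  have hpos : 0 < |y.1| := K.2.trans_lt hy
  have h1 : y.1 = y'.1 := show (endMap w y).1 = (endMap w y').1 from congrArg Prod.fst h
  have h2 : y.2 - y.1⁻¹ • w y.2 = y'.2 - y'.1⁻¹ • w y'.2 :=
    show (endMap w y).2 = (endMap w y').2 from congrArg Prod.snd h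
  rw [← h1] at h2
  have h3 : y.1 • (y.2 - y'.2) = w y.2 - w y'.2 := by
    have h4 : y.2 - y'.2 = y.1⁻¹ • (w y.2 - w y'.2) := by
      rw [smul_sub, sub_eq_sub_iff_sub_eq_sub]
      rw [sub_eq_sub_iff_add_eq_add] at h2 ⊢
      rw [h2]
    rw [h4, smul_smul, mul_inv_cancel₀ (abs_pos.1 hpos), one_smul]
  have h5 := hL.norm_sub_le y.2 y'.2
  rw [← h3, norm_smul, Real.norm_eq_abs] at h5
  have h6 : ‖y.2 - y'.2‖ = 0 := by
    by_contra h
    have h4 : 0 < ‖y.2 - y'.2‖ := lt_of_le_of_ne (norm_nonneg _) (Ne.symm h)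
    nlinarith
  exact Prod.ext h1 (sub_eq_zero.1 (norm_eq_zero.1 h6))

/-- A preimage is a fixed point of the contraction x ↦ y.2 + w(x)/r. -/
theorem exists_endMap_eq (hL : LipschitzWith K w) {y : ℝ × ℝ × ℝ} (hy : K < |y.1|) :
    ∃ x, endMap w (y.1, x) = y := by
  have hpos : 0 < |y.1| := K.2.trans_lt hy
  have hc : ContractingWith (‖y.1⁻¹‖₊ * K) fun x => y.2 + y.1⁻¹ • w x := by
    refine ⟨?_, LipschitzWith.of_dist_le_mul fun a b => ?_⟩
    · rw [← NNReal.coe_lt_coe]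
      push_cast
      rw [norm_inv, Real.norm_eq_abs, inv_mul_lt_iff₀ hpos, mul_one]
      exact hy
    · rw [dist_add_left, dist_smul₀, NNReal.coe_mul, mul_assoc]
      exact mul_le_mul_of_nonneg_left (hL.dist_le_mul a b) (norm_nonneg _)
  refine ⟨hc.fixedPoint, Prod.ext rfl ?_⟩
  have h := hc.fixedPoint_isFixedPt
  change y.2 + y.1⁻¹ • w _ = _ at h
  exact sub_eq_of_eq_add h.symm

end Contraction

namespace RuledThreefold

variable {N : RuledThreefold}

theorem dir_periodic (hcone : N.IsTwoSidedCone) (hSL : N.IsSpecialLagrangian) (m n : ℤ)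
    (x : ℝ × ℝ) : N.dir (x.1 + 2 * m, x.2 + n) = N.dir x := by
  rw [← deck_two_mul, dir_deck_eq hcone hSL, deckSign_two_mul, one_smul]

theorem field_periodic (hcone : N.IsTwoSidedCone) (hSL : N.IsSpecialLagrangian)
    (w : N.antiInvariantFields N.rot) (m n : ℤ) (x : ℝ × ℝ) :
    (w : ℝ × ℝ → ℝ × ℝ) (x.1 + 2 * m, x.2 + n) = (w : ℝ × ℝ → ℝ × ℝ) x := by
  rw [← deck_two_mul, ((mem_antiInvariantFields_iff hcone hSL).1 w.2).2.2, deckSign_two_mul,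
    one_smul, deckLin_two_mul]

theorem norm_imm_of_cone (hcone : N.IsTwoSidedCone) (y : ℝ × ℝ × ℝ) : ‖N.imm y‖ = |y.1| := by
  rw [imm, hcone.1, add_zero, norm_smul, N.norm_dir, mul_one, Real.norm_eq_abs]

/-- Identifies the fibres of the universal covering of the 3-manifold with orbits of the deck group,
acting on the line parameter by `deckSign`. It applies to the cone and to its translates alike. -/
theorem point_eq_point_iff {N' : RuledThreefold}
    (h : ∀ m n x, N'.dir (deck m n x) = deckSign m • N'.dir x) (y y' : ℝ × ℝ × ℝ) :
    N'.point y = N'.point y' ↔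
      ∃ m n : ℤ, y' = (deckSign m * y.1, deck m n y.2) := by
  have himm : ∀ m n, N'.imm (deckSign m * y.1, deck m n y.2) = N'.imm y := fun m n => by
    simp only [imm]
    rw [h, N'.foot_deck, smul_smul, mul_right_comm, deckSign_mul_self, one_mul]
  constructor
  · intro hp
    have h1 : kleinMk y.2 = kleinMk y'.2 := congrArg Prod.fst hp
    have h2 : N'.imm y = N'.imm y' := congrArg Prod.snd hp
    obtain ⟨m, n, hmn⟩ := kleinMk_eq_iff.1 h1
    refine ⟨m, n, Prod.ext ?_ hmn.symm⟩
    rw [← himm m n] at h2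
    simp only [imm] at h2
    rw [hmn, add_left_inj] at h2
    have hne : N'.dir y'.2 ≠ 0 := fun h0 => by simpa [h0] using N'.norm_dir y'.2
    exact (smul_left_injective ℝ hne h2).symm
  · rintro ⟨m, n, rfl⟩
    exact Prod.ext (kleinMk_deck m n y.2).symm (himm m n).symm

/-- Both w and r pick up the sign of the deck transformation, so w/r is equivariant and `endMap`
descends to the 3-folds. -/
theorem endMap_deck (hcone : N.IsTwoSidedCone) (hSL : N.IsSpecialLagrangian)
    (w : N.antiInvariantFields N.rot) (m n : ℤ) (y : ℝ × ℝ × ℝ) :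
    endMap w (deckSign m * y.1, deck m n y.2) =
      (deckSign m * (endMap w y).1, deck m n (endMap w y).2) := by
  refine Prod.ext rfl ?_
  have hs : (deckSign m)⁻¹ = deckSign m := by
    rcases deckSign_eq_or m with h | h <;> rw [h] <;> norm_num
  simp only [endMap]
  rw [((mem_antiInvariantFields_iff hcone hSL).1 w.2).2.2, mul_inv, hs, smul_smul,
    mul_right_comm, deckSign_mul_self, one_mul, deck_eq_add, deck_eq_add, map_sub, map_smul,
    deckCLM_apply, deckCLM_apply]
  abel

theorem continuous_point (N : RuledThreefold) : Continuous N.point :=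
  (continuous_kleinMk.comp continuous_snd).prodMk N.contDiff_imm.continuous

/-- The topological part of the asymptotics of a translated cone. -/
theorem image_endMap (hcone : N.IsTwoSidedCone) (hSL : N.IsSpecialLagrangian)
    (w : N.antiInvariantFields N.rot) {K : ℝ≥0} (hL : LipschitzWith K (w : ℝ × ℝ → ℝ × ℝ))
    {R : ℝ} (hR : K ≤ R) :
    (fun y => (N.translate hcone hSL w).point (endMap w y)) '' {y | R < |y.1|} =
      (N.translate hcone hSL w).total \ ((N.translate hcone hSL w).point ''
        (Set.Icc (-R) R ×ˢ (Set.Icc (0 : ℝ) 2 ×ˢ Set.Icc (0 : ℝ) 1))) := by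
  have hiff := point_eq_point_iff (N' := N.translate hcone hSL w)
    (show ∀ m n x, N.dir (deck m n x) = deckSign m • N.dir x from dir_deck_eq hcone hSL)
  have habs : ∀ m : ℤ, |deckSign m| = 1 := fun m => by
    rcases deckSign_eq_or m with h | h <;> simp [h]
  ext q
  constructor
  · rintro ⟨y, hy, rfl⟩
    refine ⟨⟨_, rfl⟩, ?_⟩
    rintro ⟨z, ⟨hz, -⟩, hzy⟩
    obtain ⟨m, n, h⟩ := (hiff _ _).1 hzy
    have h1 : y.1 = deckSign m * z.1 := congrArg Prod.fst h
    have h2 : |z.1| ≤ R := abs_le.2 hz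
    rw [Set.mem_ofPred_eq, h1, abs_mul, habs, one_mul] at hy
    exact absurd h2 (not_le.2 hy)
  · rintro ⟨⟨z, rfl⟩, hz⟩
    have hzR : R < |z.1| := by
      by_contra! hle
      refine hz ?_
      obtain ⟨m, n, x₀, hx₀, hx⟩ := exists_mem_Icc_two z.2
      refine ⟨(z.1, x₀), ⟨abs_le.1 hle, hx₀⟩, (hiff _ _).2 ⟨2 * m, n, ?_⟩⟩
      refine Prod.ext ?_ ?_
      · simp [deckSign_two_mul]
      · rw [hx, deck_two_mul]
    obtain ⟨x, hx⟩ := exists_endMap_eq hL (y := z) (hR.trans_lt hzR)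
    exact ⟨(z.1, x), hzR, congrArg _ hx⟩

theorem point_endMap_iff (hcone : N.IsTwoSidedCone) (hSL : N.IsSpecialLagrangian)
    (w : N.antiInvariantFields N.rot) {K : ℝ≥0} (hL : LipschitzWith K (w : ℝ × ℝ → ℝ × ℝ))
    {y y' : ℝ × ℝ × ℝ} (hy' : K < |y'.1|) :
    (N.translate hcone hSL w).point (endMap w y) = (N.translate hcone hSL w).point (endMap w y') ↔
      N.point y = N.point y' := by
  rw [point_eq_point_iff (N' := N.translate hcone hSL w)
    (show ∀ m n x, N.dir (deck m n x) = deckSign m • N.dir x from dir_deck_eq hcone hSL),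
    point_eq_point_iff (dir_deck_eq hcone hSL)]
  refine exists_congr fun m => exists_congr fun n => ?_
  rw [← endMap_deck hcone hSL]
  exact ⟨fun h => endMap_injective hL hy' h, fun h => congrArg _ h⟩

end RuledThreefold

end ConeEnd

/-! ### Decay of all covariant derivatives -/

noncomputable section AsymptoticEstimate

open scoped NNReal

/-- The linear map `(r, x) ↦ (c r, x)`. -/
def radialScale (c : ℝ) (hc : c ≠ 0) : (ℝ × ℝ × ℝ) ≃L[ℝ] (ℝ × ℝ × ℝ) :=
  (ContinuousLinearEquiv.unitsEquivAut ℝ (Units.mk0 c hc)).prodCongr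
    (ContinuousLinearEquiv.refl ℝ (ℝ × ℝ))

theorem radialScale_apply (c : ℝ) (hc : c ≠ 0) (y : ℝ × ℝ × ℝ) :
    radialScale c hc y = (c * y.1, y.2) := by
  simp [radialScale, mul_comm]

/-- Minimum over unit vectors on a compact set; it compares coordinate lengths at r = 1 with lengths
in the cone metric. -/
theorem exists_lower_bound_of_injective {D : ℝ × ℝ × ℝ → (ℝ × ℝ × ℝ →L[ℝ] C3)} (hD : Continuous D)
    {C : Set (ℝ × ℝ × ℝ)} (hC : IsCompact C) (hinj : ∀ y ∈ C, Function.Injective (D y)) :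
    ∃ c : ℝ, 0 < c ∧ ∀ y ∈ C, ∀ v, c * ‖v‖ ≤ ‖D y v‖ := by
  have hcont : Continuous fun q : (ℝ × ℝ × ℝ) × (ℝ × ℝ × ℝ) => ‖D q.1 q.2‖ := by fun_prop
  rcases (C ×ˢ Metric.sphere (0 : ℝ × ℝ × ℝ) 1).eq_empty_or_nonempty with hemp | hne
  · refine ⟨1, one_pos, fun y hy v => absurd hemp ?_⟩
    have h1 : (1, 0, 0) ∈ Metric.sphere (0 : ℝ × ℝ × ℝ) 1 := by simp [Prod.norm_def]
    exact Set.Nonempty.ne_empty ⟨(y, _), hy, h1⟩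
  obtain ⟨⟨y₀, v₀⟩, ⟨hy₀, hv₀⟩, hmin⟩ := (hC.prod (isCompact_sphere (0 : ℝ × ℝ × ℝ) 1)
    ).exists_isMinOn hne hcont.continuousOn
  have hv₀' : v₀ ≠ 0 := fun h => by simp [h] at hv₀
  refine ⟨‖D y₀ v₀‖, norm_pos_iff.2 fun h => hv₀' (hinj y₀ hy₀ (by rw [h, map_zero])),
    fun y hy v => ?_⟩
  by_cases hv : v = 0
  · simp [hv]
  have hvn : 0 < ‖v‖ := norm_pos_iff.2 hv
  have h1 : ‖v‖⁻¹ • v ∈ Metric.sphere (0 : ℝ × ℝ × ℝ) 1 := by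
    rw [mem_sphere_zero_iff_norm, norm_smul, norm_inv, norm_norm, inv_mul_cancel₀ hvn.ne']
  have h2 : ‖D y₀ v₀‖ ≤ ‖D y (‖v‖⁻¹ • v)‖ := hmin (a := (y, ‖v‖⁻¹ • v)) ⟨hy, h1⟩
  rw [map_smul, norm_smul, norm_inv, norm_norm, le_inv_mul_iff₀ hvn, mul_comm] at h2
  exact h2

namespace RuledThreefold

variable {N : RuledThreefold}

/-- The difference between the translated cone and the cone, rescaled to `r = 1 / s`. -/
def coneDefect (N : RuledThreefold) (w : ℝ × ℝ → ℝ × ℝ) (q : ℝ × ℝ × ℝ) : C3 :=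
  N.dir (q.2 - q.1 • w q.2) - N.dir q.2 + q.1 • N.variation w (q.2 - q.1 • w q.2)

theorem contDiff_coneDefect (N : RuledThreefold) {w : ℝ × ℝ → ℝ × ℝ} (hw : ContDiff ℝ ∞ w) :
    ContDiff ℝ ∞ (N.coneDefect w) := by
  have h1 : ContDiff ℝ ∞ fun q : ℝ × ℝ × ℝ => q.2 - q.1 • w q.2 :=
    contDiff_snd.sub (contDiff_fst.smul (hw.comp contDiff_snd))
  exact ((N.contDiff_dir.comp h1).sub (N.contDiff_dir.comp contDiff_snd)).add
    (contDiff_fst.smul ((N.contDiff_variation hw).comp h1))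

/-- To first order φ(x - s w) - φ(x) is -s dφ(w), which cancels the translation s L_w φ. The shift
by -w/r in `endMap` is chosen for this cancellation; without it the difference would only be O(1).
-/
theorem fderiv_coneDefect_zero (N : RuledThreefold) {w : ℝ × ℝ → ℝ × ℝ} (hw : ContDiff ℝ ∞ w)
    (x : ℝ × ℝ) : fderiv ℝ (N.coneDefect w) (0, x) (1, 0) = 0 := by
  have h1 := ((N.contDiff_coneDefect hw).differentiable (by simp) (0, x)).hasFDerivAt.comp_hasDerivAt
    (0 : ℝ) ((hasDerivAt_id (0 : ℝ)).prodMk (hasDerivAt_const (0 : ℝ) x))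
  have hγ : HasDerivAt (fun s : ℝ => x - s • w x) (-w x) 0 := by
    have h := ((hasDerivAt_id (0 : ℝ)).smul_const (w x)).const_sub x
    simpa using h
  have hγ0 : x - (0 : ℝ) • w x = x := by simp
  have hφ : HasDerivAt (fun s : ℝ => N.dir (x - s • w x)) (fderiv ℝ N.dir x (-w x)) 0 := by
    have h := (N.contDiff_dir.differentiable (by simp) (x - (0 : ℝ) • w x)).hasFDerivAt.comp_hasDerivAt
      (0 : ℝ) hγ
    rwa [hγ0] at h
  have hψ : HasDerivAt (fun s : ℝ => N.variation w (x - s • w x))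
      (fderiv ℝ (N.variation w) x (-w x)) 0 := by
    have h := ((N.contDiff_variation hw).differentiable (by simp)
      (x - (0 : ℝ) • w x)).hasFDerivAt.comp_hasDerivAt (0 : ℝ) hγ
    rwa [hγ0] at h
  have h2 := (hφ.sub_const (N.dir x)).add ((hasDerivAt_id (0 : ℝ)).smul hψ)
  have h3 := h1.unique h2
  rw [h3]
  simp [variation]

/-- A family of rescalings of the difference between the translated cone and the cone. -/
theorem exists_rescaled_defect (hcone : N.IsTwoSidedCone) (hSL : N.IsSpecialLagrangian)
    (w : N.antiInvariantFields N.rot) :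
    ∃ Q : ℝ × ℝ × ℝ × ℝ → C3, ContDiffOn ℝ ∞ Q {m | m.2 ∈ {y : ℝ × ℝ × ℝ | y.1 ≠ 0}} ∧
      ∀ (c : ℝ), c ≠ 0 → ∀ (m n : ℤ) (p : ℝ × ℝ × ℝ), p.1 ≠ 0 →
        (N.translate hcone hSL w).imm (endMap w (c * p.1, p.2.1 + 2 * m, p.2.2 + n)) -
          N.imm (c * p.1, p.2.1 + 2 * m, p.2.2 + n) = c⁻¹ • Q (c⁻¹, p) := by
  have hw := ((mem_antiInvariantFields_iff hcone hSL).1 w.2).1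
  obtain ⟨B, hB, hAB⟩ := exists_sq_smul_eq_of_zero (N.contDiff_coneDefect hw)
    (fun x => by simp [coneDefect]) (N.fderiv_coneDefect_zero hw)
  -- With r = c p.1 and s = 1/r, the difference is r s² B(s, x) = r⁻¹ B(s, x); splitting r⁻¹ = c⁻¹
  -- (p.1)⁻¹ leaves this Q.
  refine ⟨fun q => q.2.1⁻¹ • B (q.1 * q.2.1⁻¹, q.2.2), ?_, ?_⟩
  · have h1 : ContDiffOn ℝ ∞ (fun q : ℝ × ℝ × ℝ × ℝ => q.2.1⁻¹)
        {m | m.2 ∈ {y : ℝ × ℝ × ℝ | y.1 ≠ 0}} :=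
      (contDiff_fst.comp contDiff_snd).contDiffOn.inv fun q hq => hq
    exact h1.smul (hB.comp_contDiffOn ((contDiff_fst.contDiffOn.mul h1).prodMk
      (contDiff_snd.comp contDiff_snd).contDiffOn))
  · intro c hc m n p hp
    have hcp : c * p.1 ≠ 0 := mul_ne_zero hc hp
    have hshift : (p.2.1 + 2 * (m : ℝ), p.2.2 + (n : ℝ)) - (c * p.1)⁻¹ • (w : ℝ × ℝ → ℝ × ℝ) p.2 =
        ((p.2 - (c * p.1)⁻¹ • (w : ℝ × ℝ → ℝ × ℝ) p.2).1 + 2 * (m : ℝ),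
          (p.2 - (c * p.1)⁻¹ • (w : ℝ × ℝ → ℝ × ℝ) p.2).2 + (n : ℝ)) := by
      ext <;> simp <;> ring
    have hvar : ∀ x : ℝ × ℝ, N.variation w (x.1 + 2 * m, x.2 + n) = N.variation w x := fun x => by
      rw [variation, field_periodic hcone hSL, fderiv_periodic_two (dir_periodic hcone hSL)]
      rfl
    have h1 : (N.translate hcone hSL w).imm (endMap w (c * p.1, p.2.1 + 2 * m, p.2.2 + n)) -
        N.imm (c * p.1, p.2.1 + 2 * m, p.2.2 + n) =
        (c * p.1) • N.coneDefect w ((c * p.1)⁻¹, p.2) := by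
      have h2 : (N.translate hcone hSL w).imm (endMap w (c * p.1, p.2.1 + 2 * m, p.2.2 + n)) =
          (c * p.1) • N.dir (p.2 - (c * p.1)⁻¹ • (w : ℝ × ℝ → ℝ × ℝ) p.2) +
            N.variation w (p.2 - (c * p.1)⁻¹ • (w : ℝ × ℝ → ℝ × ℝ) p.2) := by
        change (c * p.1) • N.dir ((p.2.1 + 2 * (m : ℝ), p.2.2 + (n : ℝ)) - (c * p.1)⁻¹ •
          (w : ℝ × ℝ → ℝ × ℝ) (p.2.1 + 2 * (m : ℝ), p.2.2 + (n : ℝ))) +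
          N.variation w ((p.2.1 + 2 * (m : ℝ), p.2.2 + (n : ℝ)) - (c * p.1)⁻¹ •
          (w : ℝ × ℝ → ℝ × ℝ) (p.2.1 + 2 * (m : ℝ), p.2.2 + (n : ℝ))) = _
        rw [field_periodic hcone hSL, hshift, dir_periodic hcone hSL, hvar]
      rw [h2, imm, hcone.1]
      simp only [add_zero]
      rw [dir_periodic hcone hSL, coneDefect, smul_add, smul_smul, mul_inv_cancel₀ hcp, one_smul,
        smul_sub]
      abel
    rw [h1, hAB, smul_smul, smul_smul, mul_inv]
    congr 1
    field_simp

theorem imm_affine (hcone : N.IsTwoSidedCone) (hSL : N.IsSpecialLagrangian) (c : ℝ) (hc : c ≠ 0)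
    (m n : ℤ) (p : ℝ × ℝ × ℝ) :
    N.imm (radialScale c hc p + (0, 2 * (m : ℝ), (n : ℝ))) = c • N.imm p := by
  have h := dir_periodic hcone hSL m n p.2
  simp only [imm, hcone.1, add_zero, radialScale_apply, smul_smul]
  congr 1
  · simp

/-- Every point comes from some (1, x₀), with x₀ in the compact rectangle, by the homothety of
factor r and a period. Pulled back, the difference is r⁻¹ Q(r⁻¹, ·) with r⁻¹ in the compact [-1, 1],
so ∇ᵏ is bounded by r⁻¹ up to a constant; each of the k vectors contributes a further |r|⁻¹ when
measured in the cone metric. -/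
theorem nabla_imm_bound (hcone : N.IsTwoSidedCone) (hSL : N.IsSpecialLagrangian)
    (w : N.antiInvariantFields N.rot) (k : ℕ) :
    ∃ M : ℝ, ∀ y : ℝ × ℝ × ℝ, 1 ≤ |y.1| → ∀ v : Fin k → ℝ × ℝ × ℝ,
      ‖nabla N.imm (fun p => (N.translate hcone hSL w).imm (endMap w p) - N.imm p) k y v‖ ≤
        M * (|y.1|⁻¹ * (|y.1|⁻¹) ^ k) * ∏ i, ‖fderiv ℝ N.imm y (v i)‖ := by
  obtain ⟨Q, hQ, hQf⟩ := exists_rescaled_defect hcone hSL w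
  set U : Set (ℝ × ℝ × ℝ) := {y | y.1 ≠ 0} with hUdef
  have hUo : IsOpen U := isOpen_ne.preimage continuous_fst
  have hU : ∀ y ∈ U, Function.Injective (fderiv ℝ N.imm y) := hcone.2
  -- The slice r = 1 alone suffices: the end r < 0 is reached by homotheties of negative factor.
  set C : Set (ℝ × ℝ × ℝ) := {1} ×ˢ (Set.Icc (0 : ℝ) 2 ×ˢ Set.Icc (0 : ℝ) 1) with hCdef
  have hC : IsCompact C := isCompact_singleton.prod isCompact_fundamentalRectangle
  have hCU : C ⊆ U := fun y hy => by
    have h1 : y.1 = 1 := hy.1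
    change y.1 ≠ 0
    rw [h1]
    exact one_ne_zero
  obtain ⟨M, hM0, hM⟩ := exists_nabla_bound N.contDiff_imm hUo hU hQ
    (isCompact_Icc (a := (-1 : ℝ)) (b := 1)) hC hCU k
  obtain ⟨a, ha, hlow⟩ := exists_lower_bound_of_injective
    (N.contDiff_imm.continuous_fderiv (by simp)) hC fun y hy => hU y (hCU hy)
  refine ⟨M * (a⁻¹) ^ k, fun y hy v => ?_⟩
  have hpos : 0 < |y.1| := one_pos.trans_le hy
  have hy0 : y.1 ≠ 0 := abs_pos.1 hpos
  obtain ⟨m, n, x₀, hx₀, hx⟩ := exists_mem_Icc_two y.2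
  set L := radialScale y.1 hy0 with hL
  set b : ℝ × ℝ × ℝ := (0, 2 * (m : ℝ), (n : ℝ)) with hb
  have hy₀ : ((1, x₀) : ℝ × ℝ × ℝ) ∈ C := ⟨rfl, hx₀⟩
  have hyL : L (1, x₀) + b = y := by
    rw [hL, radialScale_apply]
    refine Prod.ext (by simp [hb]) ?_
    rw [hx]
    rfl
  have hT := imm_affine hcone hSL y.1 hy0 m n
  set u : Fin k → ℝ × ℝ × ℝ := fun i => L.symm (v i) with hu
  have hv : v = fun i => L (u i) := by funext i; simp [hu]
  have h1 : nabla N.imm (fun p => (N.translate hcone hSL w).imm (endMap w p) - N.imm p) k y v =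
      y.1⁻¹ • nabla N.imm (fun p => Q (y.1⁻¹, p)) k (1, x₀) u := by
    rw [← nabla_const_smul, hv]
    nth_rewrite 1 [← hyL]
    rw [nabla_homothety N.contDiff_imm hy0 hT hUo hU _ k _ (hCU hy₀)]
    refine nabla_congr hUo (fun p hp => ?_) k _ (hCU hy₀) u
    have h2 : L p + b = (y.1 * p.1, p.2.1 + 2 * (m : ℝ), p.2.2 + (n : ℝ)) := by
      rw [hL, radialScale_apply]
      simp [hb, Prod.ext_iff]
    rw [h2]
    exact hQf y.1 hy0 m n p hp
  have h3 : ∀ i, ‖u i‖ ≤ a⁻¹ * |y.1|⁻¹ * ‖fderiv ℝ N.imm y (v i)‖ := fun i => by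
    have h4 := fderiv_homothety hT (1, x₀) (u i)
    rw [hyL, show L (u i) = v i by simp [hu]] at h4
    rw [h4, norm_smul, Real.norm_eq_abs, mul_assoc, inv_mul_cancel_left₀ hpos.ne',
      le_inv_mul_iff₀ ha]
    exact hlow _ hy₀ _
  have h5 : y.1⁻¹ ∈ Set.Icc (-1 : ℝ) 1 := by
    rw [Set.mem_Icc, ← abs_le, abs_inv]
    exact inv_le_one_of_one_le₀ hy
  have h6 : ∏ i, ‖u i‖ ≤ (a⁻¹ * |y.1|⁻¹) ^ k * ∏ i, ‖fderiv ℝ N.imm y (v i)‖ := by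
    refine (Finset.prod_le_prod (fun i _ => norm_nonneg _) fun i _ => h3 i).trans_eq ?_
    rw [Finset.prod_mul_distrib, Finset.prod_const, Finset.card_univ, Fintype.card_fin]
  rw [h1, norm_smul, norm_inv, Real.norm_eq_abs]
  calc |y.1|⁻¹ * ‖nabla N.imm (fun p => Q (y.1⁻¹, p)) k (1, x₀) u‖
      ≤ |y.1|⁻¹ * (M * ((a⁻¹ * |y.1|⁻¹) ^ k * ∏ i, ‖fderiv ℝ N.imm y (v i)‖)) := by
        refine mul_le_mul_of_nonneg_left ((hM _ h5 _ hy₀ u).trans ?_) (inv_nonneg.2 hpos.le)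
        exact mul_le_mul_of_nonneg_left h6 hM0
    _ = _ := by rw [mul_pow]; ring

theorem asymptoticTo_translate (hcone : N.IsTwoSidedCone) (hSL : N.IsSpecialLagrangian)
    (w : N.antiInvariantFields N.rot) : (N.translate hcone hSL w).AsymptoticTo N (-1) := by
  have hw := ((mem_antiInvariantFields_iff hcone hSL).1 w.2).1
  obtain ⟨K, hK, hLip⟩ := exists_lipschitz_of_periodic hw (field_periodic hcone hSL w)
  -- The radius K + 1 exceeds the Lipschitz constant, as the diffeomorphism requires, and is at
  -- least 1, as the estimate requires.
  have hKR : (K : ℝ) ≤ K + 1 := by linarith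
  have hK0 : 0 ≤ (K : ℝ) := K.2
  have hlt : ∀ {y : ℝ × ℝ × ℝ}, (K : ℝ) + 1 < ‖N.imm y‖ → K < |y.1| := fun {y} hy => by
    rw [norm_imm_of_cone hcone] at hy
    linarith
  refine ⟨(N.translate hcone hSL w).point ''
    (Set.Icc (-((K : ℝ) + 1)) (K + 1) ×ˢ (Set.Icc (0 : ℝ) 2 ×ˢ Set.Icc (0 : ℝ) 1)), K + 1,
    endMap w, (isCompact_Icc.prod isCompact_fundamentalRectangle).image (continuous_point _),
    Set.image_subset_range _ _, by linarith, ?_, ?_, ?_, ?_, ?_⟩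
  · refine (contDiffOn_endMap hw).mono fun y hy => ?_
    exact abs_pos.1 (hK0.trans_lt (hlt hy))
  · exact fun y hy => bijective_fderiv_endMap hw hK (hlt hy)
  · exact fun y y' hy hy' => point_endMap_iff hcone hSL w hLip (hlt hy')
  · have h := image_endMap hcone hSL w hLip hKR
    simp only [← norm_imm_of_cone hcone] at h
    exact h
  · intro k
    obtain ⟨M, hM⟩ := nabla_imm_bound hcone hSL w k
    refine ⟨M, K + 1, le_rfl, fun y hy v => ?_⟩
    rw [norm_imm_of_cone hcone] at hy ⊢
    have hpos : 0 < |y.1| := by linarith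
    refine (hM y (by linarith) v).trans_eq ?_
    rw [Real.rpow_sub hpos, Real.rpow_natCast, Real.rpow_neg_one, div_eq_mul_inv, inv_pow]

end RuledThreefold

end AsymptoticEstimate

/-! ### Lifting isomorphisms and distinctness -/

noncomputable section KleinCovering

/-- The deck transformations of the Klein bottle as a group of permutations. -/
def deckGroup : Subgroup (Equiv.Perm (ℝ × ℝ)) where
  carrier := {g | ∃ m n : ℤ, ∀ x, g x = deck m n x}
  one_mem' := ⟨0, 0, fun x => (deck_zero x).symm⟩
  mul_mem' := by
    rintro a b ⟨m, n, h⟩ ⟨p, q, h'⟩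
    exact ⟨_, _, fun x => by rw [Equiv.Perm.mul_apply, h', h, deck_deck]⟩
  inv_mem' := by
    rintro a ⟨m, n, h⟩
    refine ⟨-m, -((m.negOnePow : ℤ) * n), fun x => ?_⟩
    obtain ⟨y, rfl⟩ := a.surjective x
    change a.symm (a y) = _
    rw [Equiv.symm_apply_apply, h, deck_inv]

/-- A deck transformation as a permutation. -/
def deckPerm (m n : ℤ) : Equiv.Perm (ℝ × ℝ) where
  toFun := deck m n
  invFun := deck (-m) (-((m.negOnePow : ℤ) * n))
  left_inv := deck_inv m n
  right_inv := fun x => by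
    have h := deck_inv (-m) (-((m.negOnePow : ℤ) * n)) x
    rw [neg_neg, Int.negOnePow_neg, mul_neg, neg_neg, ← mul_assoc, ← Units.val_mul,
      ← Int.negOnePow_add, Int.negOnePow_even _ ⟨m, rfl⟩, Units.val_one, one_mul] at h
    exact h

theorem isQuotientCoveringMap_kleinMk : IsQuotientCoveringMap kleinMk deckGroup where
  toIsQuotientMap := isQuotientMap_quot_mk
  continuous_const_smul := by
    rintro ⟨g, m, n, h⟩
    exact (continuous_deck m n).congr fun x => (h x).symm
  apply_eq_iff_mem_orbit := by
    intro x y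
    rw [eq_comm, kleinMk_eq_iff]
    constructor
    · rintro ⟨m, n, h⟩
      exact ⟨⟨deckPerm m n, m, n, fun x => rfl⟩, h⟩
    · rintro ⟨⟨g, m, n, hg⟩, h⟩
      exact ⟨m, n, (hg y).symm.trans h⟩
  disjoint := by
    intro e
    -- A deck transformation that maps one point of this ball into the ball moves it by less than 1.
    -- The first coordinate moves by the integer m, so m = 0; then the second moves by n, so n = 0.
    refine ⟨Metric.ball e (1 / 2), Metric.ball_mem_nhds e (by norm_num), ?_⟩
    rintro ⟨g, m, n, hg⟩ ⟨z, ⟨x, hx, hxz⟩, hz⟩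
    have hz' : deck m n x = z := (hg x).symm.trans hxz
    have hd : dist (deck m n x) x < 1 := by
      rw [hz']
      have h1 := dist_triangle_right z x e
      rw [Metric.mem_ball] at hx hz
      linarith
    rw [Prod.dist_eq, max_lt_iff, Real.dist_eq, Real.dist_eq, deck_eq] at hd
    have hm : m = 0 := by
      have h1 := hd.1
      simp only [add_sub_cancel_left] at h1
      exact Int.abs_lt_one_iff.1 (by exact_mod_cast h1)
    subst hm
    have hn : n = 0 := by
      have h1 := hd.2
      simp only [deckSign, Int.negOnePow_zero, Units.val_one, Int.cast_one, one_mul,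
        add_sub_cancel_left] at h1
      exact Int.abs_lt_one_iff.1 (by exact_mod_cast h1)
    subst hn
    refine Subtype.ext (Equiv.ext fun y => ?_)
    exact (hg y).trans (deck_zero y)

theorem isCoveringMap_kleinMk : IsCoveringMap kleinMk := isQuotientCoveringMap_kleinMk.isCoveringMap

/-- Maps between Klein bottles lift to the universal covers. -/
theorem exists_lift_kleinMk {f : KleinBottle → KleinBottle} (hf : Continuous f) :
    ∃ F : ℝ × ℝ → ℝ × ℝ, Continuous F ∧ ∀ x, kleinMk (F x) = f (kleinMk x) := by
  obtain ⟨e, he⟩ := Quotient.exists_rep (f (kleinMk 0))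
  obtain ⟨F, ⟨-, hF⟩, -⟩ := isCoveringMap_kleinMk.existsUnique_continuousMap_lifts
    ⟨f ∘ kleinMk, hf.comp continuous_kleinMk⟩ 0 e he
  exact ⟨F, F.continuous, fun x => congrFun hF x⟩

/-- A continuous lift of a smooth map through an immersion is differentiable. -/
theorem exists_hasFDerivAt_of_comp_eq {φ g : ℝ × ℝ → C3} {F : ℝ × ℝ → ℝ × ℝ} {x : ℝ × ℝ}
    (hφ : ContDiffAt ℝ 1 φ (F x)) (hinj : Function.Injective (fderiv ℝ φ (F x)))
    (hg : DifferentiableAt ℝ g x) (hF : ContinuousAt F x) (h : ∀ z, φ (F z) = g z) :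
    ∃ F' : ℝ × ℝ →L[ℝ] ℝ × ℝ, HasFDerivAt F F' x := by
  -- Composed with a linear left inverse P of dφ, the map φ becomes a local diffeomorphism near F x,
  -- and continuity of F gives F = (P ∘ φ)⁻¹ ∘ P ∘ g near x.
  obtain ⟨P, hP⟩ := (fderiv ℝ φ (F x)).toLinearMap.exists_leftInverse_of_injective
    (LinearMap.ker_eq_bot.2 hinj)
  set P' : C3 →L[ℝ] ℝ × ℝ := LinearMap.toContinuousLinearMap P with hP'
  have hid : P'.comp (fderiv ℝ φ (F x)) =
      ((ContinuousLinearEquiv.refl ℝ (ℝ × ℝ) : (ℝ × ℝ) ≃L[ℝ] (ℝ × ℝ)) : ℝ × ℝ →L[ℝ] ℝ × ℝ) :=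
    ContinuousLinearMap.ext fun v => LinearMap.congr_fun hP v
  have hs : HasStrictFDerivAt (fun y => P' (φ y))
      ((ContinuousLinearEquiv.refl ℝ (ℝ × ℝ) : (ℝ × ℝ) ≃L[ℝ] (ℝ × ℝ)) : ℝ × ℝ →L[ℝ] ℝ × ℝ)
      (F x) := by
    rw [← hid]
    exact P'.hasStrictFDerivAt.comp (F x) (hφ.hasStrictFDerivAt one_ne_zero)
  have hinv := hs.to_localInverse.hasFDerivAt
  have hev := hF.eventually hs.eventually_left_inverse
  have hFeq : F =ᶠ[nhds x] fun z => hs.localInverse _ _ _ (P' (g z)) := by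
    filter_upwards [hev] with z hz
    rw [← h z]
    exact hz.symm
  have hPg : HasFDerivAt (fun z => P' (g z)) (P'.comp (fderiv ℝ g x)) x :=
    P'.hasFDerivAt.comp x hg.hasFDerivAt
  have hpt : P' (φ (F x)) = P' (g x) := by rw [h]
  rw [hpt] at hinv
  exact ⟨_, (hinv.comp x hPg).congr_of_eventuallyEq hFeq⟩

namespace RuledThreefold

theorem mem_line_kleinMk (N : RuledThreefold) (x : ℝ × ℝ) (z : C3) :
    z ∈ N.line (kleinMk x) ↔ ∃ r : ℝ, z = r • N.dir x + N.foot x := by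
  constructor
  · rintro ⟨y, hy⟩
    have h1 : kleinMk y.2 = kleinMk x := congrArg Prod.fst hy
    have h2 : N.imm y = z := congrArg Prod.snd hy
    obtain ⟨m, n, rfl⟩ := kleinMk_eq_iff.1 h1
    rw [N.foot_deck, ← h2, imm]
    rcases N.dir_deck m n y.2 with h | h
    · exact ⟨y.1, by rw [h]⟩
    · exact ⟨-y.1, by rw [h, smul_neg, neg_smul, neg_neg]⟩
  · rintro ⟨r, rfl⟩
    exact ⟨(r, x), rfl⟩

/-- The foot is the unique point of the line nearest to 0, and unit directions of a line agree up to
sign. -/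
theorem foot_eq_and_dir_eq_of_line_eq {N N' : RuledThreefold} {x x' : ℝ × ℝ}
    (h : N'.line (kleinMk x') = N.line (kleinMk x)) :
    N'.foot x' = N.foot x ∧ (N'.dir x' = N.dir x ∨ N'.dir x' = -N.dir x) := by
  have h1 : N.foot x ∈ N'.line (kleinMk x') := by
    rw [h, mem_line_kleinMk]
    exact ⟨0, by simp⟩
  have h2 : N'.foot x' ∈ N.line (kleinMk x) := by
    rw [← h, mem_line_kleinMk]
    exact ⟨0, by simp⟩
  have h3 : N.dir x + N.foot x ∈ N'.line (kleinMk x') := by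
    rw [h, mem_line_kleinMk]
    exact ⟨1, by simp⟩
  obtain ⟨s, hs⟩ := (N'.mem_line_kleinMk _ _).1 h1
  obtain ⟨t, ht⟩ := (N.mem_line_kleinMk _ _).1 h2
  obtain ⟨r, hr⟩ := (N'.mem_line_kleinMk _ _).1 h3
  have hn : ∀ (N : RuledThreefold) (x : ℝ × ℝ) (s : ℝ),
      ‖s • N.dir x + N.foot x‖ ^ 2 = s ^ 2 + ‖N.foot x‖ ^ 2 := fun N x s => by
    rw [norm_add_sq_real, real_inner_smul_left, N.inner_dir_foot, norm_smul, N.norm_dir,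
      Real.norm_eq_abs, mul_one, sq_abs]
    ring
  have e1 := hn N' x' s
  have e2 := hn N x t
  rw [← hs] at e1
  rw [← ht] at e2
  have hs0 : s = 0 := by
    have := sq_nonneg t
    exact pow_eq_zero_iff two_ne_zero |>.1 (le_antisymm (by linarith) (sq_nonneg s))
  rw [hs0, zero_smul, zero_add] at hs
  refine ⟨hs.symm, ?_⟩
  rw [hs, add_left_inj] at hr
  have hr1 : |r| = 1 := by
    have := congrArg norm hr
    rwa [norm_smul, N.norm_dir, N'.norm_dir, mul_one, Real.norm_eq_abs, eq_comm] at this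
  rcases eq_or_eq_neg_of_abs_eq hr1 with h | h
  · left; rw [hr, h, one_smul]
  · right; rw [hr, h, neg_smul, one_smul, neg_neg]

theorem SameRuled.symm {N N' : RuledThreefold} (h : N.SameRuled N') : N'.SameRuled N := by
  obtain ⟨f, hf⟩ := h
  exact ⟨f.symm, fun s => by rw [← hf, f.apply_symm_apply]⟩

variable {N : RuledThreefold}

/-- An isomorphism of translated cones lifts to the universal cover of the base. -/
theorem SameRuled.exists_lift (hcone : N.IsTwoSidedCone) (hSL : N.IsSpecialLagrangian)
    {w w' : N.antiInvariantFields N.rot}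
    (h : (N.translate hcone hSL w).SameRuled (N.translate hcone hSL w')) :
    ∃ F : ℝ × ℝ → ℝ × ℝ, Continuous F ∧ (∀ x, N.dir (F x) = N.dir x) ∧
      ∀ x, N.variation w' (F x) = N.variation w x := by
  obtain ⟨f, hf⟩ := h
  obtain ⟨F, hF, hFf⟩ := exists_lift_kleinMk f.continuous
  have key : ∀ x, N.variation w' (F x) = N.variation w x ∧
      (N.dir (F x) = N.dir x ∨ N.dir (F x) = -N.dir x) := fun x =>
    foot_eq_and_dir_eq_of_line_eq (N := N.translate hcone hSL w) (N' := N.translate hcone hSL w')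
      (by rw [hFf, hf])
  rcases eq_or_eq_neg_of_continuous (N.contDiff_dir.continuous.comp hF)
    N.contDiff_dir.continuous N.norm_dir fun x => (key x).2 with h | h
  · exact ⟨F, hF, h, fun x => (key x).1⟩
  -- A lift that reverses φ is corrected by the glide reflection, which changes the sign of φ and
  -- fixes the feet.
  · refine ⟨fun x => deck 1 0 (F x), (continuous_deck 1 0).comp hF, fun x => ?_, fun x => ?_⟩
    · rw [dir_deck_eq hcone hSL, deckSign_one, neg_smul, one_smul]
      have h1 := h x
      simp only [Function.comp_apply] at h1
      rw [h1, neg_neg]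
    · exact ((N.translate hcone hSL w').foot_deck 1 0 (F x)).trans (key x).1

theorem variation_smul (N : RuledThreefold) (a : ℝ) (w : ℝ × ℝ → ℝ × ℝ) (x : ℝ × ℝ) :
    N.variation (a • w) x = a • N.variation w x := by
  simp [variation]

/-- Isomorphic lines have feet of equal norm. At a maximum p of |L_{w₀} φ| this gives |a| max = |a'|
|L_{w₀} φ|(F p) ≤ |a'| max. -/
theorem abs_le_of_sameRuled (hcone : N.IsTwoSidedCone) (hSL : N.IsSpecialLagrangian)
    {w w' w₀ : N.antiInvariantFields N.rot} {a a' : ℝ} (hw : (w : ℝ × ℝ → ℝ × ℝ) = a • w₀)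
    (hw' : (w' : ℝ × ℝ → ℝ × ℝ) = a' • w₀) (h0 : (w₀ : ℝ × ℝ → ℝ × ℝ) 0 ≠ 0)
    (h : (N.translate hcone hSL w).SameRuled (N.translate hcone hSL w')) : |a| ≤ |a'| := by
  obtain ⟨F, -, -, hF⟩ := SameRuled.exists_lift hcone hSL h
  have hc : Continuous fun x => ‖N.variation w₀ x‖ :=
    (N.contDiff_variation ((mem_antiInvariantFields_iff hcone hSL).1 w₀.2).1).continuous.norm
  obtain ⟨p, -, hp⟩ := isCompact_fundamentalRectangle.exists_isMaxOn
    ⟨0, ⟨le_rfl, zero_le_two⟩, ⟨le_rfl, zero_le_one⟩⟩ hc.continuousOn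
  have hmax : ∀ x, ‖N.variation w₀ x‖ ≤ ‖N.variation w₀ p‖ := fun x => by
    obtain ⟨m, n, x₀, hx₀, rfl⟩ := exists_mem_Icc_two x
    have h1 := (N.translate hcone hSL w₀).foot_deck (2 * m) n x₀
    rw [deck_two_mul] at h1
    have h2 : N.variation w₀ (x₀.1 + 2 * (m : ℝ), x₀.2 + n) = N.variation w₀ x₀ := h1
    rw [h2]
    exact hp hx₀
  have hpos : 0 < ‖N.variation w₀ p‖ := by
    refine (norm_pos_iff.2 fun h => h0 ?_).trans_le (hmax 0)
    exact injective_fderiv_dir hcone 0 (h.trans (map_zero _).symm)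
  have h1 := congrArg norm (hF p)
  rw [hw, hw', variation_smul, variation_smul, norm_smul, norm_smul, Real.norm_eq_abs,
    Real.norm_eq_abs] at h1
  refine le_of_mul_le_mul_right ?_ hpos
  rw [← h1]
  exact mul_le_mul_of_nonneg_left (hmax _) (abs_nonneg _)

/-- No lift of an isomorphism reverses a coordinate vector field. -/
theorem not_exists_reversing_lift (hcone : N.IsTwoSidedCone) (hSL : N.IsSpecialLagrangian)
    {Z : ℝ × ℝ → ℂ} (hZ : IsGlobalCoordinate N.rot 2 Z) {h : ℂ} (h0 : h ≠ 0)
    {F : ℝ × ℝ → ℝ × ℝ} (hF : Continuous F) (hdir : ∀ x, N.dir (F x) = N.dir x)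
    (hvar : ∀ x, N.variation (coordField Z h) (F x) = -N.variation (coordField Z h) x) : False := by
  have hinj := injective_fderiv_dir hcone
  -- F is only a continuous lift so far; since φ ∘ F = φ and φ is an immersion, F is differentiable.
  choose F' hF' using fun x => exists_hasFDerivAt_of_comp_eq
    (N.contDiff_dir.contDiffAt.of_le (by simp)) (hinj (F x))
    (N.contDiff_dir.differentiable (by simp) x) hF.continuousAt hdir
  have hd : ∀ x v, fderiv ℝ N.dir (F x) (F' x v) = fderiv ℝ N.dir x v := fun x v => by
    have h1 := ((N.contDiff_dir.differentiable (by simp) (F x)).hasFDerivAt.comp x (hF' x)).fderiv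
    rw [show N.dir ∘ F = N.dir from funext hdir] at h1
    rw [h1]
    rfl
  have hw : ∀ x, F' x (coordField Z h x) = -coordField Z h (F x) := fun x => by
    apply hinj (F x)
    rw [hd, map_neg]
    have h1 := hvar x
    simp only [variation] at h1
    rw [h1, neg_neg]
  -- J is determined by φ and dφ through the cross product, and F preserves both; so F is
  -- holomorphic.
  have hJ : ∀ x v, F' x (N.rot x v) = N.rot (F x) (F' x v) := fun x v => by
    apply hinj (F x)
    rw [hd, fderiv_dir_rot hcone hSL, fderiv_dir_rot hcone hSL, hd, hdir]
  have hZF : ∀ x v, fderiv ℝ Z (F x) (F' x v) = -1 * fderiv ℝ Z x v := fun x v => by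
    refine hZ.eq_mul_of_complexLinear (L := fun v => fderiv ℝ Z (F x) (F' x v)) (fun u v => ?_)
      (fun c u => ?_) (fun v => ?_) h0 (hZ.fderiv_coordField h x) ?_ v
    · rw [map_add, map_add]
    · rw [map_smul, map_smul, Complex.real_smul]
    · rw [hJ, hZ.map_J]
    · rw [hw, map_neg, hZ.fderiv_coordField, neg_one_mul]
  have hsum : ∀ x, HasFDerivAt (fun y => Z (F y) + Z y) (0 : ℝ × ℝ →L[ℝ] ℂ) x := fun x => by
    have h1 := ((hZ.contDiff.differentiable (by simp) (F x)).hasFDerivAt.comp x (hF' x)).add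
      (hZ.contDiff.differentiable (by simp) x).hasFDerivAt
    refine h1.congr_fderiv (ContinuousLinearMap.ext fun v => ?_)
    have h2 := hZF x v
    simp [h2]
  have hconst := eq_of_fderiv_eq_zero (f := fun y => Z (F y) + Z y)
    (fun x => (hsum x).differentiableAt) fun x => (hsum x).fderiv
  -- F acts as Z ↦ C - Z, so the point with Z = C/2 is fixed. There dφ ∘ F' = dφ gives F' = id,
  -- against F' reversing the nonzero coordinate field.
  obtain ⟨p, hp⟩ := hZ.bijective.2 ((Z (F 0) + Z 0) / 2)
  have hfix : F p = p := hZ.bijective.1 (by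
    have h1 := hconst p 0
    rw [hp] at h1 ⊢
    linear_combination h1)
  have h1 := hw p
  rw [hfix] at h1
  have h2 : F' p (coordField Z h p) = coordField Z h p := by
    apply hinj p
    have h3 := hd p (coordField Z h p)
    rwa [hfix] at h3
  rw [h2] at h1
  have h4 := congrArg (fderiv ℝ Z p) h1
  rw [map_neg, hZ.fderiv_coordField] at h4
  exact h0 (self_eq_neg.1 h4)

/-- Both fields are multiples a, a' of one generator. Applying `abs_le_of_sameRuled` in both
directions leaves a = -a' ≠ 0, and the lifted isomorphism would then reverse the generator. -/
theorem not_sameRuled (hcone : N.IsTwoSidedCone) (hSL : N.IsSpecialLagrangian)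
    {Z : ℝ × ℝ → ℂ} (hZ : IsGlobalCoordinate N.rot 2 Z) {w w' : N.antiInvariantFields N.rot}
    (hne : w ≠ w') : ¬ (N.translate hcone hSL w).SameRuled (N.translate hcone hSL w') := by
  intro hs
  obtain ⟨h, h0, hm, hg⟩ := exists_field_generator hcone hSL hZ
  obtain ⟨a, ha⟩ := hg w w.2
  obtain ⟨a', ha'⟩ := hg w' w'.2
  have hz : coordField Z h 0 ≠ 0 := fun hz => by
    have h1 := hZ.fderiv_coordField h 0
    rw [hz, map_zero] at h1
    exact h0 h1.symm
  have habs : |a| = |a'| := le_antisymm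
    (abs_le_of_sameRuled (w₀ := ⟨_, hm⟩) hcone hSL ha ha' hz hs)
    (abs_le_of_sameRuled (w₀ := ⟨_, hm⟩) hcone hSL ha' ha hz hs.symm)
  have haa : a ≠ a' := fun haa => hne (Subtype.ext (by rw [ha, ha', haa]))
  have hneg : a = -a' := (abs_eq_abs.1 habs).resolve_left haa
  have ha0 : a' ≠ 0 := fun h => haa (by rw [hneg, h, neg_zero])
  obtain ⟨F, hF, hdir, hvar⟩ := SameRuled.exists_lift hcone hSL hs
  refine not_exists_reversing_lift hcone hSL hZ h0 hF hdir fun x => ?_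
  have h1 := hvar x
  rw [ha, ha', variation_smul, variation_smul, hneg, neg_smul, ← smul_neg] at h1
  exact smul_right_injective C3 ha0 h1

end RuledThreefold

end KleinCovering

theorem theorem6p4 (N₀ : RuledThreefold) (hcone : N₀.IsTwoSidedCone)
    (hSL : N₀.IsSpecialLagrangian) :
    ¬ N₀.ROrientable ∧
    ∃ J : ℝ × ℝ → (ℝ × ℝ →L[ℝ] ℝ × ℝ), N₀.IsComplexStructure J ∧
      Module.finrank ℝ (N₀.antiInvariantFields J) = 1 ∧
      ∃ N : N₀.antiInvariantFields J → RuledThreefold,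
        (∀ w, (N w).dir = N₀.dir ∧
          (∀ x, (N w).foot x = fderiv ℝ N₀.dir x ((w : ℝ × ℝ → ℝ × ℝ) x)) ∧
          (N w).IsSpecialLagrangian ∧
          ¬ (N w).ROrientable ∧
          (N w).asymptoticCone = Set.range N₀.imm ∧
          (N w).AsymptoticTo N₀ (-1)) ∧
        ∀ w w', w ≠ w' → ¬ (N w).SameRuled (N w') := by
  open RuledThreefold in
  -- The first period is 2, because only the deck transformations with even m preserve φ and J.
  obtain ⟨Z, hZ⟩ := exists_globalCoordinate two_ne_zero (contDiff_rot hcone hSL)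
    (rot_rot hcone hSL) (rot_add_period hcone hSL)
  refine ⟨not_rOrientable hcone hSL rfl, N₀.rot, isComplexStructure_rot hcone hSL,
    finrank_antiInvariantFields hcone hSL hZ, N₀.translate hcone hSL, fun w => ?_, fun w w' h =>
      not_sameRuled hcone hSL hZ h⟩
  exact ⟨rfl, fun x => rfl, isSpecialLagrangian_translate hcone hSL w,
    not_rOrientable hcone hSL rfl, asymptoticCone_translate hcone hSL w,
    asymptoticTo_translate hcone hSL w⟩
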